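/- Let $n\ge 1$ and $\mathrm{Sp}_{2n}(\mathbb R)=\{g\in \mathrm{GL}_{2n}(\mathbb R): {}^tgJg=J\}$, $J=\begin{bmatrix}0&1_n\\-1_n&0\end{bmatrix}$, and let $K=\mathrm{Sp}_{2n}(\mathbb R)\cap \mathrm O(2n)$, equipped with its Haar measure $dk$ of total mass $1$. Let $\mathbb H_n$ be the Siegel upper half space of complex symmetric matrices $Z=X+iY$ with $X,Y$ real and $Y$ positive definite, on which $\mathrm{Sp}_{2n}(\mathbb R)$ acts by $\begin{bmatrix}A&B\\C&D\end{bmatrix}Z=(AZ+B)(CZ+D)^{-1}$, and put $I=i1_n$. Lebesgue measure on real symmetric matrices means $\prod_{i\le j}dx_{ij}$. There is exactly one Haar measure $dh$ on $\mathrm{Sp}_{2n}(\mathbb R)$ such that $$\int_{\mathrm{Sp}_{2n}(\mathbb R)} F(h)\,dh=\int_{\mathbb H_n} f(Z)\det(Y)^{-(n+1)}\,dX\,dY\qquad(\ast)$$ for every measurable right $K$-invariant function $F:\mathrm{Sp}_{2n}(\mathbb R)\to[0,\infty]$, where $f$ is given by $F(g)=f(gI)$. For this measure the following hold. (1) (KAK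 measure) Let $\mathfrak a^+=\{H=\mathrm{diag}(a_1,\dots,a_n,-a_1,\dots,-a_n): a_1<\dots<a_n<0\}$ with Lebesgue measure $dH=da_1\cdots da_n$, let $e_i(H)=a_i$, and let $\Sigma^+=\{e_j-e_i:1\le i<j\le n\}\cup\{-e_i-e_j:1\le i\le j\le n\}$. A constant $\alpha_n>0$ satisfies $$\int_{\mathrm{Sp}_{2n}(\mathbb R)}\phi(h)\,dh=\alpha_n\int_K\int_{\mathfrak a^+}\int_K\Big(\prod_{\lambda\in\Sigma^+}\sinh(\lambda(H))\Big)\phi(k_1\exp(H)k_2)\,dk_1\,dH\,dk_2$$ for all continuous $\phi:\mathrm{Sp}_{2n}(\mathbb R)\to[0,\infty)$ (integrals taken in $[0,\infty]$) if and only if $$\alpha_n=\frac{(4\pi)^{n(n+1)/2}}{\prod_{m=1}^n(m-1)!}.$$ (2) (Iwasawa measure) Let $A=\{\mathrm{diag}(a_1,\dots,a_n,a_1^{-1},\dots,a_n^{-1}):a_1,\dots,a_n>0\}$ with $da=\frac{da_1}{a_1}\cdots\frac{da_n}{a_n}$, and let $N$ be the group of all $\begin{bmatrix}U&\\&{}^tU^{-1}\end{bmatrix}\begin{bmatrix}1_n&X\\&1_n\end{bmatrix}$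 with $U$ real upper triangular unipotent and $X$ real symmetric, with the Lebesgue measure $dn=\prod_{i<j}du_{ij}\prod_{i\le j}dx_{ij}$. Then $$\int_{\mathrm{Sp}_{2n}(\mathbb R)}F(h)\,dh=2^n\int_A\int_N\int_K F(ank)\,dk\,dn\,da$$ for every measurable $F:\mathrm{Sp}_{2n}(\mathbb R)\to[0,\infty]$, and for every $F:\mathrm{Sp}_{2n}(\mathbb R)\to\mathbb C$ that is integrable with respect to $dh$. -/

import Mathlib

open MeasureTheory
open scoped Matrix ENNReal

/-- The real symplectic group of size `2n`, with its topology as a subspace of the matrices. -/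
abbrev Sp (n : ℕ) : Type := ↥(Matrix.symplecticGroup (Fin n) ℝ)

/-- The Borel sigma-algebra on the symplectic group. -/
instance Sp.instMeasurableSpace (n : ℕ) : MeasurableSpace (Sp n) := borel (Sp n)

instance Sp.instBorelSpace (n : ℕ) : BorelSpace (Sp n) := ⟨rfl⟩

/-- The maximal compact subgroup, the orthogonal symplectic matrices. -/
def maxCompact (n : ℕ) : Subgroup (Sp n) where
  carrier := {g | (g : Matrix (Fin n ⊕ Fin n) (Fin n ⊕ Fin n) ℝ) ∈
    Matrix.orthogonalGroup (Fin n ⊕ Fin n) ℝ}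
  mul_mem' {a b} ha hb := by
    simpa using mul_mem ha hb
  one_mem' := by
    simp
  inv_mem' {a} ha := by
    have h1 := (Matrix.mem_orthogonalGroup_iff _ _).1 ha
    have h2 := (Matrix.mem_orthogonalGroup_iff' _ _).1 ha
    have h3 : ((a⁻¹ : Sp n) : Matrix (Fin n ⊕ Fin n) (Fin n ⊕ Fin n) ℝ) =
        star (a : Matrix (Fin n ⊕ Fin n) (Fin n ⊕ Fin n) ℝ) := by
      rw [SymplecticGroup.coe_inv']
      exact Matrix.inv_eq_right_inv h1
    change ((a⁻¹ : Sp n) : Matrix (Fin n ⊕ Fin n) (Fin n ⊕ Fin n) ℝ) ∈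
      Matrix.orthogonalGroup (Fin n ⊕ Fin n) ℝ
    rw [h3, Matrix.mem_orthogonalGroup_iff]
    simpa [Matrix.star_eq_conjTranspose, Matrix.conjTranspose_eq_transpose_of_trivial] using h2

/-! ### The Siegel upper half space -/

/-- Pairs `i ≤ j`: the positions of the independent entries of a symmetric matrix. -/
abbrev UpperPairs (n : ℕ) : Type := {p : Fin n × Fin n // p.1 ≤ p.2}

/-- Pairs `i < j`: the positions strictly above the diagonal. -/
abbrev StrictPairs (n : ℕ) : Type := {p : Fin n × Fin n // p.1 < p.2}

/-- The symmetric matrix with entries `x (i, j)`, `i ≤ j`, on and above the diagonal.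
Lebesgue measure on symmetric matrices is Lebesgue measure in these coordinates. -/
def symMatrix {n : ℕ} (x : UpperPairs n → ℝ) : Matrix (Fin n) (Fin n) ℝ :=
  Matrix.of fun i j => x ⟨(min i j, max i j), min_le_max⟩

/-- The Siegel upper half space: complex symmetric matrices with positive definite imaginary
part. -/
def siegelUpperHalfSpace (n : ℕ) : Set (Matrix (Fin n) (Fin n) ℂ) :=
  {Z | Z.IsSymm ∧ (Z.map Complex.im).PosDef}

/-- The complex matrix `X + iY` with the symmetric matrices `X`, `Y` given in coordinates. -/
noncomputable def complexSym {n : ℕ} (p : (UpperPairs n → ℝ) × (UpperPairs n → ℝ)) :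
    Matrix (Fin n) (Fin n) ℂ :=
  (symMatrix p.1).map Complex.ofReal + Complex.I • (symMatrix p.2).map Complex.ofReal

/-- The action `Z ↦ (AZ + B)(CZ + D)⁻¹` of the symplectic group. -/
noncomputable def siegelAct {n : ℕ} (g : Sp n) (Z : Matrix (Fin n) (Fin n) ℂ) :
    Matrix (Fin n) (Fin n) ℂ :=
  let M : Matrix (Fin n ⊕ Fin n) (Fin n ⊕ Fin n) ℂ :=
    (g : Matrix (Fin n ⊕ Fin n) (Fin n ⊕ Fin n) ℝ).map Complex.ofReal
  (M.toBlocks₁₁ * Z + M.toBlocks₁₂) * (M.toBlocks₂₁ * Z + M.toBlocks₂₂)⁻¹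

/-- The base point `i · 1`. -/
noncomputable def basePoint (n : ℕ) : Matrix (Fin n) (Fin n) ℂ := Complex.I • 1

/-- The classical Haar measure on the symplectic group: the integral of a right `K`-invariant
function, that is, of a function of the form `g ↦ f (g · i1)`, is the integral of `f` over the
Siegel upper half space against `det(Y)^{-(n+1)} dX dY`. -/
def IsClassicalHaar {n : ℕ} (μ : Measure (Sp n)) : Prop :=
  μ.IsHaarMeasure ∧
  ∀ f : Matrix (Fin n) (Fin n) ℂ → ℝ≥0∞,
    Measurable (fun g : Sp n => f (siegelAct g (basePoint n))) →
    ∫⁻ g, f (siegelAct g (basePoint n)) ∂μ =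
      ∫⁻ p in {p : (UpperPairs n → ℝ) × (UpperPairs n → ℝ) |
          complexSym p ∈ siegelUpperHalfSpace n},
        f (complexSym p) * ENNReal.ofReal (((symMatrix p.2).det ^ (n + 1))⁻¹)

/-! ### The diagonal and the unipotent subgroups -/

/-- Vectors with positive entries. -/
abbrev PosVec (n : ℕ) : Type := {a : Fin n → ℝ // ∀ i, 0 < a i}

/-- The measure `da = (da₁ / a₁) ⋯ (daₙ / aₙ)` on vectors with positive entries. -/
noncomputable def diagMeasure (n : ℕ) : Measure (PosVec n) :=
  (Measure.comap Subtype.val (volume : Measure (Fin n → ℝ))).withDensity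
    fun a => ENNReal.ofReal (∏ i, (a.1 i)⁻¹)

/-- The element `diag(a₁, …, aₙ, a₁⁻¹, …, aₙ⁻¹)` of the symplectic group. -/
noncomputable def diagSp {n : ℕ} (a : PosVec n) : Sp n :=
  ⟨Matrix.fromBlocks (Matrix.diagonal a.1) 0 0 (Matrix.diagonal fun i => (a.1 i)⁻¹), by
    rw [SymplecticGroup.fromBlocks_mem_iff]
    refine ⟨by simp, by simp, ?_⟩
    ext i j
    by_cases h : i = j
    · subst h
      simp [(a.2 i).ne']
    · simp [h]⟩

/-- The element `exp(H)` for `H = diag(a₁, …, aₙ, -a₁, …, -aₙ)`. -/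
noncomputable def expSp {n : ℕ} (a : Fin n → ℝ) : Sp n :=
  diagSp ⟨fun i => Real.exp (a i), fun i => Real.exp_pos (a i)⟩

theorem coe_expSp {n : ℕ} (a : Fin n → ℝ) :
    (expSp a : Matrix (Fin n ⊕ Fin n) (Fin n ⊕ Fin n) ℝ) =
      NormedSpace.exp (Matrix.diagonal (Sum.elim a fun i => -a i)) := by
  rw [Matrix.exp_diagonal]
  ext (i | i) (j | j) <;>
    simp [expSp, diagSp, Matrix.diagonal_apply, Real.exp_eq_exp_ℝ, Pi.exp_def,
      NormedSpace.exp_neg]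

/-- The upper triangular unipotent matrix with entries `v (i, j)`, `i < j`, above the diagonal. -/
def unipotentMatrix {n : ℕ} (v : StrictPairs n → ℝ) : Matrix (Fin n) (Fin n) ℝ :=
  Matrix.of fun i j => if h : i < j then v ⟨(i, j), h⟩ else if i = j then 1 else 0

theorem det_unipotentMatrix {n : ℕ} (v : StrictPairs n → ℝ) : (unipotentMatrix v).det = 1 := by
  rw [Matrix.det_of_isUpperTriangular]
  · simp [unipotentMatrix]
  · intro i j hij
    have hij' : j < i := hij
    simp [unipotentMatrix, hij'.not_gt, hij'.ne']

/-- The element `[U, 0; 0, ᵗU⁻¹]` of the symplectic group, with `U` upper triangular unipotent. -/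
noncomputable def leviUnipotentSp {n : ℕ} (v : StrictPairs n → ℝ) : Sp n :=
  ⟨Matrix.fromBlocks (unipotentMatrix v) 0 0 ((unipotentMatrix v)ᵀ)⁻¹, by
    rw [SymplecticGroup.fromBlocks_mem_iff]
    refine ⟨by simp, by simp, ?_⟩
    rw [Matrix.mul_nonsing_inv _ (by simp [Matrix.det_transpose, det_unipotentMatrix])]
    simp⟩

theorem symMatrix_transpose {n : ℕ} (x : UpperPairs n → ℝ) : (symMatrix x)ᵀ = symMatrix x := by
  ext i j
  simp [symMatrix, min_comm, max_comm]

/-- The element `[1, X; 0, 1]` of the symplectic group, with `X` symmetric. -/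
def siegelUnipotentSp {n : ℕ} (x : UpperPairs n → ℝ) : Sp n :=
  ⟨Matrix.fromBlocks 1 (symMatrix x) 0 1, by
    rw [SymplecticGroup.fromBlocks_mem_iff]
    exact ⟨by simp, by simp [symMatrix_transpose], by simp⟩⟩

/-- The general element of the unipotent radical `N` of the Borel subgroup, in the coordinates
`(v, x)`; the measure on `N` is Lebesgue measure in these coordinates. -/
noncomputable def unipotentSp {n : ℕ} (p : (StrictPairs n → ℝ) × (UpperPairs n → ℝ)) : Sp n :=
  leviUnipotentSp p.1 * siegelUnipotentSp p.2

/-! ### The KAK integral -/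

/-- The positive Weyl chamber `a₁ < ⋯ < aₙ < 0`. -/
def weylChamber (n : ℕ) : Set (Fin n → ℝ) := {a | StrictMono a ∧ ∀ i, a i < 0}

/-- The product of `sinh (λ(H))` over the positive roots `eⱼ - eᵢ` (`i < j`) and `-eᵢ - eⱼ`
(`i ≤ j`). -/
noncomputable def sinhRootProduct {n : ℕ} (a : Fin n → ℝ) : ℝ :=
  (∏ p : StrictPairs n, Real.sinh (a p.1.2 - a p.1.1)) *
    ∏ p : UpperPairs n, Real.sinh (-a p.1.1 - a p.1.2)

/-- The integration formula for the KAK decomposition holds with the constant `α`, for all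
continuous non-negative functions. The integrals are taken in `[0, ∞]`. -/
def IsKAKConstant {n : ℕ} (μ : Measure (Sp n)) (κ : Measure (maxCompact n)) (α : ℝ) : Prop :=
  ∀ φ : Sp n → ℝ, Continuous φ → (∀ g, 0 ≤ φ g) →
    ∫⁻ g, ENNReal.ofReal (φ g) ∂μ =
      ENNReal.ofReal α * ∫⁻ k₂ : maxCompact n, (∫⁻ a in weylChamber n, (∫⁻ k₁ : maxCompact n,
        ENNReal.ofReal (sinhRootProduct a * φ ((k₁ : Sp n) * expSp a * (k₂ : Sp n))) ∂κ)) ∂κ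

/-!
# The classical Haar measure on the real symplectic group

The Haar measure is constructed from the Iwasawa decomposition: `iwasawaHaar κ` is `2 ^ n` times the
image of `da dn dk` under `(a, n, k) ↦ a n k`. A function on the group and its average over right
translations by the maximal compact subgroup `K` have the same integral, and the average is a
function on the upper half space. In the coordinates `a n · i1`, which are the Cholesky
factorization `Y = T ᵗT` together with `X ↦ T X ᵗT`, the Jacobian (`abs_det_iwasawaMap`) turns the
integral of a right `K`-invariant function into the integral against `det(Y)^{-(n+1)} dX dY`
(`lintegral_iwasawaHaar_siegelAct`). The differential of a fractional linear transformation is a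
congruence of symmetric matrices, whose determinant is a power of that of the automorphy factor
(`det_congrSym`, `IsSimilitude.lintegral_image_mobius`); hence the measure on the upper half space
is invariant, and `iwasawaHaar κ` is left invariant (`lintegral_iwasawaHaar_mul_left`). Uniqueness
follows by testing two Haar measures on one right `K`-invariant compact neighbourhood of the
identity (`IsClassicalHaar.eq_iwasawaHaar`). The Iwasawa integration formulas then hold by Fubini.

For the `KAK` formula the upper half space is mapped by the Cayley transform to the disc of
symmetric contractions `W`, on which `K`, a copy of the unitary group, acts by `W ↦ u W ᵗu`. The
Autonne–Takagi factorization `W = u diag (tanh a) ᵗu` (`exists_takagi`, `takagi_unique`) gives polar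
coordinates on the disc. Its Jacobian is computed in the chart of the unitary group given by the
Cayley transform of skew-Hermitian matrices (`abs_det_takagiMat`); multiplied by the density of the
invariant measure on the disc it becomes the product of the `sinh` of the positive roots, up to a
power of two (`discDensity_mul_takagiWeight`).

Only a small open set `O` of the unitary group has to be covered by the chart. By averaging over `K`
(`lintegral_mul_measure_eq_setLIntegral`), the integral of a bi-invariant function is determined by
its integral over the points with polar coordinates in `O` and in the chamber. The stabilizer of a
regular point of the chamber consists of the `2 ^ n` diagonal matrices of signs, which accounts for
a factor `2 ^ n`. What remains is the ratio of the volume of `O` in the chart to its Haar measure.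
The same averaging argument for the right action of the unitary group on all complex matrices, in
the coordinates of the `QR` decomposition and with a Gaussian as test function, gives this ratio as
a quotient of Gaussian integrals (`lintegral_cayleyWeight`). Together these give the formula for
bi-invariant functions (`lintegral_iwasawaHaar_polar`), and averaging on both sides gives it for
all continuous functions (`lintegral_iwasawaHaar_kak`). The constant is determined by the value of
both sides on a bump function (`isKAKConstant_iwasawaHaar_iff`).
-/


/-! ### Determinants of congruence and of triangular multiplication -/

/-- The symmetric matrix with entries `x (i, j)`, `i ≤ j`, over any coefficients. -/
def symMat {R : Type*} {n : ℕ} (x : UpperPairs n → R) : Matrix (Fin n) (Fin n) R :=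
  Matrix.of fun i j => x ⟨(min i j, max i j), min_le_max⟩

/-- The entries of a matrix on and above the diagonal. -/
def upperEntries {R : Type*} {n : ℕ} (M : Matrix (Fin n) (Fin n) R) : UpperPairs n → R :=
  fun p => M p.1.1 p.1.2

/-- The strictly upper triangular matrix with entries `v (i, j)`, `i < j`. -/
def strictMat {R : Type*} [Zero R] {n : ℕ} (v : StrictPairs n → R) : Matrix (Fin n) (Fin n) R :=
  Matrix.of fun i j => if h : i < j then v ⟨(i, j), h⟩ else 0

/-- The entries of a matrix strictly above the diagonal. -/
def strictEntries {R : Type*} {n : ℕ} (M : Matrix (Fin n) (Fin n) R) : StrictPairs n → R :=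
  fun p => M p.1.1 p.1.2

section Coordinates

variable {R : Type*} {n : ℕ}

theorem symMat_apply (x : UpperPairs n → R) (i j : Fin n) :
    symMat x i j = x ⟨(min i j, max i j), min_le_max⟩ := rfl

theorem symMat_apply_of_le (x : UpperPairs n → R) {i j : Fin n} (h : i ≤ j) :
    symMat x i j = x ⟨(i, j), h⟩ := by
  rw [symMat_apply]
  congr 2
  rw [min_eq_left h, max_eq_right h]

theorem symMat_comm (x : UpperPairs n → R) (i j : Fin n) : symMat x i j = symMat x j i := by
  simp [symMat_apply, min_comm, max_comm]

theorem symMat_transpose (x : UpperPairs n → R) : (symMat x)ᵀ = symMat x := by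
  ext i j
  exact symMat_comm x j i

theorem symMat_isSymm (x : UpperPairs n → R) : (symMat x).IsSymm := symMat_transpose x

@[simp]
theorem upperEntries_symMat (x : UpperPairs n → R) : upperEntries (symMat x) = x := by
  ext ⟨⟨i, j⟩, h⟩
  exact symMat_apply_of_le x h

theorem symMat_upperEntries {M : Matrix (Fin n) (Fin n) R} (hM : M.IsSymm) :
    symMat (upperEntries M) = M := by
  ext i j
  rcases le_total i j with h | h
  · rw [symMat_apply_of_le _ h]; rfl
  · rw [symMat_comm, symMat_apply_of_le _ h]; exact hM.apply i j

theorem symMat_injective : Function.Injective (symMat : (UpperPairs n → R) → _) :=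
  Function.LeftInverse.injective upperEntries_symMat

theorem strictMat_apply_of_lt [Zero R] (v : StrictPairs n → R) {i j : Fin n} (h : i < j) :
    strictMat v i j = v ⟨(i, j), h⟩ := by
  simp [strictMat, h]

theorem strictMat_apply_of_le [Zero R] (v : StrictPairs n → R) {i j : Fin n} (h : j ≤ i) :
    strictMat v i j = 0 := by
  simp [strictMat, h.not_gt]

@[simp]
theorem strictEntries_strictMat [Zero R] (v : StrictPairs n → R) :
    strictEntries (strictMat v) = v := by
  ext ⟨⟨i, j⟩, h⟩
  exact strictMat_apply_of_lt v h

theorem strictMat_strictEntries [Zero R] {M : Matrix (Fin n) (Fin n) R}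
    (hM : ∀ i j, j ≤ i → M i j = 0) : strictMat (strictEntries M) = M := by
  ext i j
  rcases lt_or_ge i j with h | h
  · rw [strictMat_apply_of_lt _ h]; rfl
  · rw [strictMat_apply_of_le _ h, hM i j h]

theorem symMat_add [Add R] (x y : UpperPairs n → R) : symMat (x + y) = symMat x + symMat y := rfl

theorem symMat_smul {S : Type*} [SMul S R] (c : S) (x : UpperPairs n → R) :
    symMat (c • x) = c • symMat x := rfl

theorem strictMat_add [AddZeroClass R] (x y : StrictPairs n → R) :
    strictMat (x + y) = strictMat x + strictMat y := by
  ext i j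
  by_cases h : i < j <;> simp [strictMat, h]

theorem strictMat_smul {S : Type*} [Zero R] [SMulZeroClass S R] (c : S) (x : StrictPairs n → R) :
    strictMat (c • x) = c • strictMat x := by
  ext i j
  by_cases h : i < j <;> simp [strictMat, h]

end Coordinates

theorem prod_upperPairs {M : Type*} [CommMonoid M] {n : ℕ} (f : Fin n → Fin n → M) :
    ∏ p : UpperPairs n, f p.1.1 p.1.2 = ∏ i, ∏ j, if i ≤ j then f i j else 1 := by
  rw [← Fintype.prod_prod_type', Finset.prod_ite, Finset.prod_const_one, mul_one]
  exact (Finset.prod_subtype _ (by simp) fun p : Fin n × Fin n => f p.1 p.2).symm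

theorem prod_strictPairs {M : Type*} [CommMonoid M] {n : ℕ} (f : Fin n → Fin n → M) :
    ∏ p : StrictPairs n, f p.1.1 p.1.2 = ∏ i, ∏ j, if i < j then f i j else 1 := by
  rw [← Fintype.prod_prod_type', Finset.prod_ite, Finset.prod_const_one, mul_one]
  exact (Finset.prod_subtype _ (by simp) fun p : Fin n × Fin n => f p.1 p.2).symm

/-- Each index lies in `n + 1` of the pairs `i ≤ j`, the diagonal pair counted twice. -/
theorem prod_upperPairs_mul {M : Type*} [CommMonoid M] {n : ℕ} (d : Fin n → M) :
    ∏ p : UpperPairs n, (d p.1.1 * d p.1.2) = (∏ i, d i) ^ (n + 1) := by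
  rw [Finset.prod_mul_distrib, prod_upperPairs fun i _ => d i, prod_upperPairs fun _ j => d j,
    Finset.prod_comm (f := fun i j => if i ≤ j then d j else 1), ← Finset.prod_mul_distrib,
    ← Finset.prod_pow]
  refine Finset.prod_congr rfl fun i _ => ?_
  have h1 : (Finset.univ.filter fun j : Fin n => i ≤ j) = Finset.Ici i := by ext; simp
  have h2 : (Finset.univ.filter fun j : Fin n => j ≤ i) = Finset.Iic i := by ext; simp
  rw [Finset.prod_ite, Finset.prod_ite, Finset.prod_const_one, Finset.prod_const_one, mul_one,
    mul_one, Finset.prod_const, Finset.prod_const, ← pow_add, h1, h2, Fin.card_Ici, Fin.card_Iic]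
  congr 1
  omega

theorem LinearMap.det_one_add_of_isNilpotent {𝕜 V : Type*} [Field 𝕜] [AddCommGroup V] [Module 𝕜 V]
    [FiniteDimensional 𝕜 V] {N : Module.End 𝕜 V} (hN : IsNilpotent N) :
    LinearMap.det (1 + N) = 1 := by
  have h := (hN.neg).charpoly_eq_X_pow_finrank
  have h2 := LinearMap.det_eq_sign_charpoly_coeff (1 + N)
  have h3 := congrArg (Polynomial.eval 1) h
  rw [LinearMap.eval_charpoly] at h3
  simpa using h3

theorem LinearMap.det_pi_smul {𝕜 ι : Type*} [Field 𝕜] [Fintype ι] (c : ι → 𝕜)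
    (f : (ι → 𝕜) →ₗ[𝕜] (ι → 𝕜)) (hf : ∀ x i, f x i = c i * x i) : LinearMap.det f = ∏ i, c i := by
  classical
  have : f = Matrix.toLin' (Matrix.diagonal c) := by
    ext x i
    simp [hf, Matrix.mulVec_diagonal]
  rw [this, LinearMap.det_toLin', Matrix.det_diagonal]

/-- The congruence `X ↦ T X ᵗT` of symmetric matrices. -/
def congrSym {𝕜 : Type*} [Field 𝕜] {n : ℕ} (T : Matrix (Fin n) (Fin n) 𝕜) :
    (UpperPairs n → 𝕜) →ₗ[𝕜] (UpperPairs n → 𝕜) where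
  toFun x := upperEntries (T * symMat x * Tᵀ)
  map_add' x y := by rw [symMat_add, mul_add, add_mul]; rfl
  map_smul' c x := by rw [symMat_smul, Matrix.mul_smul, Matrix.smul_mul]; rfl

section Congruence

variable {𝕜 : Type*} [Field 𝕜] {n : ℕ}

theorem symMat_congrSym (T : Matrix (Fin n) (Fin n) 𝕜) (x : UpperPairs n → 𝕜) :
    symMat (congrSym T x) = T * symMat x * Tᵀ := by
  refine symMat_upperEntries (M := T * symMat x * Tᵀ) ?_
  simp [Matrix.IsSymm, Matrix.transpose_mul, symMat_transpose, Matrix.mul_assoc]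

theorem congrSym_mul (S T : Matrix (Fin n) (Fin n) 𝕜) :
    congrSym (S * T) = congrSym S ∘ₗ congrSym T := by
  refine LinearMap.ext fun x => symMat_injective ?_
  simp [symMat_congrSym, Matrix.transpose_mul, Matrix.mul_assoc]

theorem congrSym_one : congrSym (1 : Matrix (Fin n) (Fin n) 𝕜) = LinearMap.id := by
  refine LinearMap.ext fun x => symMat_injective ?_
  simp [symMat_congrSym]

/-- For a transvection `T` the determinant equals its own square, because `T ^ 2` is conjugate to
`T` by a diagonal matrix. -/
theorem det_congrSym [CharZero 𝕜] {T : Matrix (Fin n) (Fin n) 𝕜} (hT : T.det ≠ 0) :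
    LinearMap.det (congrSym T) = T.det ^ (n + 1) := by
  have hmul (S T : Matrix (Fin n) (Fin n) 𝕜) :
      LinearMap.det (congrSym (S * T)) =
        LinearMap.det (congrSym S) * LinearMap.det (congrSym T) := by
    rw [congrSym_mul, LinearMap.det_comp]
  have hne {S S' : Matrix (Fin n) (Fin n) 𝕜} (h : S * S' = 1) :
      LinearMap.det (congrSym S) * LinearMap.det (congrSym S') = 1 := by
    rw [← hmul, h, congrSym_one, LinearMap.det_id]
  refine Matrix.diagonal_transvection_induction_of_det_ne_zero
    (fun T => LinearMap.det (congrSym T) = T.det ^ (n + 1)) T hT ?_ ?_ ?_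
  · intro D _
    rw [Matrix.det_diagonal, ← prod_upperPairs_mul]
    refine LinearMap.det_pi_smul _ _ fun x p => ?_
    change (Matrix.diagonal D * symMat x * (Matrix.diagonal D)ᵀ) p.1.1 p.1.2 = _
    rw [Matrix.diagonal_transpose, Matrix.mul_diagonal, Matrix.diagonal_mul,
      symMat_apply_of_le _ p.2]
    ring
  · intro t
    rw [Matrix.TransvectionStruct.det, one_pow]
    obtain ⟨i, j, hij, c⟩ := t
    simp only [Matrix.TransvectionStruct.toMatrix]
    set D : Matrix (Fin n) (Fin n) 𝕜 := Matrix.diagonal (Function.update 1 i 2)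
    set D' : Matrix (Fin n) (Fin n) 𝕜 := Matrix.diagonal (Function.update 1 i 2⁻¹)
    have hDD : D * D' = 1 := by
      rw [Matrix.diagonal_mul_diagonal, ← Matrix.diagonal_one]
      congr 1
      ext k
      by_cases h : k = i <;> simp [h]
    have hconj : D * Matrix.transvection i j c * D' =
        Matrix.transvection i j c * Matrix.transvection i j c := by
      rw [Matrix.transvection_mul_transvection_same i j hij]
      ext k l
      rw [Matrix.mul_diagonal, Matrix.diagonal_mul]
      simp only [Matrix.transvection, Matrix.add_apply, Matrix.single_apply, Matrix.one_apply,
        Function.update_apply, Pi.one_apply]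
      grind
    have h1 := congrArg (fun M => LinearMap.det (congrSym M)) hconj
    simp only [hmul] at h1
    have h2 : LinearMap.det (congrSym (Matrix.transvection i j c)) ≠ 0 := by
      refine left_ne_zero_of_mul_eq_one
        (b := LinearMap.det (congrSym (Matrix.transvection i j (-c)))) (hne ?_)
      rw [Matrix.transvection_mul_transvection_same i j hij, add_neg_cancel,
        Matrix.transvection_zero]
    have h3 := hne hDD
    refine mul_left_cancel₀ h2 ?_
    rw [← h1, mul_one]
    linear_combination LinearMap.det (congrSym (Matrix.transvection i j c)) * h3
  · intro A B _ _ hA hB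
    rw [hmul, hA, hB, Matrix.det_mul, mul_pow]

theorem abs_det_restrictScalars {V : Type*} [AddCommGroup V] [Module ℂ V] [Module ℝ V]
    [IsScalarTower ℝ ℂ V] (f : V →ₗ[ℂ] V) :
    |LinearMap.det (f.restrictScalars ℝ)| = ‖LinearMap.det f‖ ^ 2 := by
  rw [LinearMap.det_restrictScalars, Algebra.norm_complex_apply, Complex.normSq_eq_norm_sq, abs_sq]

/-- Left multiplication by an upper triangular matrix on strictly upper triangular matrices. -/
def strictMul (U : Matrix (Fin n) (Fin n) 𝕜) :
    (StrictPairs n → 𝕜) →ₗ[𝕜] (StrictPairs n → 𝕜) where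
  toFun v := strictEntries (U * strictMat v)
  map_add' x y := by rw [strictMat_add, mul_add]; rfl
  map_smul' c x := by rw [strictMat_smul, Matrix.mul_smul]; rfl

theorem mul_strictMat_apply_of_le {U : Matrix (Fin n) (Fin n) 𝕜} (hU : U.IsUpperTriangular)
    (v : StrictPairs n → 𝕜) {i j : Fin n} (h : j ≤ i) : (U * strictMat v) i j = 0 := by
  rw [Matrix.mul_apply]
  refine Finset.sum_eq_zero fun k _ => ?_
  rcases lt_or_ge k i with hk | hk
  · rw [hU hk, zero_mul]
  · rw [strictMat_apply_of_le _ (h.trans hk), mul_zero]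

theorem strictMat_strictMul {U : Matrix (Fin n) (Fin n) 𝕜} (hU : U.IsUpperTriangular)
    (v : StrictPairs n → 𝕜) : strictMat (strictMul U v) = U * strictMat v :=
  strictMat_strictEntries fun _ _ h => mul_strictMat_apply_of_le hU v h

theorem isUpperTriangular_strictMat (v : StrictPairs n → 𝕜) : (strictMat v).IsUpperTriangular :=
  fun _ _ h => strictMat_apply_of_le v (le_of_lt h)

theorem isNilpotent_strictMat (v : StrictPairs n → 𝕜) : IsNilpotent (strictMat v) := by
  have h := Matrix.aeval_self_charpoly (strictMat v)
  rw [Matrix.charpoly_of_isUpperTriangular _ (isUpperTriangular_strictMat v)] at h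
  refine ⟨n, ?_⟩
  simpa [strictMat_apply_of_le] using h

/-- Left multiplication by a unipotent matrix is a unipotent map. -/
theorem det_strictMul_unipotent (w : StrictPairs n → 𝕜) :
    LinearMap.det (strictMul (1 + strictMat w)) = 1 := by
  have h1 : strictMul (1 + strictMat w) = 1 + strictMul (strictMat w) := by
    refine LinearMap.ext fun v => ?_
    change strictEntries ((1 + strictMat w) * strictMat v) =
      v + strictEntries (strictMat w * strictMat v)
    ext p
    simp [strictEntries, add_mul, strictMat_apply_of_lt v p.2]
  rw [h1]
  refine LinearMap.det_one_add_of_isNilpotent ?_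
  obtain ⟨k, hk⟩ := isNilpotent_strictMat w
  refine ⟨k, LinearMap.ext fun v => ?_⟩
  have (k : ℕ) : strictMat ((strictMul (strictMat w) ^ k) v) = strictMat w ^ k * strictMat v := by
    induction k with
    | zero => simp
    | succ k ih =>
      rw [pow_succ', Module.End.mul_apply, strictMat_strictMul (isUpperTriangular_strictMat w), ih,
        pow_succ', Matrix.mul_assoc]
  have h2 := this k
  rw [hk, zero_mul] at h2
  rw [← strictEntries_strictMat ((strictMul (strictMat w) ^ k) v), h2]
  rfl

end Congruence

/-! ### Linear coordinates and the change of variables formula -/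

/-- The linear equivalence underlying an additive and homogeneous measurable equivalence of
finite-dimensional spaces. -/
noncomputable def MeasurableEquiv.toContinuousLinearEquiv {E F : Type*} [NormedAddCommGroup E]
    [NormedSpace ℝ E] [FiniteDimensional ℝ E] [MeasurableSpace E]
    [NormedAddCommGroup F] [NormedSpace ℝ F] [MeasurableSpace F] (e : E ≃ᵐ F)
    (hadd : ∀ x y, e (x + y) = e x + e y) (hsmul : ∀ (c : ℝ) x, e (c • x) = c • e x) : E ≃L[ℝ] F :=
  LinearEquiv.toContinuousLinearEquiv
    { e.toEquiv with
      map_add' := hadd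
      map_smul' := hsmul }

section ChangeOfVariables

variable {E F : Type*} [NormedAddCommGroup E] [NormedSpace ℝ E] [FiniteDimensional ℝ E]
  [MeasurableSpace E] [BorelSpace E] [NormedAddCommGroup F] [NormedSpace ℝ F]
  [MeasurableSpace F] [BorelSpace F]
  {μ : Measure E} [μ.IsAddHaarMeasure] {ν : Measure F} {L : E ≃L[ℝ] F}
  {s : Set E} {f : E → F} {f' : E → E →L[ℝ] F}

/-- The change of variables formula for a map between two spaces that are identified by a
measure-preserving linear equivalence. -/
theorem lintegral_image_eq_of_measurePreserving (hL : MeasurePreserving L μ ν)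
    (hs : MeasurableSet s) (hf' : ∀ x ∈ s, HasFDerivAt f (f' x) x) (hf : Set.InjOn f s)
    (g : F → ℝ≥0∞) :
    ∫⁻ y in f '' s, g y ∂ν =
      ∫⁻ x in s, ENNReal.ofReal |((L.symm : F →L[ℝ] E).comp (f' x)).det| * g (f x) ∂μ := by
  have hemb : MeasurableEmbedding L := L.toHomeomorph.measurableEmbedding
  have h := lintegral_image_eq_lintegral_abs_det_fderiv_mul μ hs (f := fun x => L.symm (f x))
    (fun x hx => ((L.symm : F →L[ℝ] E).hasFDerivAt.comp x (hf' x hx)).hasFDerivWithinAt)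
    (fun x hx y hy hxy => hf hx hy (L.symm.injective hxy)) (fun x => g (L x))
  simp only [ContinuousLinearEquiv.apply_symm_apply] at h
  rw [← h, ← hL.setLIntegral_comp_preimage_emb hemb]
  congr 2
  ext x
  simp only [Set.mem_preimage, Set.mem_image]
  exact exists_congr fun y => and_congr_right fun _ => L.symm_apply_eq.symm

/-- An injective differentiable map is a measurable embedding; the linear identification `L` only
serves to put it on a single space. -/
theorem measurableEmbedding_of_measurePreserving (hs : MeasurableSet s)
    (hf' : ∀ x ∈ s, HasFDerivAt f (f' x) x) (hf : Set.InjOn f s) (L : E ≃L[ℝ] F) :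
    MeasurableEmbedding (s.domRestrict f) := by
  have hemb : MeasurableEmbedding L := L.toHomeomorph.measurableEmbedding
  have h := measurableEmbedding_of_fderivWithin hs (f := fun x => L.symm (f x))
    (fun x hx => ((L.symm : F →L[ℝ] E).hasFDerivAt.comp x (hf' x hx)).hasFDerivWithinAt)
    (fun x hx y hy hxy => hf hx hy (L.symm.injective hxy))
  have h2 := hemb.comp h
  convert h2 using 1
  ext x
  simp

/-- Sard's lemma for a map between two spaces that are identified by a measure-preserving linear
equivalence. -/
theorem measure_image_eq_zero_of_measurePreserving (hL : MeasurePreserving L μ ν)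
    (hf' : ∀ x ∈ s, HasFDerivAt f (f' x) x)
    (h0 : ∀ x ∈ s, ((L.symm : F →L[ℝ] E).comp (f' x)).det = 0) : ν (f '' s) = 0 := by
  have hemb : MeasurableEmbedding L := L.toHomeomorph.measurableEmbedding
  have h := addHaar_image_eq_zero_of_det_fderivWithin_eq_zero μ (f := fun x => L.symm (f x))
    (fun x hx => ((L.symm : F →L[ℝ] E).hasFDerivAt.comp x (hf' x hx)).hasFDerivWithinAt) h0
  rw [← h, ← hL.measure_preimage_emb hemb]
  congr 1
  ext x
  simp only [Set.mem_preimage, Set.mem_image]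
  exact exists_congr fun y => and_congr_right fun _ => L.symm_apply_eq.symm

end ChangeOfVariables

section Coordinates

variable {n : ℕ}

/-- A pair `i ≤ j` is a pair `i < j` or an index. -/
def upperIndexEquiv (n : ℕ) : StrictPairs n ⊕ Fin n ≃ UpperPairs n where
  toFun := Sum.elim (fun p => ⟨p.1, p.2.le⟩) fun i => ⟨(i, i), le_rfl⟩
  invFun p := if h : p.1.1 < p.1.2 then Sum.inl ⟨p.1, h⟩ else Sum.inr p.1.1
  left_inv := by
    rintro (⟨⟨i, j⟩, h⟩ | i)
    · have h' : i < j := h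
      simp [h']
    · simp
  right_inv := by
    rintro ⟨⟨i, j⟩, h⟩
    by_cases h' : i < j
    · simp [h']
    · have : i = j := le_antisymm h (not_lt.1 h')
      simp [this]

/-- A pair `(i, j)` lies below, on or above the diagonal; the positions below it are labelled by the
transposed pairs. -/
def squareIndexEquiv (n : ℕ) : (StrictPairs n ⊕ Fin n) ⊕ StrictPairs n ≃ Fin n × Fin n where
  toFun := Sum.elim (Sum.elim (fun p => (p.1.2, p.1.1)) fun i => (i, i)) fun p => p.1
  invFun q := if h : q.2 < q.1 then Sum.inl (Sum.inl ⟨(q.2, q.1), h⟩) else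
    if h : q.1 < q.2 then Sum.inr ⟨q, h⟩ else Sum.inl (Sum.inr q.1)
  left_inv := by
    rintro ((⟨⟨i, j⟩, h⟩ | i) | ⟨⟨i, j⟩, h⟩)
    · have h' : i < j := h
      simp [h']
    · simp
    · have h' : i < j := h
      simp [h', h'.not_gt]
  right_inv := by
    rintro ⟨i, j⟩
    rcases lt_trichotomy i j with h' | h' | h'
    · simp [h', h'.not_gt]
    · simp [h']
    · simp [h']

/-- Functions on a disjoint union, reindexed. -/
noncomputable def glueEquiv {ι ι' κ : Type*} (R : Type*) [MeasurableSpace R] (e : ι ⊕ ι' ≃ κ) :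
    (ι → R) × (ι' → R) ≃ᵐ (κ → R) :=
  (MeasurableEquiv.sumPiEquivProdPi fun _ : ι ⊕ ι' => R).symm.trans
    (MeasurableEquiv.piCongrLeft (fun _ => R) e)

section

variable {ι ι' κ R : Type*} [MeasurableSpace R] (e : ι ⊕ ι' ≃ κ)

@[simp]
theorem glueEquiv_inl (p : (ι → R) × (ι' → R)) (i : ι) :
    glueEquiv R e p (e (Sum.inl i)) = p.1 i :=
  Equiv.piCongrLeft_apply_apply (fun _ => R) e
    ((MeasurableEquiv.sumPiEquivProdPi fun _ : ι ⊕ ι' => R).symm p) (Sum.inl i)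

@[simp]
theorem glueEquiv_inr (p : (ι → R) × (ι' → R)) (i : ι') :
    glueEquiv R e p (e (Sum.inr i)) = p.2 i :=
  Equiv.piCongrLeft_apply_apply (fun _ => R) e
    ((MeasurableEquiv.sumPiEquivProdPi fun _ : ι ⊕ ι' => R).symm p) (Sum.inr i)

end

theorem measurePreserving_glueEquiv {ι ι' κ : Type*} [Fintype ι] [Fintype ι'] [Fintype κ]
    {R : Type*} [MeasureSpace R] [SigmaFinite (volume : Measure R)] (e : ι ⊕ ι' ≃ κ) :
    MeasurePreserving (glueEquiv R e) :=
  (volume_measurePreserving_piCongrLeft (fun _ => R) e).comp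
    (volume_measurePreserving_sumPiEquivProdPi_symm fun _ : ι ⊕ ι' => R)

/-- A complex vector is a pair of real vectors. -/
noncomputable def reImEquiv (ι : Type*) : (ι → ℝ) × (ι → ℝ) ≃ᵐ (ι → ℂ) :=
  (MeasurableEquiv.arrowProdEquivProdArrow ℝ ℝ ι).symm.trans
    (MeasurableEquiv.piCongrRight fun _ => Complex.measurableEquivRealProd.symm)

@[simp]
theorem reImEquiv_apply {ι : Type*} (p : (ι → ℝ) × (ι → ℝ)) (i : ι) :
    reImEquiv ι p i = ⟨p.1 i, p.2 i⟩ := rfl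

theorem measurePreserving_reImEquiv (ι : Type*) [Fintype ι] :
    MeasurePreserving (reImEquiv ι) :=
  (volume_preserving_pi fun _ =>
    Complex.volume_preserving_equiv_real_prod.symm Complex.measurableEquivRealProd).comp
    ((volume_measurePreserving_arrowProdEquivProdArrow ℝ ℝ ι).symm
      (MeasurableEquiv.arrowProdEquivProdArrow ℝ ℝ ι))

end Coordinates

/-! ### Derivatives of matrix-valued functions -/

section MatrixDerivatives

open scoped Matrix.Norms.Operator

variable {E : Type*} [NormedAddCommGroup E] [NormedSpace ℝ E] {n : ℕ}
  {𝕜 : Type*} [RCLike 𝕜]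

/-- The product rule. Stating the derivative through its values keeps the choice of a matrix norm
out of the later statements. -/
theorem exists_hasFDerivAt_matrix_mul {f g : E → Matrix (Fin n) (Fin n) 𝕜}
    {f' g' : E →L[ℝ] Matrix (Fin n) (Fin n) 𝕜} {x : E} (hf : HasFDerivAt f f' x)
    (hg : HasFDerivAt g g' x) :
    ∃ G : E →L[ℝ] Matrix (Fin n) (Fin n) 𝕜, HasFDerivAt (fun y => f y * g y) G x ∧
      ∀ h, G h = f' h * g x + f x * g' h :=
  ⟨_, hf.mul' hg, fun _ => add_comm _ _⟩

theorem exists_hasFDerivAt_matrix_inv {f : E → Matrix (Fin n) (Fin n) 𝕜}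
    {f' : E →L[ℝ] Matrix (Fin n) (Fin n) 𝕜} {x : E} (hf : HasFDerivAt f f' x)
    (hx : IsUnit (f x).det) :
    ∃ G : E →L[ℝ] Matrix (Fin n) (Fin n) 𝕜, HasFDerivAt (fun y => (f y)⁻¹) G x ∧
      ∀ h, G h = -((f x)⁻¹ * f' h * (f x)⁻¹) := by
  obtain ⟨u, hu⟩ := (Matrix.isUnit_iff_isUnit_det _).2 hx
  have h1 := hasFDerivAt_ringInverse (𝕜 := ℝ) u
  rw [hu] at h1
  have h2 := h1.comp x hf
  refine ⟨_, h2.congr_of_eventuallyEq (.of_forall fun y => ?_), fun h => ?_⟩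
  · exact Matrix.nonsing_inv_eq_ringInverse _
  · have : ((u⁻¹ : (Matrix (Fin n) (Fin n) 𝕜)ˣ) : Matrix (Fin n) (Fin n) 𝕜) = (f x)⁻¹ := by
      rw [Matrix.coe_units_inv, hu]
    rw [← this]
    rfl

theorem hasFDerivAt_linear_comp {F : Type*} [NormedAddCommGroup F] [NormedSpace ℝ F]
    (l : Matrix (Fin n) (Fin n) 𝕜 →ₗ[ℝ] F) {f : E → Matrix (Fin n) (Fin n) 𝕜}
    {f' : E →L[ℝ] Matrix (Fin n) (Fin n) 𝕜} {x : E} (hf : HasFDerivAt f f' x) :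
    ∃ G : E →L[ℝ] F, HasFDerivAt (fun y => l (f y)) G x ∧ ∀ h, G h = l (f' h) :=
  ⟨_, l.toContinuousLinearMap.hasFDerivAt.comp x hf, fun _ => rfl⟩

theorem exists_hasFDerivAt_matrix_transpose {f : E → Matrix (Fin n) (Fin n) 𝕜}
    {f' : E →L[ℝ] Matrix (Fin n) (Fin n) 𝕜} {x : E} (hf : HasFDerivAt f f' x) :
    ∃ G : E →L[ℝ] Matrix (Fin n) (Fin n) 𝕜, HasFDerivAt (fun y => (f y)ᵀ) G x ∧
      ∀ h, G h = (f' h)ᵀ :=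
  hasFDerivAt_linear_comp (Matrix.transposeLinearEquiv (Fin n) (Fin n) ℝ 𝕜).toLinearMap hf

theorem hasFDerivAt_of_linear [FiniteDimensional ℝ E]
    (l : E →ₗ[ℝ] Matrix (Fin n) (Fin n) 𝕜) (x : E) :
    HasFDerivAt (fun y => l y) l.toContinuousLinearMap x :=
  l.toContinuousLinearMap.hasFDerivAt

end MatrixDerivatives

/-! ### Fractional linear transformations of symmetric matrices -/

/-- The fractional linear transformation `Z ↦ (A Z + B) (C Z + D)⁻¹`. -/
noncomputable def mobius {n : ℕ} (A B C D Z : Matrix (Fin n) (Fin n) ℂ) :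
    Matrix (Fin n) (Fin n) ℂ :=
  (A * Z + B) * (C * Z + D)⁻¹

/-- The block matrix `[A, B; C, D]` is a symplectic similitude with multiplier `l`. -/
structure IsSimilitude {n : ℕ} (l : ℂ) (A B C D : Matrix (Fin n) (Fin n) ℂ) : Prop where
  left : Aᵀ * C = Cᵀ * A
  right : Bᵀ * D = Dᵀ * B
  mixed : Aᵀ * D - Cᵀ * B = l • 1

namespace IsSimilitude

variable {n : ℕ} {l : ℂ} {A B C D : Matrix (Fin n) (Fin n) ℂ}

theorem mixed' (h : IsSimilitude l A B C D) : Dᵀ * A - Bᵀ * C = l • 1 := by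
  have := congrArg Matrix.transpose h.mixed
  simpa using this

/-- The identity `ᵗ(CZ' + D) (AZ + B) - ᵗ(AZ' + B) (CZ + D) = l (Z - Z')`, from which symmetry and
injectivity of the transformation follow. -/
theorem numerator_sub (h : IsSimilitude l A B C D) {Z Z' : Matrix (Fin n) (Fin n) ℂ}
    (hZ' : Z'.IsSymm) :
    (C * Z' + D)ᵀ * (A * Z + B) - (A * Z' + B)ᵀ * (C * Z + D) = l • (Z - Z') := by
  have h3 := h.mixed
  have h4 := h.mixed'
  have hZ'' : Z'ᵀ = Z' := hZ'
  have : (C * Z' + D)ᵀ * (A * Z + B) - (A * Z' + B)ᵀ * (C * Z + D) =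
      Z' * (Cᵀ * A - Aᵀ * C) * Z - Z' * (Aᵀ * D - Cᵀ * B) + (Dᵀ * A - Bᵀ * C) * Z +
        (Dᵀ * B - Bᵀ * D) := by
    simp only [Matrix.transpose_add, Matrix.transpose_mul, hZ'']
    noncomm_ring
  rw [this, h.left, h.right, h3, h4]
  simp only [sub_self, mul_zero, zero_mul, Matrix.mul_smul, Matrix.mul_one, Matrix.smul_mul,
    Matrix.one_mul, smul_sub]
  abel

theorem numerator_symm (h : IsSimilitude l A B C D) {Z : Matrix (Fin n) (Fin n) ℂ}
    (hZ : Z.IsSymm) : (C * Z + D)ᵀ * (A * Z + B) = (A * Z + B)ᵀ * (C * Z + D) := by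
  rw [← sub_eq_zero, h.numerator_sub hZ, sub_self, smul_zero]

theorem mobius_isSymm (h : IsSimilitude l A B C D) {Z : Matrix (Fin n) (Fin n) ℂ}
    (hZ : Z.IsSymm) (hP : IsUnit (C * Z + D).det) : (mobius A B C D Z).IsSymm := by
  have hPT : IsUnit (C * Z + D)ᵀ.det := by rwa [Matrix.det_transpose]
  have h1 := h.numerator_symm hZ
  set P := C * Z + D
  set N := A * Z + B
  change (N * P⁻¹)ᵀ = N * P⁻¹
  rw [Matrix.transpose_mul, Matrix.transpose_nonsing_inv]
  calc Pᵀ⁻¹ * Nᵀ = Pᵀ⁻¹ * (Nᵀ * P) * P⁻¹ := by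
        rw [Matrix.mul_assoc, Matrix.mul_assoc, Matrix.mul_nonsing_inv _ hP, Matrix.mul_one]
    _ = N * P⁻¹ := by
        rw [← h1, ← Matrix.mul_assoc, Matrix.nonsing_inv_mul _ hPT, Matrix.one_mul]

theorem mobius_injective (h : IsSimilitude l A B C D) (hl : l ≠ 0)
    {Z Z' : Matrix (Fin n) (Fin n) ℂ} (hZ' : Z'.IsSymm)
    (hP : IsUnit (C * Z + D).det) (hP' : IsUnit (C * Z' + D).det)
    (hZZ : mobius A B C D Z = mobius A B C D Z') : Z = Z' := by
  have h1 := h.numerator_sub (Z := Z) hZ'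
  have h2 : (mobius A B C D Z')ᵀ = mobius A B C D Z' := h.mobius_isSymm hZ' hP'
  have h3 : A * Z + B = mobius A B C D Z' * (C * Z + D) := by
    rw [← hZZ, mobius, Matrix.nonsing_inv_mul_cancel_right _ _ hP]
  have h4 : A * Z' + B = mobius A B C D Z' * (C * Z' + D) := by
    rw [mobius, Matrix.nonsing_inv_mul_cancel_right _ _ hP']
  rw [h3, h4, Matrix.transpose_mul, h2, Matrix.mul_assoc, sub_self] at h1
  exact sub_eq_zero.1 ((smul_eq_zero.1 h1.symm).resolve_left hl)

/-- The factor that appears in the derivative of the transformation, by the quotient rule. -/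
theorem sub_mobius_mul (h : IsSimilitude l A B C D) {Z : Matrix (Fin n) (Fin n) ℂ}
    (hZ : Z.IsSymm) (hP : IsUnit (C * Z + D).det) :
    A - mobius A B C D Z * C = l • ((C * Z + D)⁻¹)ᵀ := by
  have hPT : IsUnit (C * Z + D)ᵀ.det := by rwa [Matrix.det_transpose]
  have h1 : (mobius A B C D Z)ᵀ = mobius A B C D Z := h.mobius_isSymm hZ hP
  have h2 : (C * Z + D)ᵀ * A - (A * Z + B)ᵀ * C = l • 1 := by
    have hZ' : Zᵀ = Z := hZ
    have : (C * Z + D)ᵀ * A - (A * Z + B)ᵀ * C =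
        Z * (Cᵀ * A - Aᵀ * C) + (Dᵀ * A - Bᵀ * C) := by
      simp only [Matrix.transpose_add, Matrix.transpose_mul, hZ']
      noncomm_ring
    rw [this, h.left, h.mixed']
    simp
  rw [← h1]
  unfold mobius
  set P := C * Z + D
  set N := A * Z + B
  rw [Matrix.transpose_mul, Matrix.transpose_nonsing_inv]
  calc A - Pᵀ⁻¹ * Nᵀ * C = Pᵀ⁻¹ * (Pᵀ * A - Nᵀ * C) := by
        rw [Matrix.mul_sub, ← Matrix.mul_assoc, Matrix.nonsing_inv_mul _ hPT, Matrix.one_mul,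
          Matrix.mul_assoc]
    _ = l • Pᵀ⁻¹ := by rw [h2, Matrix.mul_smul, Matrix.mul_one]

open scoped Matrix.Norms.Operator in
/-- The derivative of a symplectic fractional linear transformation is a congruence. -/
theorem hasFDerivAt_mobius (h : IsSimilitude l A B C D) {x : UpperPairs n → ℂ}
    (hP : IsUnit (C * symMat x + D).det) :
    HasFDerivAt (fun y : UpperPairs n → ℂ => upperEntries (mobius A B C D (symMat y)))
      (LinearMap.toContinuousLinearMap
        (LinearMap.restrictScalars ℝ (l • congrSym ((C * symMat x + D)⁻¹)ᵀ))) x := by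
  let symL : (UpperPairs n → ℂ) →ₗ[ℝ] Matrix (Fin n) (Fin n) ℂ :=
    { toFun := symMat, map_add' := symMat_add, map_smul' := symMat_smul }
  let upL : Matrix (Fin n) (Fin n) ℂ →ₗ[ℝ] (UpperPairs n → ℂ) :=
    { toFun := upperEntries, map_add' := fun _ _ => rfl, map_smul' := fun _ _ => rfl }
  have hS := hasFDerivAt_of_linear symL x
  have haff (S T : Matrix (Fin n) (Fin n) ℂ) :
      ∃ G : (UpperPairs n → ℂ) →L[ℝ] Matrix (Fin n) (Fin n) ℂ,
        HasFDerivAt (fun y => S * symL y + T) G x ∧ ∀ k, G k = S * symMat k := by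
    obtain ⟨G, hG, hG'⟩ := exists_hasFDerivAt_matrix_mul (hasFDerivAt_const S x) hS
    exact ⟨G, hG.add_const T, fun k => by rw [hG']; simp [symL]⟩
  obtain ⟨GN, hN, hN'⟩ := haff A B
  obtain ⟨GP, hPd, hP'⟩ := haff C D
  obtain ⟨GI, hI, hI'⟩ := exists_hasFDerivAt_matrix_inv hPd hP
  obtain ⟨GM, hM, hM'⟩ := exists_hasFDerivAt_matrix_mul hN hI
  obtain ⟨G, hG, hG'⟩ := hasFDerivAt_linear_comp upL hM
  refine hG.congr_fderiv (ContinuousLinearMap.ext fun k => ?_)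
  rw [hG', hM', hI', hN', hP']
  have hk := h.sub_mobius_mul (symMat_isSymm x) hP
  change upperEntries (A * symMat k * (C * symMat x + D)⁻¹ +
      (A * symMat x + B) * -((C * symMat x + D)⁻¹ * (C * symMat k) * (C * symMat x + D)⁻¹)) =
    l • upperEntries (((C * symMat x + D)⁻¹)ᵀ * symMat k * ((C * symMat x + D)⁻¹)ᵀᵀ)
  have : A * symMat k * (C * symMat x + D)⁻¹ +
      (A * symMat x + B) * -((C * symMat x + D)⁻¹ * (C * symMat k) * (C * symMat x + D)⁻¹) =
      (A - mobius A B C D (symMat x) * C) * symMat k * (C * symMat x + D)⁻¹ := by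
    unfold mobius
    noncomm_ring
  rw [this, hk, Matrix.transpose_transpose, Matrix.smul_mul, Matrix.smul_mul]
  rfl

theorem abs_det_mobius (l : ℂ) {P : Matrix (Fin n) (Fin n) ℂ} (hP : IsUnit P.det) :
    |(LinearMap.toContinuousLinearMap (LinearMap.restrictScalars ℝ (l • congrSym (P⁻¹)ᵀ))).det| =
      ‖l‖ ^ (n * (n + 1)) * (‖P.det‖ ^ (2 * (n + 1)))⁻¹ := by
  have hcard : 2 * Fintype.card (UpperPairs n) = n * (n + 1) := by
    have h := prod_upperPairs_mul (n := n) (fun _ => Multiplicative.ofAdd (1 : ℕ))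
    have h2 := congrArg Multiplicative.toAdd h
    simp at h2
    linarith
  rw [ContinuousLinearMap.det, LinearMap.coe_toContinuousLinearMap, abs_det_restrictScalars,
    LinearMap.det_smul, det_congrSym]
  · rw [Matrix.det_transpose, Matrix.det_nonsing_inv, Ring.inverse_eq_inv', norm_mul, norm_pow,
      norm_pow, norm_inv, mul_pow, Module.finrank_fintype_fun_eq_card, ← pow_mul, ← pow_mul,
      mul_comm _ 2, hcard, mul_comm (n + 1) 2, inv_pow]
  · rw [Matrix.det_transpose]
    exact (Matrix.isUnit_nonsing_inv_det _ hP).ne_zero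

/-- The change of variables formula for a symplectic fractional linear transformation. -/
theorem lintegral_image_mobius (h : IsSimilitude l A B C D) (hl : l ≠ 0)
    {S : Set (UpperPairs n → ℂ)} (hS : MeasurableSet S)
    (hP : ∀ x ∈ S, IsUnit (C * symMat x + D).det) (G : (UpperPairs n → ℂ) → ℝ≥0∞) :
    ∫⁻ w in (fun x => upperEntries (mobius A B C D (symMat x))) '' S, G w =
      ∫⁻ x in S, ENNReal.ofReal (‖l‖ ^ (n * (n + 1)) *
        (‖(C * symMat x + D).det‖ ^ (2 * (n + 1)))⁻¹) *
          G (upperEntries (mobius A B C D (symMat x))) := by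
  rw [lintegral_image_eq_lintegral_abs_det_fderiv_mul volume hS
    (fun x hx => (h.hasFDerivAt_mobius (hP x hx)).hasFDerivWithinAt)]
  · refine setLIntegral_congr_fun hS fun x hx => ?_
    rw [abs_det_mobius l (hP x hx)]
  · intro x hx y hy hxy
    have h1 := congrArg symMat hxy
    simp only at h1
    rw [symMat_upperEntries (h.mobius_isSymm (symMat_isSymm x) (hP x hx)),
      symMat_upperEntries (h.mobius_isSymm (symMat_isSymm y) (hP y hy))] at h1
    exact symMat_injective
      (h.mobius_injective hl (symMat_isSymm y) (hP x hx) (hP y hy) h1)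

end IsSimilitude

/-! ### Cholesky factorization with upper triangular factors -/

section Cholesky

open scoped ComplexOrder

variable {𝕜 : Type*} [RCLike 𝕜] {n : ℕ}

/-- The upper triangular matrix `diag(a) U` with `U` unipotent with entries `v` above the
diagonal. -/
noncomputable def upTri (a : Fin n → ℝ) (v : StrictPairs n → 𝕜) : Matrix (Fin n) (Fin n) 𝕜 :=
  Matrix.diagonal (fun i => (a i : 𝕜)) * (1 + strictMat v)

theorem upTri_apply (a : Fin n → ℝ) (v : StrictPairs n → 𝕜) (i j : Fin n) :
    upTri a v i j = (a i : 𝕜) * (1 + strictMat v) i j := by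
  rw [upTri, Matrix.diagonal_mul]

theorem isUpperTriangular_one_add_strictMat (v : StrictPairs n → 𝕜) :
    (1 + strictMat v).IsUpperTriangular := by
  intro i j h
  have h' : j < i := h
  simp [strictMat_apply_of_le v h'.le, h'.ne']

theorem isUpperTriangular_upTri (a : Fin n → ℝ) (v : StrictPairs n → 𝕜) :
    (upTri a v).IsUpperTriangular := by
  intro i j h
  rw [upTri_apply, isUpperTriangular_one_add_strictMat v h, mul_zero]

theorem upTri_apply_self (a : Fin n → ℝ) (v : StrictPairs n → 𝕜) (i : Fin n) :
    upTri a v i i = (a i : 𝕜) := by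
  simp [upTri_apply, strictMat_apply_of_le v le_rfl]

theorem upTri_apply_of_lt (a : Fin n → ℝ) (v : StrictPairs n → 𝕜) {i j : Fin n} (h : i < j) :
    upTri a v i j = (a i : 𝕜) * v ⟨(i, j), h⟩ := by
  simp [upTri_apply, strictMat_apply_of_lt v h, h.ne]

theorem det_one_add_strictMat (v : StrictPairs n → 𝕜) : (1 + strictMat v).det = 1 := by
  rw [Matrix.det_of_isUpperTriangular (isUpperTriangular_one_add_strictMat v)]
  simp [strictMat_apply_of_le v le_rfl]

theorem det_upTri (a : Fin n → ℝ) (v : StrictPairs n → 𝕜) :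
    (upTri a v).det = ((∏ i, a i : ℝ) : 𝕜) := by
  rw [upTri, Matrix.det_mul, Matrix.det_diagonal, det_one_add_strictMat, mul_one]
  simp

theorem isUnit_det_upTri {a : Fin n → ℝ} (ha : ∀ i, 0 < a i) (v : StrictPairs n → 𝕜) :
    IsUnit (upTri a v).det := by
  rw [det_upTri, isUnit_iff_ne_zero]
  exact_mod_cast (Finset.prod_pos fun i _ => ha i).ne'

theorem upTri_injective {a a' : Fin n → ℝ} (ha : ∀ i, 0 < a i) {v v' : StrictPairs n → 𝕜}
    (h : upTri a v = upTri a' v') : a = a' ∧ v = v' := by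
  have h1 : a = a' := by
    ext i
    have := congrFun (congrFun h i) i
    rw [upTri_apply_self, upTri_apply_self] at this
    exact_mod_cast this
  subst h1
  refine ⟨rfl, ?_⟩
  ext ⟨⟨i, j⟩, hij⟩
  have := congrFun (congrFun h i) j
  have hij' : i < j := hij
  rw [upTri_apply_of_lt _ _ hij', upTri_apply_of_lt _ _ hij'] at this
  exact mul_left_cancel₀ (by exact_mod_cast (ha i).ne') this

theorem isUpperTriangular_inv {T : Matrix (Fin n) (Fin n) 𝕜} (hT : T.IsUpperTriangular)
    (hdet : IsUnit T.det) : T⁻¹.IsUpperTriangular := by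
  have := Matrix.invertibleOfIsUnitDet T hdet
  exact Matrix.blockTriangular_inv_of_blockTriangular hT

theorem isUpperTriangular_mul {S T : Matrix (Fin n) (Fin n) 𝕜} (hS : S.IsUpperTriangular)
    (hT : T.IsUpperTriangular) : (S * T).IsUpperTriangular :=
  Matrix.BlockTriangular.mul hS hT

theorem exists_upTri_eq {T : Matrix (Fin n) (Fin n) 𝕜} (hT : T.IsUpperTriangular)
    (a : Fin n → ℝ) (ha : ∀ i, 0 < a i) (hd : ∀ i, T i i = (a i : 𝕜)) :
    ∃ v : StrictPairs n → 𝕜, T = upTri a v := by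
  refine ⟨fun p => (a p.1.1 : 𝕜)⁻¹ * T p.1.1 p.1.2, ?_⟩
  ext i j
  rcases lt_trichotomy i j with h | h | h
  · have : (a i : 𝕜) ≠ 0 := by exact_mod_cast (ha i).ne'
    rw [upTri_apply_of_lt _ _ h]
    field_simp
  · subst h
    rw [upTri_apply_self, hd]
  · rw [hT h, isUpperTriangular_upTri a _ h]

/-- A positive definite matrix is `T Tᴴ` with `T` upper triangular with positive diagonal. -/
theorem exists_cholesky {S : Matrix (Fin n) (Fin n) 𝕜} (hS : S.PosDef) :
    ∃ (a : Fin n → ℝ) (v : StrictPairs n → 𝕜), (∀ i, 0 < a i) ∧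
      S = upTri a v * (upTri a v)ᴴ := by
  classical
  -- reversing the order of the indices turns lower triangular matrices into upper triangular ones
  have hS' : (S.submatrix Fin.revPerm Fin.revPerm).PosDef :=
    hS.submatrix Fin.revPerm.injective
  set R : Matrix (Fin n) (Fin n) 𝕜 := (LDL.lowerInv hS').submatrix Fin.revPerm Fin.revPerm with hR
  have hRup : R.IsUpperTriangular := by
    intro i j h
    exact LDL.lowerInv_triangular hS' (Fin.rev_lt_rev.2 h)
  have hRdet : IsUnit R.det := by
    rw [hR, Matrix.det_submatrix_equiv_self]
    exact Matrix.isUnit_det_of_invertible _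
  obtain ⟨d, hd⟩ : ∃ d : Fin n → 𝕜, R * S * Rᴴ = Matrix.diagonal d := by
    refine ⟨fun i => LDL.diagEntries hS' (Fin.revPerm i), ?_⟩
    have h := congrArg (fun M => M.submatrix Fin.revPerm Fin.revPerm)
      (LDL.diag_eq_lowerInv_conj hS')
    have h1 : (LDL.lowerInv hS' * S.submatrix Fin.revPerm Fin.revPerm *
        (LDL.lowerInv hS')ᴴ).submatrix Fin.revPerm Fin.revPerm = R * S * Rᴴ := by
      rw [← Matrix.submatrix_mul_equiv _ _ _ Fin.revPerm,
        ← Matrix.submatrix_mul_equiv _ _ _ Fin.revPerm, Matrix.submatrix_submatrix]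
      congr 2
      ext i j
      simp
    simp only [h1] at h
    rw [← h]
    ext i j
    simp [LDL.diag, Matrix.diagonal_apply]
  have hdpos : ∀ i, 0 < d i := by
    have h1 : (Matrix.diagonal d).PosDef := by
      rw [← hd]
      refine (Matrix.IsUnit.posDef_star_right_conjugate_iff ?_).2 hS
      exact (Matrix.isUnit_iff_isUnit_det _).2 hRdet
    exact Matrix.posDef_diagonal_iff.1 h1
  set e : Fin n → ℝ := fun i => Real.sqrt (RCLike.re (d i)) with he
  have hepos : ∀ i, 0 < e i := fun i => Real.sqrt_pos.2 (RCLike.pos_iff.1 (hdpos i)).1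
  have hde : Matrix.diagonal d = Matrix.diagonal (fun i => (e i : 𝕜)) *
      (Matrix.diagonal (fun i => (e i : 𝕜)))ᴴ := by
    rw [Matrix.diagonal_conjTranspose, Matrix.diagonal_mul_diagonal]
    congr 1
    ext i
    have h2 := RCLike.pos_iff.1 (hdpos i)
    have h3 : ((RCLike.re (d i) : ℝ) : 𝕜) = d i := by
      rw [RCLike.ext_iff]; simp [h2.2]
    rw [← h3]
    simp [he, ← RCLike.ofReal_mul, Real.mul_self_sqrt h2.1.le]
  have hRi := isUpperTriangular_inv hRup hRdet
  have hSR : S = (R⁻¹ * Matrix.diagonal (fun i => (e i : 𝕜))) *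
      (R⁻¹ * Matrix.diagonal (fun i => (e i : 𝕜)))ᴴ := by
    have hRH : IsUnit Rᴴ.det := by rw [Matrix.det_conjTranspose]; exact hRdet.star
    calc S = R⁻¹ * (R * S * Rᴴ) * Rᴴ⁻¹ := by
          rw [Matrix.mul_assoc R, Matrix.nonsing_inv_mul_cancel_left _ _ hRdet,
            Matrix.mul_nonsing_inv_cancel_right _ _ hRH]
      _ = _ := by
          rw [hd, hde, Matrix.conjTranspose_mul, Matrix.conjTranspose_nonsing_inv]
          simp only [Matrix.mul_assoc]
  set T0 := R⁻¹ * Matrix.diagonal (fun i => (e i : 𝕜))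
  have hT0 : T0.IsUpperTriangular :=
    isUpperTriangular_mul hRi (Matrix.blockTriangular_diagonal _)
  have hT0det : T0.det ≠ 0 := by
    rw [Matrix.det_mul, Matrix.det_diagonal]
    refine mul_ne_zero (Matrix.isUnit_nonsing_inv_det _ hRdet).ne_zero ?_
    exact Finset.prod_ne_zero_iff.2 fun i _ => by exact_mod_cast (hepos i).ne'
  have hT0i : ∀ i, T0 i i ≠ 0 := by
    rw [Matrix.det_of_isUpperTriangular hT0, Finset.prod_ne_zero_iff] at hT0det
    exact fun i => hT0det i (Finset.mem_univ i)
  -- multiplying the columns by phases makes the diagonal entries positive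
  set ph : Fin n → 𝕜 := fun i => star (T0 i i) * ((‖T0 i i‖ : ℝ) : 𝕜)⁻¹ with hph
  have hnorm : ∀ i, ((‖T0 i i‖ : ℝ) : 𝕜) ≠ 0 := fun i =>
    by exact_mod_cast (norm_pos_iff.2 (hT0i i)).ne'
  have hphu : Matrix.diagonal ph * (Matrix.diagonal ph)ᴴ = 1 := by
    rw [Matrix.diagonal_conjTranspose, Matrix.diagonal_mul_diagonal, ← Matrix.diagonal_one]
    congr 1
    ext i
    have h1 : star (T0 i i) * T0 i i = ((‖T0 i i‖ : ℝ) : 𝕜) ^ 2 := RCLike.conj_mul _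
    have := hnorm i
    simp only [hph, Pi.star_apply, star_mul', star_inv₀, RCLike.star_def,
      RCLike.conj_ofReal]
    rw [RCLike.star_def] at h1
    rw [RCLike.conj_conj]
    generalize T0 i i = z at *
    field_simp
    rw [h1]
  obtain ⟨v, hv⟩ := exists_upTri_eq (T := T0 * Matrix.diagonal ph)
    (isUpperTriangular_mul hT0 (Matrix.blockTriangular_diagonal _)) (fun i => ‖T0 i i‖)
    (fun i => norm_pos_iff.2 (hT0i i)) (fun i => by
      rw [Matrix.mul_diagonal]
      have h1 : T0 i i * star (T0 i i) = ((‖T0 i i‖ : ℝ) : 𝕜) ^ 2 := RCLike.mul_conj _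
      have := hnorm i
      simp only [hph]
      rw [← mul_assoc, h1]
      field_simp)
  refine ⟨_, v, fun i => norm_pos_iff.2 (hT0i i), ?_⟩
  rw [← hv, Matrix.conjTranspose_mul, Matrix.mul_assoc, ← Matrix.mul_assoc (Matrix.diagonal ph),
    hphu, Matrix.one_mul, hSR]

theorem cholesky_unique {a a' : Fin n → ℝ} (ha : ∀ i, 0 < a i) (ha' : ∀ i, 0 < a' i)
    {v v' : StrictPairs n → 𝕜}
    (h : upTri a v * (upTri a v)ᴴ = upTri a' v' * (upTri a' v')ᴴ) : a = a' ∧ v = v' := by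
  have hTd := isUnit_det_upTri ha v
  have hTd' := isUnit_det_upTri ha' v'
  have hT := isUpperTriangular_upTri a v
  have hT' := isUpperTriangular_upTri a' v'
  have hd : ∀ i, upTri a v i i = (a i : 𝕜) := upTri_apply_self a v
  have hd' : ∀ i, upTri a' v' i i = (a' i : 𝕜) := upTri_apply_self a' v'
  suffices hTT : upTri a v = upTri a' v' from upTri_injective ha hTT
  set T := upTri a v
  set T' := upTri a' v'
  -- the quotient of the two factors is unitary and triangular, hence diagonal
  set V := T'⁻¹ * T with hV
  have hTV : T = T' * V := by rw [hV, Matrix.mul_nonsing_inv_cancel_left _ _ hTd']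
  have hVup : V.IsUpperTriangular := isUpperTriangular_mul (isUpperTriangular_inv hT' hTd') hT
  have hVV : V * Vᴴ = 1 := by
    have hTH : IsUnit T'ᴴ.det := by rw [Matrix.det_conjTranspose]; exact hTd'.star
    rw [hV, Matrix.conjTranspose_mul, Matrix.conjTranspose_nonsing_inv, Matrix.mul_assoc,
      ← Matrix.mul_assoc T, h, Matrix.mul_assoc, Matrix.mul_nonsing_inv _ hTH, Matrix.mul_one,
      Matrix.nonsing_inv_mul _ hTd']
  have hVdet : IsUnit V.det := Matrix.isUnit_det_of_right_inverse hVV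
  have hVinv : V⁻¹ = Vᴴ := Matrix.inv_eq_right_inv hVV
  have hVH : Vᴴ.IsUpperTriangular := hVinv ▸ isUpperTriangular_inv hVup hVdet
  have hoff : ∀ i j, i ≠ j → V i j = 0 := by
    intro i j hij
    rcases lt_or_gt_of_ne hij with h1 | h1
    · have := hVH h1
      rw [Matrix.conjTranspose_apply] at this
      simpa using this
    · exact hVup h1
  have hVdiag : V = Matrix.diagonal fun i => V i i := by
    ext i j
    by_cases hij : i = j
    · subst hij; simp
    · rw [hoff i j hij, Matrix.diagonal_apply_ne _ hij]
  have hone : ∀ i, V i i = 1 := by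
    intro i
    have h1 : (a i : 𝕜) = (a' i : 𝕜) * V i i := by
      rw [← hd i, ← hd' i]
      conv_lhs => rw [hTV, hVdiag, Matrix.mul_diagonal]
    have h2 : V i i * star (V i i) = 1 := by
      have := congrFun (congrFun hVV i) i
      rw [hVdiag, Matrix.diagonal_conjTranspose, Matrix.diagonal_mul_diagonal] at this
      simpa using this
    have h3 : V i i = ((a i / a' i : ℝ) : 𝕜) := by
      have : (a' i : 𝕜) ≠ 0 := by exact_mod_cast (ha' i).ne'
      push_cast
      rw [eq_div_iff this, mul_comm]
      exact h1.symm
    have hpos : 0 < a i / a' i := div_pos (ha i) (ha' i)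
    rw [h3] at h2 ⊢
    rw [RCLike.star_def, RCLike.conj_ofReal] at h2
    have h4 : (a i / a' i) * (a i / a' i) = 1 := by exact_mod_cast h2
    have h5 : a i / a' i = 1 := by nlinarith
    rw [h5]; simp
  rw [hTV, hVdiag]
  simp [hone]

end Cholesky

/-! ### The action on the Siegel upper half space -/

section Action

variable {n : ℕ}

/-- The upper left block, with complex entries. -/
def spA (g : Sp n) : Matrix (Fin n) (Fin n) ℂ :=
  ((g : Matrix (Fin n ⊕ Fin n) (Fin n ⊕ Fin n) ℝ).map Complex.ofReal).toBlocks₁₁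

/-- The upper right block, with complex entries. -/
def spB (g : Sp n) : Matrix (Fin n) (Fin n) ℂ :=
  ((g : Matrix (Fin n ⊕ Fin n) (Fin n ⊕ Fin n) ℝ).map Complex.ofReal).toBlocks₁₂

/-- The lower left block, with complex entries. -/
def spC (g : Sp n) : Matrix (Fin n) (Fin n) ℂ :=
  ((g : Matrix (Fin n ⊕ Fin n) (Fin n ⊕ Fin n) ℝ).map Complex.ofReal).toBlocks₂₁

/-- The lower right block, with complex entries. -/
def spD (g : Sp n) : Matrix (Fin n) (Fin n) ℂ :=
  ((g : Matrix (Fin n ⊕ Fin n) (Fin n ⊕ Fin n) ℝ).map Complex.ofReal).toBlocks₂₂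

theorem siegelAct_eq_mobius (g : Sp n) (Z : Matrix (Fin n) (Fin n) ℂ) :
    siegelAct g Z = mobius (spA g) (spB g) (spC g) (spD g) Z := rfl

theorem map_ofReal_conjTranspose (M : Matrix (Fin n) (Fin n) ℝ) :
    (M.map Complex.ofReal)ᴴ = (M.map Complex.ofReal)ᵀ := by
  ext i j
  simp

theorem spA_conjTranspose (g : Sp n) : (spA g)ᴴ = (spA g)ᵀ :=
  map_ofReal_conjTranspose (g : Matrix (Fin n ⊕ Fin n) (Fin n ⊕ Fin n) ℝ).toBlocks₁₁

theorem spB_conjTranspose (g : Sp n) : (spB g)ᴴ = (spB g)ᵀ :=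
  map_ofReal_conjTranspose (g : Matrix (Fin n ⊕ Fin n) (Fin n ⊕ Fin n) ℝ).toBlocks₁₂

theorem spC_conjTranspose (g : Sp n) : (spC g)ᴴ = (spC g)ᵀ :=
  map_ofReal_conjTranspose (g : Matrix (Fin n ⊕ Fin n) (Fin n ⊕ Fin n) ℝ).toBlocks₂₁

theorem spD_conjTranspose (g : Sp n) : (spD g)ᴴ = (spD g)ᵀ :=
  map_ofReal_conjTranspose (g : Matrix (Fin n ⊕ Fin n) (Fin n ⊕ Fin n) ℝ).toBlocks₂₂

theorem coe_map_eq_fromBlocks (g : Sp n) :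
    (g : Matrix (Fin n ⊕ Fin n) (Fin n ⊕ Fin n) ℝ).map Complex.ofReal =
      Matrix.fromBlocks (spA g) (spB g) (spC g) (spD g) :=
  (Matrix.fromBlocks_toBlocks _).symm

theorem fromBlocks_mul_eq (g h : Sp n) :
    Matrix.fromBlocks (spA (g * h)) (spB (g * h)) (spC (g * h)) (spD (g * h)) =
      Matrix.fromBlocks (spA g * spA h + spB g * spC h) (spA g * spB h + spB g * spD h)
        (spC g * spA h + spD g * spC h) (spC g * spB h + spD g * spD h) := by
  rw [← Matrix.fromBlocks_multiply, ← coe_map_eq_fromBlocks, ← coe_map_eq_fromBlocks,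
    ← coe_map_eq_fromBlocks]
  exact Matrix.map_mul (f := Complex.ofRealHom)

theorem spA_mul (g h : Sp n) : spA (g * h) = spA g * spA h + spB g * spC h :=
  (Matrix.fromBlocks_inj.1 (fromBlocks_mul_eq g h)).1

theorem spB_mul (g h : Sp n) : spB (g * h) = spA g * spB h + spB g * spD h :=
  (Matrix.fromBlocks_inj.1 (fromBlocks_mul_eq g h)).2.1

theorem spC_mul (g h : Sp n) : spC (g * h) = spC g * spA h + spD g * spC h :=
  (Matrix.fromBlocks_inj.1 (fromBlocks_mul_eq g h)).2.2.1

theorem spD_mul (g h : Sp n) : spD (g * h) = spC g * spB h + spD g * spD h :=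
  (Matrix.fromBlocks_inj.1 (fromBlocks_mul_eq g h)).2.2.2

theorem fromBlocks_one_eq :
    Matrix.fromBlocks (spA (1 : Sp n)) (spB 1) (spC 1) (spD 1) = Matrix.fromBlocks 1 0 0 1 := by
  rw [← coe_map_eq_fromBlocks, Matrix.fromBlocks_one]
  ext i j
  simp [Matrix.one_apply, apply_ite]

theorem isSimilitude_sp (g : Sp n) : IsSimilitude 1 (spA g) (spB g) (spC g) (spD g) := by
  have h := SymplecticGroup.map_mem (hA := g.2) (f := Complex.ofRealHom)
  have h' : Matrix.fromBlocks (spA g) (spB g) (spC g) (spD g) ∈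
      Matrix.symplecticGroup (Fin n) ℂ := by
    rw [← coe_map_eq_fromBlocks]
    exact h
  rw [SymplecticGroup.fromBlocks_mem_iff] at h'
  exact ⟨h'.1, h'.2.1, by rw [one_smul]; exact h'.2.2⟩

/-- The numerator `i A + B` of `g · i1`. -/
noncomputable def numer (g : Sp n) : Matrix (Fin n) (Fin n) ℂ := spA g * (Complex.I • 1) + spB g

/-- The denominator `i C + D` of `g · i1`. -/
noncomputable def denom (g : Sp n) : Matrix (Fin n) (Fin n) ℂ := spC g * (Complex.I • 1) + spD g

theorem siegelAct_basePoint (g : Sp n) :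
    siegelAct g (basePoint n) = numer g * (denom g)⁻¹ := rfl

theorem numer_mul (g h : Sp n) : numer (g * h) = spA g * numer h + spB g * denom h := by
  rw [numer, numer, denom, spA_mul, spB_mul]
  simp only [Matrix.mul_add, Matrix.add_mul, Matrix.mul_assoc]
  abel

theorem denom_mul (g h : Sp n) : denom (g * h) = spC g * numer h + spD g * denom h := by
  rw [denom, numer, denom, spC_mul, spD_mul]
  simp only [Matrix.mul_add, Matrix.add_mul, Matrix.mul_assoc]
  abel

theorem numer_one : numer (1 : Sp n) = Complex.I • 1 := by
  obtain ⟨h1, h2, -, -⟩ := Matrix.fromBlocks_inj.1 (fromBlocks_one_eq (n := n))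
  rw [numer, h1, h2]
  simp

theorem denom_one : denom (1 : Sp n) = 1 := by
  obtain ⟨-, -, h1, h2⟩ := Matrix.fromBlocks_inj.1 (fromBlocks_one_eq (n := n))
  rw [denom, h1, h2]
  simp

/-- The Hermitian form of signature `(n, n)` preserved by the symplectic group, evaluated on the
columns of `(numer, denom)`. Invertibility of the denominator and positivity of the imaginary part
follow from it. -/
theorem denom_numer (g : Sp n) :
    (denom g)ᴴ * numer g - (numer g)ᴴ * denom g = (2 * Complex.I) • 1 := by
  have h := isSimilitude_sp g
  have h1 := h.left
  have h2 := h.right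
  have h3 := h.mixed
  have h4 := h.mixed'
  simp only [denom, numer, Matrix.mul_smul, Matrix.mul_one, Matrix.conjTranspose_add,
    Matrix.conjTranspose_smul, spA_conjTranspose, spB_conjTranspose, spC_conjTranspose,
    spD_conjTranspose, Complex.star_def, Complex.conj_I, Matrix.add_mul, Matrix.mul_add,
    Matrix.smul_mul]
  rw [sub_eq_iff_eq_add] at h3 h4
  rw [h1, h2, h3, h4]
  module

open scoped ComplexOrder in
theorem isUnit_det_denom (g : Sp n) : IsUnit (denom g).det := by
  rw [isUnit_iff_ne_zero]
  intro h
  obtain ⟨v, hv, hv0⟩ := Matrix.exists_mulVec_eq_zero_iff.2 h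
  have h1 := congrArg (fun M => star v ⬝ᵥ (M *ᵥ v)) (denom_numer g)
  simp only [Matrix.sub_mulVec, ← Matrix.mulVec_mulVec, hv0, Matrix.mulVec_zero, sub_zero,
    Matrix.smul_mulVec, Matrix.one_mulVec, dotProduct_smul] at h1
  rw [Matrix.dotProduct_mulVec, ← Matrix.star_mulVec, hv0] at h1
  simp only [star_zero, zero_dotProduct, smul_eq_mul] at h1
  have h2 : star v ⬝ᵥ v ≠ 0 := by
    simpa [dotProduct_star_self_eq_zero] using hv
  exact (mul_ne_zero (by simp [Complex.I_ne_zero]) h2) h1.symm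

theorem siegelAct_basePoint_isSymm (g : Sp n) : (siegelAct g (basePoint n)).IsSymm := by
  refine (isSimilitude_sp g).mobius_isSymm (Z := basePoint n) ?_ (isUnit_det_denom g)
  simp [basePoint, Matrix.IsSymm]

/-- The action law on the orbit of the base point, which is the whole upper half space. -/
theorem siegelAct_mul (g h : Sp n) :
    siegelAct g (siegelAct h (basePoint n)) = siegelAct (g * h) (basePoint n) := by
  have hd := isUnit_det_denom h
  rw [siegelAct_basePoint, siegelAct_basePoint, siegelAct_eq_mobius, mobius, numer_mul, denom_mul]
  have h1 (S T : Matrix (Fin n) (Fin n) ℂ) : S * (numer h * (denom h)⁻¹) + T =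
      (S * numer h + T * denom h) * (denom h)⁻¹ := by
    rw [Matrix.add_mul, Matrix.mul_nonsing_inv_cancel_right _ _ hd, Matrix.mul_assoc]
  rw [h1, h1, Matrix.mul_inv_rev, Matrix.nonsing_inv_nonsing_inv _ hd, Matrix.mul_assoc,
    Matrix.nonsing_inv_mul_cancel_left _ _ hd]

theorem denom_siegelAct (g h : Sp n) :
    spC g * siegelAct h (basePoint n) + spD g = denom (g * h) * (denom h)⁻¹ := by
  have hd := isUnit_det_denom h
  rw [siegelAct_basePoint, denom_mul, Matrix.add_mul, Matrix.mul_nonsing_inv_cancel_right _ _ hd,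
    Matrix.mul_assoc]

/-- The imaginary part of `g · i1` is `(P Pᴴ)⁻¹` with `P` the denominator; in particular the
right-hand side is real. -/
theorem im_siegelAct (g : Sp n) :
    ((siegelAct g (basePoint n)).map Complex.im).map Complex.ofReal =
      (denom g * (denom g)ᴴ)⁻¹ := by
  have hd := isUnit_det_denom g
  have hdH : IsUnit (denom g)ᴴ.det := by rw [Matrix.det_conjTranspose]; exact hd.star
  have hsym : (siegelAct g (basePoint n))ᵀ = siegelAct g (basePoint n) :=
    siegelAct_basePoint_isSymm g
  set Z := siegelAct g (basePoint n) with hZ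
  have h1 : Z - Zᴴ = (2 * Complex.I) • (denom g * (denom g)ᴴ)⁻¹ := by
    have h2 : Z - Zᴴ =
        (denom g)ᴴ⁻¹ * ((denom g)ᴴ * numer g - (numer g)ᴴ * denom g) * (denom g)⁻¹ := by
      rw [hZ, siegelAct_basePoint, Matrix.conjTranspose_mul, Matrix.conjTranspose_nonsing_inv,
        Matrix.mul_sub, Matrix.sub_mul, Matrix.nonsing_inv_mul_cancel_left _ _ hdH,
        ← Matrix.mul_assoc, Matrix.mul_nonsing_inv_cancel_right _ _ hd]
    rw [h2, denom_numer, Matrix.mul_smul, Matrix.mul_one, Matrix.smul_mul, Matrix.mul_inv_rev]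
  have h2 : Z - Zᴴ = (2 * Complex.I) • (Z.map Complex.im).map Complex.ofReal := by
    have h3 : Zᴴ = Z.map star := by rw [Matrix.conjTranspose, hsym]
    rw [h3]
    ext i j
    simp only [Matrix.sub_apply, Matrix.smul_apply, Matrix.map_apply, smul_eq_mul,
      Complex.star_def, Complex.sub_conj]
    push_cast
    ring
  rw [h2] at h1
  exact smul_right_injective _ (by simp [Complex.I_ne_zero]) h1

open scoped ComplexOrder in
theorem Matrix.PosDef.of_map_ofReal {M : Matrix (Fin n) (Fin n) ℝ}
    (h : (M.map Complex.ofReal).PosDef) : M.PosDef := by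
  refine Matrix.PosDef.of_dotProduct_mulVec_pos ?_ fun x hx => ?_
  · ext i j
    have := congrFun (congrFun h.isHermitian i) j
    simpa [Matrix.conjTranspose_apply] using this
  · have hx' : (fun i => (x i : ℂ)) ≠ 0 := by
      intro h0
      exact hx (funext fun i => by simpa using congrFun h0 i)
    have h1 := h.dotProduct_mulVec_pos hx'
    have h2 : star (fun i => (x i : ℂ)) ⬝ᵥ (M.map Complex.ofReal *ᵥ fun i => (x i : ℂ)) =
        ((star x ⬝ᵥ (M *ᵥ x) : ℝ) : ℂ) := by
      simp [dotProduct, Matrix.mulVec]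
    rw [h2] at h1
    exact_mod_cast h1

open scoped ComplexOrder in
theorem siegelAct_basePoint_mem (g : Sp n) :
    siegelAct g (basePoint n) ∈ siegelUpperHalfSpace n := by
  refine ⟨siegelAct_basePoint_isSymm g, Matrix.PosDef.of_map_ofReal ?_⟩
  rw [im_siegelAct]
  refine Matrix.PosDef.inv ?_
  have h := isUnit_det_denom g
  refine Matrix.PosDef.mul_conjTranspose_self _ ?_
  exact Matrix.vecMul_injective_of_isUnit ((Matrix.isUnit_iff_isUnit_det _).2 h)

theorem det_im_siegelAct (g : Sp n) :
    ((siegelAct g (basePoint n)).map Complex.im).det = (‖(denom g).det‖ ^ 2)⁻¹ := by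
  have h := congrArg Matrix.det (im_siegelAct g)
  rw [Matrix.det_nonsing_inv, Matrix.det_mul, Matrix.det_conjTranspose, Ring.inverse_eq_inv',
    Complex.star_def, Complex.mul_conj, Complex.normSq_eq_norm_sq] at h
  have h2 : (((siegelAct g (basePoint n)).map Complex.im).det : ℂ) = _ :=
    (Complex.ofRealHom.map_det ((siegelAct g (basePoint n)).map Complex.im)).trans h
  exact_mod_cast h2

end Action

/-! ### The maximal compact subgroup and the Cayley transform -/

section MaxCompact

variable {n : ℕ}

theorem coe_inv_eq_fromBlocks (g : Sp n) :
    ((g⁻¹ : Sp n) : Matrix (Fin n ⊕ Fin n) (Fin n ⊕ Fin n) ℝ) =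
      Matrix.fromBlocks (g : Matrix (Fin n ⊕ Fin n) (Fin n ⊕ Fin n) ℝ).toBlocks₂₂ᵀ
        (-(g : Matrix (Fin n ⊕ Fin n) (Fin n ⊕ Fin n) ℝ).toBlocks₁₂ᵀ)
        (-(g : Matrix (Fin n ⊕ Fin n) (Fin n ⊕ Fin n) ℝ).toBlocks₂₁ᵀ)
        (g : Matrix (Fin n ⊕ Fin n) (Fin n ⊕ Fin n) ℝ).toBlocks₁₁ᵀ := by
  have h := Matrix.fromBlocks_toBlocks (g : Matrix (Fin n ⊕ Fin n) (Fin n ⊕ Fin n) ℝ)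
  rw [SymplecticGroup.coe_inv]
  nth_rw 1 [← h]
  simp [Matrix.fromBlocks_transpose, Matrix.J, Matrix.fromBlocks_multiply, Matrix.fromBlocks_neg]

theorem mem_maxCompact_iff (g : Sp n) :
    g ∈ maxCompact n ↔
      (g : Matrix (Fin n ⊕ Fin n) (Fin n ⊕ Fin n) ℝ).toBlocks₂₂ =
        (g : Matrix (Fin n ⊕ Fin n) (Fin n ⊕ Fin n) ℝ).toBlocks₁₁ ∧
      (g : Matrix (Fin n ⊕ Fin n) (Fin n ⊕ Fin n) ℝ).toBlocks₂₁ =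
        -(g : Matrix (Fin n ⊕ Fin n) (Fin n ⊕ Fin n) ℝ).toBlocks₁₂ := by
  have hinv := coe_inv_eq_fromBlocks g
  have h1 : (g : Matrix (Fin n ⊕ Fin n) (Fin n ⊕ Fin n) ℝ)ᵀ =
      Matrix.fromBlocks (g : Matrix (Fin n ⊕ Fin n) (Fin n ⊕ Fin n) ℝ).toBlocks₁₁ᵀ
        (g : Matrix (Fin n ⊕ Fin n) (Fin n ⊕ Fin n) ℝ).toBlocks₂₁ᵀ
        (g : Matrix (Fin n ⊕ Fin n) (Fin n ⊕ Fin n) ℝ).toBlocks₁₂ᵀ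
        (g : Matrix (Fin n ⊕ Fin n) (Fin n ⊕ Fin n) ℝ).toBlocks₂₂ᵀ := by
    rw [← Matrix.fromBlocks_transpose, Matrix.fromBlocks_toBlocks]
  have hgg : (g : Matrix (Fin n ⊕ Fin n) (Fin n ⊕ Fin n) ℝ) *
      ((g⁻¹ : Sp n) : Matrix _ _ ℝ) = 1 := by
    rw [← Submonoid.coe_mul, mul_inv_cancel, Submonoid.coe_one]
  have h2 : g ∈ maxCompact n ↔ (g : Matrix (Fin n ⊕ Fin n) (Fin n ⊕ Fin n) ℝ)ᵀ =
      ((g⁻¹ : Sp n) : Matrix _ _ ℝ) := by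
    change (g : Matrix (Fin n ⊕ Fin n) (Fin n ⊕ Fin n) ℝ) ∈ Matrix.orthogonalGroup _ ℝ ↔ _
    rw [Matrix.mem_orthogonalGroup_iff, ← hgg]
    have hu := Matrix.isUnit_det_of_right_inverse hgg
    refine ⟨fun h => ?_, fun h => by rw [h]⟩
    exact ((Matrix.isUnit_iff_isUnit_det _).2 hu).mul_left_cancel h
  rw [h2, hinv, h1, Matrix.fromBlocks_inj]
  constructor
  · rintro ⟨h3, h4, -, -⟩
    exact ⟨(Matrix.transpose_injective h3).symm, Matrix.transpose_injective (by simpa using h4)⟩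
  · rintro ⟨h3, h4⟩
    simp [h3, h4]

theorem spD_eq_of_mem {k : Sp n} (hk : k ∈ maxCompact n) : spD k = spA k :=
  congrArg (fun M : Matrix (Fin n) (Fin n) ℝ => M.map Complex.ofReal)
    ((mem_maxCompact_iff k).1 hk).1

theorem spC_eq_of_mem {k : Sp n} (hk : k ∈ maxCompact n) : spC k = -spB k := by
  have := congrArg (fun M : Matrix (Fin n) (Fin n) ℝ => M.map Complex.ofReal)
    ((mem_maxCompact_iff k).1 hk).2
  refine Eq.trans this ?_
  ext i j
  simp [spB, Matrix.toBlocks₁₂]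

/-- The maximal compact subgroup fixes the base point. -/
theorem numer_eq_smul_denom_iff (k : Sp n) :
    numer k = Complex.I • denom k ↔ k ∈ maxCompact n := by
  constructor
  · intro h
    have h' (i j : Fin n) := congrFun (congrFun h i) j
    simp only [numer, denom, spA, spB, spC, spD, Matrix.mul_smul, Matrix.mul_one, Matrix.add_apply,
      Matrix.smul_apply, smul_eq_mul] at h'
    rw [mem_maxCompact_iff]
    constructor
    · ext i j
      have := congrArg Complex.im (h' i j)
      simp [Matrix.toBlocks₁₁, Matrix.toBlocks₁₂, Matrix.toBlocks₂₁, Matrix.toBlocks₂₂] at this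
      exact this.symm
    · ext i j
      have := congrArg Complex.re (h' i j)
      simp [Matrix.toBlocks₁₁, Matrix.toBlocks₁₂, Matrix.toBlocks₂₁, Matrix.toBlocks₂₂] at this
      simp [Matrix.toBlocks₁₂, Matrix.toBlocks₂₁, this]
  · intro hk
    rw [numer, denom, spD_eq_of_mem hk, spC_eq_of_mem hk]
    simp [smul_smul, add_comm]

theorem numer_mul_of_mem (g : Sp n) {k : Sp n} (hk : k ∈ maxCompact n) :
    numer (g * k) = numer g * denom k := by
  rw [numer_mul, (numer_eq_smul_denom_iff k).2 hk, numer]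
  simp [Matrix.add_mul]

theorem denom_mul_of_mem (g : Sp n) {k : Sp n} (hk : k ∈ maxCompact n) :
    denom (g * k) = denom g * denom k := by
  rw [denom_mul, (numer_eq_smul_denom_iff k).2 hk]
  nth_rw 3 [denom]
  simp [Matrix.add_mul]

theorem siegelAct_mul_of_mem (g : Sp n) {k : Sp n} (hk : k ∈ maxCompact n) :
    siegelAct (g * k) (basePoint n) = siegelAct g (basePoint n) := by
  rw [siegelAct_basePoint, siegelAct_basePoint, numer_mul_of_mem g hk, denom_mul_of_mem g hk,
    Matrix.mul_inv_rev, ← Matrix.mul_assoc,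
    Matrix.mul_nonsing_inv_cancel_right _ _ (isUnit_det_denom k)]

/-- The maximal compact subgroup is the stabilizer of the base point. -/
theorem inv_mul_mem_of_siegelAct_eq {g h : Sp n}
    (hgh : siegelAct g (basePoint n) = siegelAct h (basePoint n)) : g⁻¹ * h ∈ maxCompact n := by
  have hg := isUnit_det_denom g
  have hh := isUnit_det_denom h
  set m := (denom g)⁻¹ * denom h with hm
  have h1 : denom h = denom g * m := by rw [hm, Matrix.mul_nonsing_inv_cancel_left _ _ hg]
  have h2 : numer h = numer g * m := by
    rw [siegelAct_basePoint, siegelAct_basePoint] at hgh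
    rw [hm, ← Matrix.mul_assoc, hgh, Matrix.nonsing_inv_mul_cancel_right _ _ hh]
  have h3 (S T : Matrix (Fin n) (Fin n) ℂ) :
      S * numer h + T * denom h = (S * numer g + T * denom g) * m := by
    rw [h1, h2, Matrix.add_mul, Matrix.mul_assoc, Matrix.mul_assoc]
  rw [← numer_eq_smul_denom_iff, numer_mul, denom_mul, h3, h3, ← numer_mul, ← denom_mul,
    inv_mul_cancel, numer_one, denom_one]
  simp

/-- The unitary matrix `A + i B` of an element `[A, B; -B, A]` of the maximal compact subgroup. -/
noncomputable def unitaryPart (k : Sp n) : Matrix (Fin n) (Fin n) ℂ := spA k + Complex.I • spB k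

theorem map_star_denom {k : Sp n} (hk : k ∈ maxCompact n) :
    denom k = (unitaryPart k).map star := by
  rw [denom, unitaryPart, spC_eq_of_mem hk, spD_eq_of_mem hk]
  ext i j
  simp [spA, spB, Matrix.toBlocks₁₁, Matrix.toBlocks₁₂, add_comm]

theorem denom_of_mem {k : Sp n} (hk : k ∈ maxCompact n) :
    denom k = spA k - Complex.I • spB k := by
  rw [denom, spC_eq_of_mem hk, spD_eq_of_mem hk]
  simp only [Matrix.mul_smul, Matrix.mul_one]
  module

theorem unitaryPart_mul (k : Sp n) {k' : Sp n} (hk' : k' ∈ maxCompact n) :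
    unitaryPart (k * k') = unitaryPart k * unitaryPart k' := by
  rw [unitaryPart, unitaryPart, unitaryPart, spA_mul, spB_mul, spC_eq_of_mem hk', spD_eq_of_mem hk']
  simp only [Matrix.add_mul, Matrix.mul_add, Matrix.smul_mul, Matrix.mul_smul, mul_neg]
  (match_scalars <;> ring_nf); simp

theorem unitaryPart_one : unitaryPart (1 : Sp n) = 1 := by
  obtain ⟨h1, h2, -, -⟩ := Matrix.fromBlocks_inj.1 (fromBlocks_one_eq (n := n))
  rw [unitaryPart, h1, h2]
  simp

theorem unitaryPart_mul_conjTranspose {k : Sp n} (hk : k ∈ maxCompact n) :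
    unitaryPart k * (unitaryPart k)ᴴ = 1 := by
  have h := isSimilitude_sp k
  have h1 := denom_numer k
  rw [(numer_eq_smul_denom_iff k).2 hk, Matrix.mul_smul, Matrix.conjTranspose_smul,
    Matrix.smul_mul, Complex.star_def, Complex.conj_I, neg_smul, sub_neg_eq_add, ← two_smul ℂ,
    smul_smul] at h1
  have h2 : denom k * (denom k)ᴴ = 1 := by
    rw [mul_eq_one_comm]
    exact smul_right_injective _ (by simp [Complex.I_ne_zero]) h1
  have h3 : (unitaryPart k)ᵀ = (denom k)ᴴ := by
    rw [map_star_denom hk]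
    ext i j
    simp
  have h4 : (unitaryPart k)ᴴ = (denom k)ᵀ := by
    rw [map_star_denom hk]
    ext i j
    simp
  rw [← Matrix.transpose_inj, Matrix.transpose_mul, h3, h4, Matrix.transpose_transpose, h2,
    Matrix.transpose_one]

theorem norm_det_of_mul_conjTranspose {u : Matrix (Fin n) (Fin n) ℂ} (hu : u * uᴴ = 1) :
    ‖u.det‖ = 1 := by
  have h := congrArg (fun M => ‖Matrix.det M‖) hu
  simp only [Matrix.det_mul, Matrix.det_conjTranspose, norm_mul, norm_star, Matrix.det_one,
    norm_one] at h
  nlinarith [norm_nonneg u.det]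

theorem unitaryPart_injOn : Set.InjOn (unitaryPart : Sp n → _) (maxCompact n) := by
  intro k hk k' hk' h
  obtain ⟨h1, h2⟩ := (mem_maxCompact_iff k).1 hk
  obtain ⟨h3, h4⟩ := (mem_maxCompact_iff k').1 hk'
  have h5 (i j : Fin n) := congrFun (congrFun h i) j
  simp only [unitaryPart, spA, spB, Matrix.add_apply, Matrix.smul_apply, smul_eq_mul] at h5
  have hA : (k : Matrix (Fin n ⊕ Fin n) (Fin n ⊕ Fin n) ℝ).toBlocks₁₁ =
      (k' : Matrix (Fin n ⊕ Fin n) (Fin n ⊕ Fin n) ℝ).toBlocks₁₁ := by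
    ext i j
    simpa [Matrix.toBlocks₁₁, Matrix.toBlocks₁₂] using congrArg Complex.re (h5 i j)
  have hB : (k : Matrix (Fin n ⊕ Fin n) (Fin n ⊕ Fin n) ℝ).toBlocks₁₂ =
      (k' : Matrix (Fin n ⊕ Fin n) (Fin n ⊕ Fin n) ℝ).toBlocks₁₂ := by
    ext i j
    simpa [Matrix.toBlocks₁₁, Matrix.toBlocks₁₂] using congrArg Complex.im (h5 i j)
  refine Subtype.ext ?_
  have h6 := Matrix.fromBlocks_toBlocks (k : Matrix (Fin n ⊕ Fin n) (Fin n ⊕ Fin n) ℝ)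
  have h7 := Matrix.fromBlocks_toBlocks (k' : Matrix (Fin n ⊕ Fin n) (Fin n ⊕ Fin n) ℝ)
  rw [← h6, ← h7, h1, h2, h3, h4, hA, hB]

theorem fromBlocks_re_im_mem {u : Matrix (Fin n) (Fin n) ℂ} (hu : u * uᴴ = 1) :
    Matrix.fromBlocks (u.map Complex.re) (u.map Complex.im) (-u.map Complex.im) (u.map Complex.re) ∈
      Matrix.symplecticGroup (Fin n) ℝ := by
  have hu' : uᴴ * u = 1 := by rw [mul_eq_one_comm, hu]
  have h (i j : Fin n) := congrFun (congrFun hu' i) j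
  simp only [Matrix.mul_apply, Matrix.conjTranspose_apply] at h
  rw [SymplecticGroup.fromBlocks_mem_iff]
  refine ⟨?_, ?_, ?_⟩
  · ext i j
    have := congrArg Complex.im (h i j)
    simp [Matrix.one_apply, apply_ite, Matrix.mul_apply, Finset.sum_add_distrib] at this ⊢
    linarith
  · ext i j
    have := congrArg Complex.im (h i j)
    simp [Matrix.one_apply, apply_ite, Matrix.mul_apply, Finset.sum_add_distrib] at this ⊢
    linarith
  · ext i j
    have := congrArg Complex.re (h i j)
    simp [Matrix.one_apply, apply_ite, Matrix.mul_apply, Finset.sum_add_distrib] at this ⊢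
    split_ifs at this ⊢ <;> linarith

/-- The element of the maximal compact subgroup with a given unitary matrix. -/
noncomputable def ofUnitary (u : Matrix (Fin n) (Fin n) ℂ) (hu : u * uᴴ = 1) : maxCompact n :=
  ⟨⟨_, fromBlocks_re_im_mem hu⟩, (mem_maxCompact_iff _).2 ⟨rfl, by ext i j; simp⟩⟩

@[simp]
theorem unitaryPart_ofUnitary (u : Matrix (Fin n) (Fin n) ℂ) (hu : u * uᴴ = 1) :
    unitaryPart (ofUnitary u hu : Sp n) = u := by
  ext i j
  simp only [unitaryPart, spA, spB, ofUnitary, Matrix.add_apply, Matrix.smul_apply, smul_eq_mul]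
  simp [Matrix.toBlocks₁₁, Matrix.toBlocks₁₂, mul_comm Complex.I]

/-- The Cayley transform of the upper half space to the disc of symmetric contractions. -/
noncomputable def cayley (Z : Matrix (Fin n) (Fin n) ℂ) : Matrix (Fin n) (Fin n) ℂ :=
  mobius 1 (-Complex.I • 1) 1 (Complex.I • 1) Z

theorem isSimilitude_cayley :
    IsSimilitude (2 * Complex.I) (1 : Matrix (Fin n) (Fin n) ℂ) (-Complex.I • 1) 1
      (Complex.I • 1) := by
  refine ⟨by simp, by simp, ?_⟩
  simp only [Matrix.transpose_one, one_mul]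
  module

/-- The Hermitian form of `denom_numer` after the Cayley transform: it becomes the difference of two
squares, so that the image of the upper half space consists of contractions. -/
theorem numer_add_numer_sub (g : Sp n) :
    (numer g + Complex.I • denom g)ᴴ * (numer g + Complex.I • denom g) -
      (numer g - Complex.I • denom g)ᴴ * (numer g - Complex.I • denom g) = (4 : ℂ) • 1 := by
  have h := denom_numer g
  simp only [Matrix.conjTranspose_add, Matrix.conjTranspose_sub, Matrix.conjTranspose_smul,
    Complex.star_def, Complex.conj_I, Matrix.add_mul, Matrix.mul_add, Matrix.sub_mul,
    Matrix.mul_sub, Matrix.smul_mul, Matrix.mul_smul]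
  have h2 := congrArg (fun M => (-(2 * Complex.I)) • M) h
  simp only [smul_smul, smul_sub] at h2
  have h3 : -(2 * Complex.I) * (2 * Complex.I) = 4 := by
    linear_combination -4 * Complex.I_mul_I
  rw [h3] at h2
  rw [← h2]
  module

open scoped ComplexOrder in
theorem isUnit_det_numer_add (g : Sp n) : IsUnit (numer g + Complex.I • denom g).det := by
  rw [isUnit_iff_ne_zero]
  intro h
  obtain ⟨v, hv, hv0⟩ := Matrix.exists_mulVec_eq_zero_iff.2 h
  have hPQ := numer_add_numer_sub g
  generalize numer g - Complex.I • denom g = Q at hPQ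
  have h1 := congrArg (fun M => star v ⬝ᵥ (M *ᵥ v)) hPQ
  simp only [Matrix.sub_mulVec, ← Matrix.mulVec_mulVec, hv0, Matrix.mulVec_zero, zero_sub,
    Matrix.smul_mulVec, Matrix.one_mulVec, dotProduct_smul, dotProduct_neg] at h1
  rw [Matrix.dotProduct_mulVec, ← Matrix.star_mulVec, smul_eq_mul] at h1
  have h2 : 0 < star v ⬝ᵥ v := Matrix.dotProduct_star_self_pos_iff.2 hv
  have h3 := dotProduct_star_self_nonneg (Q *ᵥ v)
  have h4 : (0 : ℂ) < 4 * (star v ⬝ᵥ v) := mul_pos (by norm_num) h2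
  rw [← h1] at h4
  exact absurd (neg_pos.1 h4) h3.not_gt

theorem cayley_siegelAct (g : Sp n) :
    cayley (siegelAct g (basePoint n)) =
      (numer g - Complex.I • denom g) * (numer g + Complex.I • denom g)⁻¹ := by
  have hd := isUnit_det_denom g
  have h1 (c : ℂ) : numer g * (denom g)⁻¹ + c • 1 = (numer g + c • denom g) * (denom g)⁻¹ := by
    rw [Matrix.add_mul, Matrix.smul_mul, Matrix.mul_nonsing_inv _ hd]
  rw [siegelAct_basePoint, cayley, mobius, one_mul, h1, h1, Matrix.mul_inv_rev,
    Matrix.nonsing_inv_nonsing_inv _ hd, Matrix.mul_assoc,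
    Matrix.nonsing_inv_mul_cancel_left _ _ hd, neg_smul, sub_eq_add_neg]

theorem one_sub_cayley_siegelAct (g : Sp n) :
    1 - (cayley (siegelAct g (basePoint n)))ᴴ * cayley (siegelAct g (basePoint n)) =
      (4 : ℂ) • (((numer g + Complex.I • denom g)⁻¹)ᴴ * (numer g + Complex.I • denom g)⁻¹) := by
  have hP := isUnit_det_numer_add g
  have h := numer_add_numer_sub g
  rw [cayley_siegelAct]
  generalize numer g + Complex.I • denom g = P at *
  generalize numer g - Complex.I • denom g = Q at *
  have h1 : (P⁻¹)ᴴ * (Pᴴ * P) * P⁻¹ = 1 := by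
    rw [← Matrix.mul_assoc, ← Matrix.conjTranspose_mul, Matrix.mul_nonsing_inv _ hP,
      Matrix.conjTranspose_one, Matrix.one_mul, Matrix.mul_nonsing_inv _ hP]
  calc 1 - (Q * P⁻¹)ᴴ * (Q * P⁻¹) = (P⁻¹)ᴴ * (Pᴴ * P - Qᴴ * Q) * P⁻¹ := by
        rw [Matrix.mul_sub, Matrix.sub_mul, h1, Matrix.conjTranspose_mul]
        simp only [Matrix.mul_assoc]
    _ = _ := by rw [h, Matrix.mul_smul, Matrix.smul_mul, Matrix.mul_one]

/-- The maximal compact subgroup acts on the disc by `W ↦ u W uᵀ`. -/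
theorem cayley_mul_left {k : Sp n} (hk : k ∈ maxCompact n) (g : Sp n) :
    cayley (siegelAct (k * g) (basePoint n)) =
      unitaryPart k * cayley (siegelAct g (basePoint n)) * (unitaryPart k)ᵀ := by
  have hu := unitaryPart_mul_conjTranspose hk
  have h1 : numer (k * g) - Complex.I • denom (k * g) =
      unitaryPart k * (numer g - Complex.I • denom g) := by
    rw [numer_mul, denom_mul, spC_eq_of_mem hk, spD_eq_of_mem hk, unitaryPart]
    simp only [Matrix.add_mul, Matrix.mul_sub, Matrix.smul_mul, Matrix.mul_smul, Matrix.neg_mul]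
    (match_scalars <;> ring_nf); simp
  have h2 : numer (k * g) + Complex.I • denom (k * g) =
      (unitaryPart k).map star * (numer g + Complex.I • denom g) := by
    rw [← map_star_denom hk, numer_mul, denom_mul, denom_of_mem hk, spC_eq_of_mem hk,
      spD_eq_of_mem hk]
    simp only [Matrix.sub_mul, Matrix.mul_add, Matrix.smul_mul, Matrix.mul_smul, Matrix.neg_mul]
    (match_scalars <;> ring_nf); simp
  have h3 : ((unitaryPart k).map star)⁻¹ = (unitaryPart k)ᵀ := by
    refine Matrix.inv_eq_left_inv ?_
    have h4 := congrArg Matrix.transpose hu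
    have h4' : ((unitaryPart k).map star) * (unitaryPart k)ᵀ = 1 := by
      rw [Matrix.transpose_mul, Matrix.transpose_one] at h4
      rw [← h4]; rfl
    rw [mul_eq_one_comm, h4']
  rw [cayley_siegelAct, cayley_siegelAct, h1, h2, Matrix.mul_inv_rev, h3]
  simp only [Matrix.mul_assoc]

end MaxCompact

/-! ### The Jacobian of the Iwasawa coordinates -/

section TriangularJacobian

variable {𝕜 : Type*} [RCLike 𝕜] {n : ℕ}

/-- The differential of `(a, v) ↦ T = diag(a) U`. -/
noncomputable def upTriDeriv (a : Fin n → ℝ) (v : StrictPairs n → 𝕜) :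
    (Fin n → ℝ) × (StrictPairs n → 𝕜) →ₗ[ℝ] Matrix (Fin n) (Fin n) 𝕜 where
  toFun q := Matrix.diagonal (fun i => (q.1 i : 𝕜)) * (1 + strictMat v) +
    Matrix.diagonal (fun i => (a i : 𝕜)) * strictMat q.2
  map_add' q r := by
    have : (Matrix.diagonal fun i => (((q + r).1 i : ℝ) : 𝕜)) =
        Matrix.diagonal (fun i => (q.1 i : 𝕜)) + Matrix.diagonal (fun i => (r.1 i : 𝕜)) := by
      rw [Matrix.diagonal_add]
      simp
    rw [this, Prod.snd_add, strictMat_add, add_mul, mul_add _ (strictMat q.2)]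
    abel
  map_smul' c q := by
    have : (Matrix.diagonal fun i => (((c • q).1 i : ℝ) : 𝕜)) =
        c • Matrix.diagonal (fun i => (q.1 i : 𝕜)) := by
      ext i j
      by_cases h : i = j
      · subst h; simp [RCLike.real_smul_eq_coe_mul]
      · simp [h]
    rw [this, Prod.smul_snd, strictMat_smul, Matrix.smul_mul, Matrix.mul_smul, smul_add]
    rfl

open scoped Matrix.Norms.Operator in
theorem hasFDerivAt_upTri (a : Fin n → ℝ) (v : StrictPairs n → 𝕜) :
    HasFDerivAt (fun q : (Fin n → ℝ) × (StrictPairs n → 𝕜) => upTri q.1 q.2)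
      (upTriDeriv a v).toContinuousLinearMap (a, v) := by
  let lD : (Fin n → ℝ) × (StrictPairs n → 𝕜) →ₗ[ℝ] Matrix (Fin n) (Fin n) 𝕜 :=
    { toFun := fun q => Matrix.diagonal (fun i => (q.1 i : 𝕜))
      map_add' := fun q r => by rw [Matrix.diagonal_add]; simp
      map_smul' := fun c q => by
        ext i j
        by_cases h : i = j
        · subst h; simp [RCLike.real_smul_eq_coe_mul]
        · simp [h] }
  let lS : (Fin n → ℝ) × (StrictPairs n → 𝕜) →ₗ[ℝ] Matrix (Fin n) (Fin n) 𝕜 :=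
    { toFun := fun q => strictMat q.2
      map_add' := fun q r => strictMat_add _ _
      map_smul' := fun c q => strictMat_smul _ _ }
  obtain ⟨G, hG, hG'⟩ := exists_hasFDerivAt_matrix_mul (hasFDerivAt_of_linear lD (a, v))
    ((hasFDerivAt_of_linear lS (a, v)).const_add 1)
  exact hG.congr_fderiv (ContinuousLinearMap.ext fun q => hG' q)

/-- The coordinates of `T⁻¹ dT` depend on the differentials of `a` and `v` through a linear map with
determinant `∏ aᵢ⁻¹`: the diagonal part is `da / a`, and up to a term in `da` the strictly
triangular part is `U⁻¹ dv`. -/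
theorem exists_upTriDeriv_factor {a : Fin n → ℝ} (ha : ∀ i, 0 < a i) (v : StrictPairs n → 𝕜) :
    ∃ R : (Fin n → ℝ) × (StrictPairs n → 𝕜) →ₗ[ℝ] (Fin n → ℝ) × (StrictPairs n → 𝕜),
      LinearMap.det R = ∏ i, (a i)⁻¹ ∧
      ∀ q, upTriDeriv a v q =
        upTri a v * (Matrix.diagonal (fun i => ((R q).1 i : 𝕜)) + strictMat (R q).2) := by
  set U : Matrix (Fin n) (Fin n) 𝕜 := 1 + strictMat v with hU
  have hUup : U.IsUpperTriangular := isUpperTriangular_one_add_strictMat v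
  have hUdet : IsUnit U.det := by rw [hU, det_one_add_strictMat]; exact isUnit_one
  have hUi := isUpperTriangular_inv hUup hUdet
  -- the diagonal blocks `da ↦ da / a` and `dv ↦ U⁻¹ dv`
  let R1 : (Fin n → ℝ) →ₗ[ℝ] (Fin n → ℝ) := LinearMap.pi fun i => (a i)⁻¹ • LinearMap.proj i
  let R2 : (StrictPairs n → 𝕜) →ₗ[ℝ] (StrictPairs n → 𝕜) := (strictMul U⁻¹).restrictScalars ℝ
  have hR1 : LinearMap.det R1 = ∏ i, (a i)⁻¹ := LinearMap.det_pi_smul _ _ fun x i => rfl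
  have hR2 : LinearMap.det R2 = 1 := by
    have h1 : LinearMap.det (strictMul U⁻¹) = 1 := by
      have h2 : strictMul U⁻¹ ∘ₗ strictMul U = LinearMap.id := by
        refine LinearMap.ext fun w => ?_
        change strictEntries (U⁻¹ * strictMat (strictMul U w)) = w
        rw [strictMat_strictMul hUup, Matrix.nonsing_inv_mul_cancel_left _ _ hUdet,
          strictEntries_strictMat]
      have h3 := congrArg LinearMap.det h2
      rwa [LinearMap.det_comp, det_strictMul_unipotent, mul_one, LinearMap.det_id] at h3
    change LinearMap.det ((strictMul U⁻¹).restrictScalars ℝ) = 1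
    rw [LinearMap.det_restrictScalars, h1, map_one]
  -- the contribution of `da` to the strictly triangular part, which does not affect the determinant
  let S : (Fin n → ℝ) →ₗ[ℝ] (StrictPairs n → 𝕜) :=
    { toFun := fun β => strictEntries (U⁻¹ * Matrix.diagonal (fun i => (β i : 𝕜)) * U)
      map_add' := fun q r => by
        have : (Matrix.diagonal fun i => (((q + r) i : ℝ) : 𝕜)) =
            Matrix.diagonal (fun i => (q i : 𝕜)) + Matrix.diagonal (fun i => (r i : 𝕜)) := by
          rw [Matrix.diagonal_add]
          simp
        rw [this, mul_add U⁻¹ (Matrix.diagonal _), add_mul]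
        rfl
      map_smul' := fun c q => by
        have : (Matrix.diagonal fun i => (((c • q) i : ℝ) : 𝕜)) =
            c • Matrix.diagonal (fun i => (q i : 𝕜)) := by
          ext i j
          by_cases h : i = j
          · subst h; simp [RCLike.real_smul_eq_coe_mul]
          · simp [h]
        rw [this, Matrix.mul_smul, Matrix.smul_mul]
        rfl }
  let N : Module.End ℝ ((Fin n → ℝ) × (StrictPairs n → 𝕜)) :=
    LinearMap.inr ℝ _ _ ∘ₗ S ∘ₗ LinearMap.fst ℝ _ _
  have hN : IsNilpotent N := ⟨2, by
    refine LinearMap.ext fun q => ?_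
    simp [N, pow_two]⟩
  refine ⟨(1 + N) ∘ₗ R1.prodMap R2, ?_, fun q => ?_⟩
  · rw [LinearMap.det_comp, LinearMap.det_one_add_of_isNilpotent hN, LinearMap.det_prodMap, hR1,
      hR2, one_mul, mul_one]
  · have e1 : (((1 + N) ∘ₗ R1.prodMap R2) q).1 = R1 q.1 := by simp [N]
    have e2 : (((1 + N) ∘ₗ R1.prodMap R2) q).2 = R2 q.2 + S (R1 q.1) := by simp [N]
    rw [e1, e2]
    have h1 : strictMat (R2 q.2) = U⁻¹ * strictMat q.2 := strictMat_strictMul hUi q.2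
    set Δ : Matrix (Fin n) (Fin n) 𝕜 := Matrix.diagonal (fun i => (R1 q.1 i : 𝕜)) with hΔ
    have h2 : Δ + strictMat (S (R1 q.1)) = U⁻¹ * Δ * U := by
      have hup : (U⁻¹ * Δ * U).IsUpperTriangular :=
        isUpperTriangular_mul (isUpperTriangular_mul hUi (Matrix.blockTriangular_diagonal _)) hUup
      -- the diagonal of a product of upper triangular matrices is the product of the diagonals
      have hUd (i : Fin n) : U i i = 1 := by simp [hU, strictMat_apply_of_le]
      have hdiag {A B : Matrix (Fin n) (Fin n) 𝕜} (hA : A.IsUpperTriangular)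
          (hB : B.IsUpperTriangular) (i : Fin n) : (A * B) i i = A i i * B i i := by
        rw [Matrix.mul_apply]
        refine Finset.sum_eq_single i (fun k _ hk => ?_) (by simp)
        rcases lt_or_gt_of_ne hk with h | h
        · rw [hA h, zero_mul]
        · rw [hB h, mul_zero]
      have hUid (i : Fin n) : U⁻¹ i i = 1 := by
        have := congrFun (congrFun (Matrix.nonsing_inv_mul U hUdet) i) i
        rw [hdiag hUi hUup, hUd, mul_one] at this
        simpa using this
      ext i j
      rcases lt_trichotomy i j with h | h | h
      · rw [Matrix.add_apply, hΔ, Matrix.diagonal_apply_ne _ h.ne, zero_add,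
          strictMat_apply_of_lt _ h]
        rfl
      · subst h
        rw [Matrix.add_apply, strictMat_apply_of_le _ le_rfl, add_zero,
          hdiag (isUpperTriangular_mul hUi (Matrix.blockTriangular_diagonal _)) hUup,
          hdiag hUi (Matrix.blockTriangular_diagonal _), hUd, hUid, one_mul, mul_one]
      · rw [hup h, Matrix.add_apply, strictMat_apply_of_le _ (le_of_lt h), add_zero, hΔ,
          Matrix.diagonal_apply_ne _ (ne_of_gt h)]
    rw [strictMat_add, h1, add_left_comm, h2, ← add_comm, mul_add, upTri, ← hU]
    change _ * U + _ = _
    rw [Matrix.mul_assoc _ U, Matrix.mul_assoc _ U, Matrix.mul_assoc,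
      Matrix.mul_nonsing_inv_cancel_left _ _ hUdet,
      Matrix.mul_nonsing_inv_cancel_left _ _ hUdet, ← Matrix.mul_assoc, hΔ,
      Matrix.diagonal_mul_diagonal]
    congr 3
    ext i
    have : (a i : 𝕜) ≠ 0 := by exact_mod_cast (ha i).ne'
    simp [R1, this]

end TriangularJacobian

/-! ### Iwasawa coordinates on the upper half space -/

section Iwasawa

variable {n : ℕ}

/-- The coordinates `(a, (v, x))` of the element `a n` of the group `A N`. -/
abbrev IwasawaCoord (n : ℕ) : Type :=
  (Fin n → ℝ) × ((StrictPairs n → ℝ) × (UpperPairs n → ℝ))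

/-- The coordinates `(X, Y)` of the point `X + i Y`. -/
abbrev SiegelCoord (n : ℕ) : Type := (UpperPairs n → ℝ) × (UpperPairs n → ℝ)

/-- The coordinates of the point `a n · i1`. -/
noncomputable def iwasawaMap (q : IwasawaCoord n) : SiegelCoord n :=
  (upperEntries (upTri q.1 q.2.1 * symMat q.2.2 * (upTri q.1 q.2.1)ᵀ),
    upperEntries (upTri q.1 q.2.1 * (upTri q.1 q.2.1)ᵀ))

/-- The identification of the two coordinate spaces that matches `a` with the diagonal of `Y`, `v`
with the entries of `Y` above it, and `x` with `X`. -/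
noncomputable def iwasawaEquiv (n : ℕ) : IwasawaCoord n ≃ᵐ SiegelCoord n :=
  MeasurableEquiv.prodAssoc.symm.trans (MeasurableEquiv.prodComm.trans
    (MeasurableEquiv.prodCongr (MeasurableEquiv.refl _)
      (MeasurableEquiv.prodComm.trans (glueEquiv ℝ (upperIndexEquiv n)))))

theorem measurePreserving_iwasawaEquiv : MeasurePreserving (iwasawaEquiv n) := by
  have h : MeasurePreserving
      (MeasurableEquiv.prodComm.trans (glueEquiv ℝ (upperIndexEquiv n))) :=
    (measurePreserving_glueEquiv _).comp Measure.measurePreserving_swap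
  exact ((MeasurePreserving.id _).prod h).comp
    (Measure.measurePreserving_swap.comp (volume_preserving_prodAssoc.symm _))

theorem glueEquiv_ext {ι ι' κ R : Type*} [MeasurableSpace R] (e : ι ⊕ ι' ≃ κ)
    (p : (ι → R) × (ι' → R)) {f : κ → R} (h1 : ∀ i, f (e (Sum.inl i)) = p.1 i)
    (h2 : ∀ i, f (e (Sum.inr i)) = p.2 i) : glueEquiv R e p = f := by
  ext k
  obtain ⟨i | i, rfl⟩ := e.surjective k
  · rw [glueEquiv_inl, h1]
  · rw [glueEquiv_inr, h2]

theorem glueEquiv_add {ι ι' κ R : Type*} [MeasurableSpace R] [Add R] (e : ι ⊕ ι' ≃ κ)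
    (p q : (ι → R) × (ι' → R)) : glueEquiv R e (p + q) = glueEquiv R e p + glueEquiv R e q :=
  glueEquiv_ext e _ (by simp) (by simp)

theorem glueEquiv_smul {ι ι' κ R S : Type*} [MeasurableSpace R] [SMul S R] (e : ι ⊕ ι' ≃ κ)
    (c : S) (p : (ι → R) × (ι' → R)) : glueEquiv R e (c • p) = c • glueEquiv R e p :=
  glueEquiv_ext e _ (by simp) (by simp)

/-- The linear equivalence underlying `iwasawaEquiv`. -/
noncomputable def iwasawaLinear (n : ℕ) : IwasawaCoord n ≃L[ℝ] SiegelCoord n :=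
  (iwasawaEquiv n).toContinuousLinearEquiv
    (fun x y => Prod.ext rfl (glueEquiv_add _ (x.2.1, x.1) (y.2.1, y.1)))
    (fun c x => Prod.ext rfl (glueEquiv_smul _ c (x.2.1, x.1)))

theorem measurePreserving_iwasawaLinear :
    MeasurePreserving (iwasawaLinear n) :=
  measurePreserving_iwasawaEquiv

open scoped Matrix.Norms.Operator in
theorem exists_hasFDerivAt_iwasawaMap (q : IwasawaCoord n) :
    ∃ G : IwasawaCoord n →L[ℝ] SiegelCoord n, HasFDerivAt iwasawaMap G q ∧
      ∀ h, G h =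
        (upperEntries (upTriDeriv q.1 q.2.1 (h.1, h.2.1) * symMat q.2.2 * (upTri q.1 q.2.1)ᵀ +
          upTri q.1 q.2.1 * symMat h.2.2 * (upTri q.1 q.2.1)ᵀ +
          upTri q.1 q.2.1 * symMat q.2.2 * (upTriDeriv q.1 q.2.1 (h.1, h.2.1))ᵀ),
        upperEntries (upTriDeriv q.1 q.2.1 (h.1, h.2.1) * (upTri q.1 q.2.1)ᵀ +
          upTri q.1 q.2.1 * (upTriDeriv q.1 q.2.1 (h.1, h.2.1))ᵀ)) := by
  let pr : IwasawaCoord n →L[ℝ] (Fin n → ℝ) × (StrictPairs n → ℝ) :=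
    (ContinuousLinearMap.fst ℝ _ _).prod
      ((ContinuousLinearMap.fst ℝ _ _).comp (ContinuousLinearMap.snd ℝ _ _))
  let symL : IwasawaCoord n →ₗ[ℝ] Matrix (Fin n) (Fin n) ℝ :=
    { toFun := fun q => symMat q.2.2
      map_add' := fun _ _ => rfl
      map_smul' := fun _ _ => rfl }
  let upL : Matrix (Fin n) (Fin n) ℝ →ₗ[ℝ] (UpperPairs n → ℝ) :=
    { toFun := upperEntries, map_add' := fun _ _ => rfl, map_smul' := fun _ _ => rfl }
  have hT : HasFDerivAt (fun q : IwasawaCoord n => upTri (𝕜 := ℝ) q.1 q.2.1)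
      ((upTriDeriv q.1 q.2.1).toContinuousLinearMap.comp pr) q :=
    HasFDerivAt.comp (g := fun p : (Fin n → ℝ) × (StrictPairs n → ℝ) => upTri p.1 p.2) q
      (hasFDerivAt_upTri q.1 q.2.1) pr.hasFDerivAt
  obtain ⟨GT, hGT, hGT'⟩ := exists_hasFDerivAt_matrix_transpose hT
  obtain ⟨G1, hG1, hG1'⟩ := exists_hasFDerivAt_matrix_mul hT (hasFDerivAt_of_linear symL q)
  obtain ⟨G2, hG2, hG2'⟩ := exists_hasFDerivAt_matrix_mul hG1 hGT
  obtain ⟨G3, hG3, hG3'⟩ := exists_hasFDerivAt_matrix_mul hT hGT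
  obtain ⟨G4, hG4, hG4'⟩ := hasFDerivAt_linear_comp upL hG2
  obtain ⟨G5, hG5, hG5'⟩ := hasFDerivAt_linear_comp upL hG3
  refine ⟨G4.prod G5, hG4.prodMk hG5, fun h => ?_⟩
  rw [ContinuousLinearMap.prod_apply, hG4', hG5', hG2', hG3', hG1', hGT', add_mul]
  rfl

/-- The Jacobian of the Iwasawa coordinates. -/
theorem abs_det_iwasawaMap {q : IwasawaCoord n} (hq : ∀ i, 0 < q.1 i)
    {G : IwasawaCoord n →L[ℝ] SiegelCoord n} (hG : ∀ h, G h =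
        (upperEntries (upTriDeriv q.1 q.2.1 (h.1, h.2.1) * symMat q.2.2 * (upTri q.1 q.2.1)ᵀ +
          upTri q.1 q.2.1 * symMat h.2.2 * (upTri q.1 q.2.1)ᵀ +
          upTri q.1 q.2.1 * symMat q.2.2 * (upTriDeriv q.1 q.2.1 (h.1, h.2.1))ᵀ),
        upperEntries (upTriDeriv q.1 q.2.1 (h.1, h.2.1) * (upTri q.1 q.2.1)ᵀ +
          upTri q.1 q.2.1 * (upTriDeriv q.1 q.2.1 (h.1, h.2.1))ᵀ))) :
    |(((iwasawaLinear n).symm : SiegelCoord n →L[ℝ] IwasawaCoord n).comp G).det| =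
      2 ^ n * (∏ i, (q.1 i)⁻¹) * (∏ i, q.1 i) ^ (2 * (n + 1)) := by
  obtain ⟨a, v, x⟩ := q
  simp only at hq hG ⊢
  obtain ⟨R, hRdet, hR⟩ := exists_upTriDeriv_factor (𝕜 := ℝ) hq v
  set T : Matrix (Fin n) (Fin n) ℝ := upTri a v with hT
  have hTdet : T.det = ∏ i, a i := by rw [hT, det_upTri]; rfl
  have hTne : T.det ≠ 0 := (isUnit_det_upTri hq v).ne_zero
  -- with `T⁻¹ dT = τ` one has `dY = T (τ + ᵗτ) ᵗT`: the coordinates of `τ + ᵗτ` are those of `τ`,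
  -- with the diagonal doubled
  let R' : IwasawaCoord n →ₗ[ℝ] IwasawaCoord n :=
    (LinearEquiv.prodAssoc ℝ _ _ _).toLinearMap ∘ₗ
      ((((2 : ℝ) • LinearMap.id).prodMap LinearMap.id ∘ₗ R).prodMap LinearMap.id) ∘ₗ
      (LinearEquiv.prodAssoc ℝ _ _ _).symm.toLinearMap
  have hR'det : LinearMap.det R' = 2 ^ n * ∏ i, (a i)⁻¹ := by
    have := LinearMap.det_conj
      ((((2 : ℝ) • LinearMap.id).prodMap LinearMap.id ∘ₗ R).prodMap
        (LinearMap.id : (UpperPairs n → ℝ) →ₗ[ℝ] _))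
      (LinearEquiv.prodAssoc ℝ (Fin n → ℝ) (StrictPairs n → ℝ) (UpperPairs n → ℝ))
    refine this.trans ?_
    rw [LinearMap.det_prodMap, LinearMap.det_comp, LinearMap.det_prodMap, hRdet,
      LinearMap.det_id, LinearMap.det_id, LinearMap.det_smul, LinearMap.det_id]
    simp
  -- the dependence of `dX` on `dY`: `τ` is recovered from the symmetric matrix `τ + ᵗτ` as its
  -- upper half, and the map `dY ↦ dX` only contributes a unipotent factor
  let halfTri : (UpperPairs n → ℝ) →ₗ[ℝ] Matrix (Fin n) (Fin n) ℝ :=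
    { toFun := fun y => Matrix.of fun i j =>
        if i < j then symMat y i j else if i = j then symMat y i j / 2 else 0
      map_add' := fun y z => by
        ext i j
        simp only [symMat_add, Matrix.add_apply, Matrix.of_apply]
        split_ifs <;> ring
      map_smul' := fun c y => by
        ext i j
        simp only [symMat_smul, Matrix.smul_apply, Matrix.of_apply, smul_eq_mul, RingHom.id_apply]
        split_ifs <;> ring }
  let g : (UpperPairs n → ℝ) →ₗ[ℝ] (UpperPairs n → ℝ) :=
    { toFun := fun y => upperEntries (halfTri y * symMat x + symMat x * (halfTri y)ᵀ)
      map_add' := fun y z => by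
        rw [map_add, Matrix.transpose_add, mul_add, add_mul, add_add_add_comm]
        rfl
      map_smul' := fun c y => by
        rw [map_smul, Matrix.transpose_smul, Matrix.smul_mul, Matrix.mul_smul, ← smul_add]
        rfl }
  let N : Module.End ℝ (SiegelCoord n) := LinearMap.inl ℝ _ _ ∘ₗ g ∘ₗ LinearMap.snd ℝ _ _
  have hN : IsNilpotent N := ⟨2, by
    refine LinearMap.ext fun q => ?_
    simp [N, pow_two]⟩
  let L : IwasawaCoord n ≃ₗ[ℝ] SiegelCoord n := (iwasawaLinear n).toLinearEquiv
  have hL (q : IwasawaCoord n) : L q = (q.2.2, glueEquiv ℝ (upperIndexEquiv n) (q.2.1, q.1)) := rfl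
  have hfac : (G : IwasawaCoord n →ₗ[ℝ] SiegelCoord n) =
      ((congrSym T).prodMap (congrSym T) ∘ₗ (1 + N)) ∘ₗ L.toLinearMap ∘ₗ R' := by
    refine LinearMap.ext fun h => ?_
    set r := R (h.1, h.2.1) with hr
    have hR'h : R' h = ((2 : ℝ) • r.1, (r.2, h.2.2)) := rfl
    set τ := Matrix.diagonal r.1 + strictMat r.2 with hτ
    have hdT : upTriDeriv a v (h.1, h.2.1) = T * τ := hR (h.1, h.2.1)
    have hy : symMat (glueEquiv ℝ (upperIndexEquiv n) (r.2, (2 : ℝ) • r.1)) = τ + τᵀ := by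
      have hs : (τ + τᵀ).IsSymm := by
        rw [Matrix.IsSymm, Matrix.transpose_add, Matrix.transpose_transpose, add_comm]
      rw [← symMat_upperEntries hs]
      congr 1
      refine glueEquiv_ext _ _ (fun p => ?_) fun i => ?_
      · obtain ⟨⟨i, j⟩, hij⟩ := p
        have hij' : i < j := hij
        change (τ + τᵀ) i j = r.2 ⟨(i, j), hij⟩
        simp [hτ, strictMat_apply_of_lt _ hij', strictMat_apply_of_le _ hij'.le, hij'.ne]
      · change (τ + τᵀ) i i = 2 * r.1 i
        simp [hτ, strictMat_apply_of_le _ le_rfl]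
        ring
    have hhalf : halfTri (glueEquiv ℝ (upperIndexEquiv n) (r.2, (2 : ℝ) • r.1)) = τ := by
      ext i j
      change (if i < j then symMat _ i j else if i = j then symMat _ i j / 2 else 0) = _
      rw [hy]
      rcases lt_trichotomy i j with hij | hij | hij
      · simp [hτ, hij, strictMat_apply_of_le _ hij.le, Matrix.diagonal_apply_ne r.1 hij.ne]
      · subst hij
        simp [hτ]
      · simp [hτ, hij.not_gt, hij.ne', strictMat_apply_of_le _ hij.le]
    have hLR : L (R' h) = (h.2.2, glueEquiv ℝ (upperIndexEquiv n) (r.2, (2 : ℝ) • r.1)) := rfl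
    change G h = (congrSym T).prodMap (congrSym T) ((1 + N) (L (R' h)))
    rw [hLR]
    set y := glueEquiv ℝ (upperIndexEquiv n) (r.2, (2 : ℝ) • r.1)
    have h1N : (1 + N) (h.2.2, y) = (h.2.2 + g y, y) := by
      simp [N]
    have hgy : symMat (g y) = τ * symMat x + symMat x * τᵀ := by
      have hs : (τ * symMat x + symMat x * τᵀ).IsSymm := by
        simp [Matrix.IsSymm, Matrix.transpose_mul, symMat_transpose, add_comm]
      rw [← symMat_upperEntries hs, ← hhalf]
      rfl
    rw [h1N, hG, hdT]
    refine Prod.ext ?_ ?_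
    · change _ = upperEntries (T * symMat (h.2.2 + g y) * Tᵀ)
      rw [symMat_add, hgy, Matrix.transpose_mul]
      noncomm_ring
    · change _ = upperEntries (T * symMat y * Tᵀ)
      rw [hy, Matrix.transpose_mul]
      noncomm_ring
  have hdet : (((iwasawaLinear n).symm : SiegelCoord n →L[ℝ] IwasawaCoord n).comp G).det =
      LinearMap.det ((L.symm.toLinearMap ∘ₗ
        ((congrSym T).prodMap (congrSym T) ∘ₗ (1 + N)) ∘ₗ L.toLinearMap) ∘ₗ R') := by
    change LinearMap.det (L.symm.toLinearMap ∘ₗ (G : IwasawaCoord n →ₗ[ℝ] SiegelCoord n)) = _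
    rw [hfac]
    rfl
  rw [hdet, LinearMap.det_comp, hR'det]
  have hconj := LinearMap.det_conj ((congrSym T).prodMap (congrSym T) ∘ₗ (1 + N)) L.symm
  rw [LinearEquiv.symm_symm] at hconj
  rw [hconj, LinearMap.det_comp, LinearMap.det_prodMap, det_congrSym hTne,
    LinearMap.det_one_add_of_isNilpotent hN, hTdet]
  have hpos : 0 < ∏ i, a i := Finset.prod_pos fun i _ => hq i
  have hpos' : 0 < ∏ i, (a i)⁻¹ := Finset.prod_pos fun i _ => inv_pos.2 (hq i)
  rw [abs_of_pos (by positivity)]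
  ring

end Iwasawa

/-! ### The Iwasawa decomposition -/

section IwasawaDecomposition

variable {n : ℕ}

theorem unipotentMatrix_eq (v : StrictPairs n → ℝ) : unipotentMatrix v = 1 + strictMat v := by
  ext i j
  rcases lt_trichotomy i j with h | h | h
  · simp [unipotentMatrix, h, strictMat_apply_of_lt _ h, h.ne]
  · simp [unipotentMatrix, h, strictMat_apply_of_le _ le_rfl]
  · simp [unipotentMatrix, h.not_gt, h.ne', strictMat_apply_of_le _ h.le]

theorem coe_iwasawa (a : PosVec n) (p : (StrictPairs n → ℝ) × (UpperPairs n → ℝ)) :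
    ((diagSp a * unipotentSp p : Sp n) : Matrix (Fin n ⊕ Fin n) (Fin n ⊕ Fin n) ℝ) =
      Matrix.fromBlocks (upTri a.1 p.1) (upTri a.1 p.1 * symMat p.2) 0 ((upTri a.1 p.1)ᵀ)⁻¹ := by
  have h1 : upTri a.1 p.1 = Matrix.diagonal a.1 * unipotentMatrix p.1 := by
    rw [unipotentMatrix_eq]; rfl
  have h2 : (Matrix.diagonal a.1)⁻¹ = Matrix.diagonal fun i => (a.1 i)⁻¹ := by
    refine Matrix.inv_eq_right_inv ?_
    rw [Matrix.diagonal_mul_diagonal, ← Matrix.diagonal_one]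
    congr 1
    ext i
    exact mul_inv_cancel₀ (a.2 i).ne'
  rw [h1, Matrix.transpose_mul, Matrix.mul_inv_rev, Matrix.diagonal_transpose, h2]
  simp only [unipotentSp, diagSp, leviUnipotentSp, siegelUnipotentSp, Submonoid.coe_mul,
    Matrix.fromBlocks_multiply, Matrix.mul_zero, Matrix.zero_mul, add_zero, zero_add,
    Matrix.mul_one, Matrix.mul_assoc]
  rfl

theorem complexSym_eq (p : SiegelCoord n) : complexSym p = symMat (reImEquiv _ p) := by
  ext i j
  simp only [complexSym, symMatrix, symMat, Matrix.add_apply, Matrix.map_apply, Matrix.of_apply,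
    Matrix.smul_apply, smul_eq_mul, reImEquiv_apply]
  apply Complex.ext <;> simp

/-- With `T = diag(a) U`, the point `a n · i1` is `T X ᵗT + i T ᵗT`. -/
theorem siegelAct_iwasawa (a : PosVec n) (p : (StrictPairs n → ℝ) × (UpperPairs n → ℝ)) :
    siegelAct (diagSp a * unipotentSp p) (basePoint n) = complexSym (iwasawaMap (a.1, p)) := by
  set T := upTri (𝕜 := ℝ) a.1 p.1 with hT
  have hTdet : IsUnit T.det := isUnit_det_upTri a.2 p.1
  have hc := coe_iwasawa a p
  have hA : spA (diagSp a * unipotentSp p) = T.map Complex.ofReal := by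
    rw [spA, hc]; rfl
  have hB : spB (diagSp a * unipotentSp p) = (T * symMat p.2).map Complex.ofReal := by
    rw [spB, hc]; rfl
  have hC : spC (diagSp a * unipotentSp p) = 0 := by
    rw [spC, hc]
    ext i j
    simp [Matrix.toBlocks₂₁]
  have hD : spD (diagSp a * unipotentSp p) = (Tᵀ⁻¹).map Complex.ofReal := by
    rw [spD, hc]; rfl
  have hmap (M N : Matrix (Fin n) (Fin n) ℝ) :
      (M * N).map Complex.ofReal = M.map Complex.ofReal * N.map Complex.ofReal :=
    Matrix.map_mul (f := Complex.ofRealHom)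
  have hinv : ((Tᵀ⁻¹).map Complex.ofReal)⁻¹ = Tᵀ.map Complex.ofReal := by
    refine Matrix.inv_eq_left_inv ?_
    rw [← hmap, Matrix.mul_nonsing_inv _ (by rwa [Matrix.det_transpose])]
    ext i j
    by_cases h : i = j <;> simp [Matrix.one_apply, h]
  rw [siegelAct_basePoint, numer, denom, hA, hB, hC, hD, Matrix.zero_mul, zero_add, hinv,
    Matrix.mul_smul, Matrix.mul_one, Matrix.add_mul, Matrix.smul_mul, ← hmap, ← hmap, add_comm]
  have h1 : symMatrix (iwasawaMap (a.1, p)).1 = T * symMat p.2 * Tᵀ :=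
    symMat_upperEntries (M := T * symMat p.2 * Tᵀ) (by
      simp [Matrix.IsSymm, Matrix.transpose_mul, symMat_transpose, Matrix.mul_assoc])
  have h2 : symMatrix (iwasawaMap (a.1, p)).2 = T * Tᵀ :=
    symMat_upperEntries (M := T * Tᵀ) (by simp [Matrix.IsSymm, Matrix.transpose_mul])
  rw [complexSym, h1, h2]

theorem complexSym_mem_iff (p : SiegelCoord n) :
    complexSym p ∈ siegelUpperHalfSpace n ↔ (symMatrix p.2).PosDef := by
  have h1 : (complexSym p).IsSymm := by rw [complexSym_eq]; exact symMat_isSymm _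
  have h2 : (complexSym p).map Complex.im = symMatrix p.2 := by
    ext i j
    simp [complexSym]
  simp [siegelUpperHalfSpace, h1, h2]

theorem exists_complexSym_eq {Z : Matrix (Fin n) (Fin n) ℂ} (hZ : Z.IsSymm) :
    ∃ p : SiegelCoord n, complexSym p = Z := by
  refine ⟨(reImEquiv _).symm (upperEntries Z), ?_⟩
  rw [complexSym_eq, MeasurableEquiv.apply_symm_apply, symMat_upperEntries hZ]

/-- The group `A N` acts transitively on the upper half space. -/
theorem exists_iwasawaMap_eq {p : SiegelCoord n} (hp : complexSym p ∈ siegelUpperHalfSpace n) :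
    ∃ q : IwasawaCoord n, (∀ i, 0 < q.1 i) ∧ iwasawaMap q = p := by
  rw [complexSym_mem_iff] at hp
  obtain ⟨a, v, ha, hav⟩ := exists_cholesky hp
  have hTdet : IsUnit (upTri (𝕜 := ℝ) a v).det := isUnit_det_upTri ha v
  rw [Matrix.conjTranspose_eq_transpose_of_trivial] at hav
  refine ⟨(a, (v, congrSym (upTri a v)⁻¹ p.1)), ha, Prod.ext ?_ ?_⟩
  · change upperEntries (upTri a v * symMat (congrSym (upTri a v)⁻¹ p.1) * (upTri a v)ᵀ) = p.1
    rw [symMat_congrSym, Matrix.mul_assoc, Matrix.mul_assoc, Matrix.mul_assoc,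
      ← Matrix.transpose_mul, Matrix.mul_nonsing_inv _ hTdet, Matrix.transpose_one, Matrix.mul_one,
      Matrix.mul_nonsing_inv_cancel_left _ _ hTdet, upperEntries_symMat]
  · change upperEntries (upTri a v * (upTri a v)ᵀ) = p.2
    rw [← hav]
    exact upperEntries_symMat p.2

theorem iwasawaMap_injOn : Set.InjOn iwasawaMap {q : IwasawaCoord n | ∀ i, 0 < q.1 i} := by
  rintro ⟨a, v, x⟩ ha ⟨a', v', x'⟩ ha' h
  have hsymm (T : Matrix (Fin n) (Fin n) ℝ) : (T * Tᵀ).IsSymm := by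
    simp [Matrix.IsSymm, Matrix.transpose_mul]
  have h2 := congrArg symMat (congrArg Prod.snd h)
  change symMat (upperEntries (upTri a v * (upTri a v)ᵀ)) =
    symMat (upperEntries (upTri a' v' * (upTri a' v')ᵀ)) at h2
  rw [symMat_upperEntries (hsymm _), symMat_upperEntries (hsymm _)] at h2
  obtain ⟨rfl, rfl⟩ := cholesky_unique (𝕜 := ℝ) ha ha' (by
    rw [Matrix.conjTranspose_eq_transpose_of_trivial, Matrix.conjTranspose_eq_transpose_of_trivial,
      h2])
  have h1 : congrSym (upTri (𝕜 := ℝ) a v) x = congrSym (upTri a v) x' := congrArg Prod.fst h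
  have hTdet : IsUnit (upTri (𝕜 := ℝ) a v).det := isUnit_det_upTri ha v
  have h3 := congrArg (congrSym (upTri a v)⁻¹) h1
  rw [← LinearMap.comp_apply, ← LinearMap.comp_apply, ← congrSym_mul,
    Matrix.nonsing_inv_mul _ hTdet, congrSym_one] at h3
  rw [show x = x' from h3]

theorem complexSym_iwasawaMap_mem {q : IwasawaCoord n} (hq : ∀ i, 0 < q.1 i) :
    complexSym (iwasawaMap q) ∈ siegelUpperHalfSpace n := by
  rw [← siegelAct_iwasawa ⟨q.1, hq⟩ q.2]
  exact siegelAct_basePoint_mem _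

theorem image_iwasawaMap :
    iwasawaMap '' {q : IwasawaCoord n | ∀ i, 0 < q.1 i} =
      {p | complexSym p ∈ siegelUpperHalfSpace n} := by
  ext p
  constructor
  · rintro ⟨q, hq, rfl⟩
    exact complexSym_iwasawaMap_mem hq
  · intro hp
    obtain ⟨q, hq, rfl⟩ := exists_iwasawaMap_eq hp
    exact ⟨q, hq, rfl⟩

instance isAddHaarMeasure_unipotentCoord :
    (volume : Measure ((StrictPairs n → ℝ) × (UpperPairs n → ℝ))).IsAddHaarMeasure :=
  Measure.prod.instIsAddHaarMeasure (volume : Measure (StrictPairs n → ℝ))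
    (volume : Measure (UpperPairs n → ℝ))

instance isAddHaarMeasure_iwasawaCoord : (volume : Measure (IwasawaCoord n)).IsAddHaarMeasure :=
  Measure.prod.instIsAddHaarMeasure (volume : Measure (Fin n → ℝ))
    (volume : Measure ((StrictPairs n → ℝ) × (UpperPairs n → ℝ)))

theorem measurableSet_pos : MeasurableSet {q : IwasawaCoord n | ∀ i, 0 < q.1 i} := by
  rw [Set.ofPred_forall]
  exact MeasurableSet.iInter fun i =>
    measurableSet_lt measurable_const ((measurable_pi_apply i).comp measurable_fst)

theorem measurableEmbedding_iwasawaMap :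
    MeasurableEmbedding ({q : IwasawaCoord n | ∀ i, 0 < q.1 i}.domRestrict iwasawaMap) := by
  choose G hG _ using fun q : IwasawaCoord n => exists_hasFDerivAt_iwasawaMap q
  exact measurableEmbedding_of_measurePreserving measurableSet_pos (fun q _ => hG q)
    iwasawaMap_injOn (iwasawaLinear n)

theorem measurableSet_siegelCoord :
    MeasurableSet {p : SiegelCoord n | complexSym p ∈ siegelUpperHalfSpace n} := by
  have h := (measurableEmbedding_iwasawaMap (n := n)).measurableSet_range
  rwa [Set.range_domRestrict, image_iwasawaMap] at h

theorem det_symMatrix_iwasawaMap (q : IwasawaCoord n) :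
    (symMatrix (iwasawaMap q).2).det = (∏ i, q.1 i) ^ 2 := by
  have h2 : symMatrix (iwasawaMap q).2 = upTri q.1 q.2.1 * (upTri q.1 q.2.1)ᵀ :=
    symMat_upperEntries (M := upTri q.1 q.2.1 * (upTri q.1 q.2.1)ᵀ)
      (by simp [Matrix.IsSymm, Matrix.transpose_mul])
  rw [h2, Matrix.det_mul, Matrix.det_transpose, det_upTri, pow_two]
  rfl

theorem measurable_prod_inv :
    Measurable fun a : Fin n → ℝ => ENNReal.ofReal (∏ i, (a i)⁻¹) :=
  (Finset.measurable_prod _ fun i _ => (measurable_pi_apply i).inv).ennreal_ofReal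

theorem measurableSet_posVec : MeasurableSet {a : Fin n → ℝ | ∀ i, 0 < a i} := by
  rw [Set.ofPred_forall]
  exact MeasurableSet.iInter fun i => measurableSet_lt measurable_const (measurable_pi_apply i)

theorem lintegral_diagMeasure (f : (Fin n → ℝ) → ℝ≥0∞) :
    ∫⁻ a : PosVec n, f a.1 ∂(diagMeasure n) =
      ∫⁻ a in {a : Fin n → ℝ | ∀ i, 0 < a i}, ENNReal.ofReal (∏ i, (a i)⁻¹) * f a := by
  rw [diagMeasure, lintegral_withDensity_eq_lintegral_mul_non_measurable _
    (show Measurable fun a : PosVec n => ENNReal.ofReal (∏ i, (a.1 i)⁻¹) from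
      measurable_prod_inv.comp measurable_subtype_coe) (.of_forall fun _ => ENNReal.ofReal_lt_top)]
  exact lintegral_subtype_comap measurableSet_posVec
    fun a : Fin n → ℝ => ENNReal.ofReal (∏ i, (a i)⁻¹) * f a

/-- Tonelli's theorem over the cylinder `s × β`, for a function that is only known to be measurable
on this cylinder. -/
theorem setLIntegral_prod_univ_mul {α β : Type*} [MeasurableSpace α] [MeasurableSpace β]
    {μ : Measure α} {ν : Measure β} [SFinite μ] [SFinite ν] {s : Set α} (hs : MeasurableSet s)
    {w : α → ℝ≥0∞} (hw : Measurable w) (hw' : ∀ a, w a ≠ ∞) {f : α × β → ℝ≥0∞}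
    (hf : Measurable fun q : s × β => f (q.1.1, q.2)) :
    ∫⁻ q in s ×ˢ Set.univ, w q.1 * f q ∂(μ.prod ν) = ∫⁻ a in s, w a * ∫⁻ b, f (a, b) ∂ν ∂μ := by
  have hsu : MeasurableSet (s ×ˢ (Set.univ : Set β)) := hs.prod MeasurableSet.univ
  have hm : AEMeasurable (fun q : α × β => w q.1 * f q) ((μ.restrict s).prod ν) := by
    rw [← Measure.restrict_univ (μ := ν), Measure.prod_restrict]
    refine (hw.comp measurable_fst).aemeasurable.mul ?_
    rw [← map_comap_subtype_coe hsu (μ.prod ν),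
      (MeasurableEmbedding.subtype_coe hsu).aemeasurable_map_iff]
    refine Measurable.aemeasurable ?_
    have : Measurable fun q : (s ×ˢ (Set.univ : Set β) : Set (α × β)) =>
        ((⟨q.1.1, q.2.1⟩, q.1.2) : s × β) :=
      ((measurable_fst.comp measurable_subtype_coe).subtype_mk).prodMk
        (measurable_snd.comp measurable_subtype_coe)
    exact hf.comp this
  rw [← Measure.prod_restrict, Measure.restrict_univ, lintegral_prod _ hm]
  exact lintegral_congr fun a => lintegral_const_mul' _ _ (hw' a)

/-- The invariant integral over the upper half space in Iwasawa coordinates. -/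
theorem lintegral_siegel_eq_iwasawa (f : SiegelCoord n → ℝ≥0∞)
    (hf : Measurable fun q : PosVec n × ((StrictPairs n → ℝ) × (UpperPairs n → ℝ)) =>
      f (iwasawaMap (q.1.1, q.2))) :
    ∫⁻ p in {p : SiegelCoord n | complexSym p ∈ siegelUpperHalfSpace n},
        f p * ENNReal.ofReal (((symMatrix p.2).det ^ (n + 1))⁻¹) =
      2 ^ n * ∫⁻ a : PosVec n, (∫⁻ p, f (iwasawaMap (a.1, p))) ∂(diagMeasure n) := by
  choose G hG hG' using fun q : IwasawaCoord n => exists_hasFDerivAt_iwasawaMap q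
  rw [← image_iwasawaMap, lintegral_image_eq_of_measurePreserving measurePreserving_iwasawaLinear
    measurableSet_pos (fun q _ => hG q) iwasawaMap_injOn]
  have h1 : ∀ q ∈ {q : IwasawaCoord n | ∀ i, 0 < q.1 i},
      ENNReal.ofReal
          |(((iwasawaLinear n).symm : SiegelCoord n →L[ℝ] IwasawaCoord n).comp (G q)).det| *
        (f (iwasawaMap q) * ENNReal.ofReal (((symMatrix (iwasawaMap q).2).det ^ (n + 1))⁻¹)) =
      2 ^ n * (ENNReal.ofReal (∏ i, (q.1 i)⁻¹) * f (iwasawaMap q)) := by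
    intro q hq
    have hpos : 0 < ∏ i, q.1 i := Finset.prod_pos fun i _ => hq i
    rw [abs_det_iwasawaMap hq (hG' q), det_symMatrix_iwasawaMap, mul_comm (f _), ← mul_assoc,
      ← ENNReal.ofReal_mul' (by positivity), ← mul_assoc]
    congr 1
    rw [← pow_mul, mul_assoc, mul_inv_cancel₀ (by positivity), mul_one,
      ENNReal.ofReal_mul (by positivity), ENNReal.ofReal_pow (by positivity)]
    norm_num
  have hpos : {q : IwasawaCoord n | ∀ i, 0 < q.1 i} =
      {a : Fin n → ℝ | ∀ i, 0 < a i} ×ˢ Set.univ := by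
    ext q; simp
  rw [setLIntegral_congr_fun measurableSet_pos h1, lintegral_const_mul' _ _ (by simp), hpos]
  congr 1
  exact (setLIntegral_prod_univ_mul (f := fun q : IwasawaCoord n => f (iwasawaMap q))
    measurableSet_posVec measurable_prod_inv (fun _ => ENNReal.ofReal_ne_top) hf).trans
    (lintegral_diagMeasure fun a => ∫⁻ p, f (iwasawaMap (a, p))).symm

end IwasawaDecomposition

/-! ### Topology of the symplectic group and of its maximal compact subgroup -/

section Topology

variable {n : ℕ}

theorem continuous_coe_sp :
    Continuous fun g : Sp n => (g : Matrix (Fin n ⊕ Fin n) (Fin n ⊕ Fin n) ℝ) :=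
  continuous_subtype_val

instance Sp.isTopologicalGroup : IsTopologicalGroup (Sp n) where
  continuous_inv := by
    refine Continuous.subtype_mk (f := fun g : Sp n =>
      ((g⁻¹ : Sp n) : Matrix (Fin n ⊕ Fin n) (Fin n ⊕ Fin n) ℝ)) ?_ _
    simp only [SymplecticGroup.coe_inv]
    exact (continuous_const.matrix_mul continuous_coe_sp.matrix_transpose).matrix_mul
      continuous_const

instance Sp.secondCountableTopology : SecondCountableTopology (Sp n) :=
  haveI : SecondCountableTopology (Matrix (Fin n ⊕ Fin n) (Fin n ⊕ Fin n) ℝ) :=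
    inferInstanceAs (SecondCountableTopology (Fin n ⊕ Fin n → Fin n ⊕ Fin n → ℝ))
  TopologicalSpace.Subtype.secondCountableTopology _

theorem isClosed_symplecticGroup :
    IsClosed
      (Matrix.symplecticGroup (Fin n) ℝ : Set (Matrix (Fin n ⊕ Fin n) (Fin n ⊕ Fin n) ℝ)) := by
  have : (Matrix.symplecticGroup (Fin n) ℝ : Set (Matrix (Fin n ⊕ Fin n) (Fin n ⊕ Fin n) ℝ)) =
      {A | A * Matrix.J (Fin n) ℝ * Aᵀ = Matrix.J (Fin n) ℝ} := by
    ext A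
    exact SymplecticGroup.mem_iff
  rw [this]
  exact isClosed_eq ((continuous_id.matrix_mul continuous_const).matrix_mul
    continuous_id.matrix_transpose) continuous_const

instance Sp.locallyCompactSpace : LocallyCompactSpace (Sp n) :=
  haveI : LocallyCompactSpace (Matrix (Fin n ⊕ Fin n) (Fin n ⊕ Fin n) ℝ) :=
    inferInstanceAs (LocallyCompactSpace (Fin n ⊕ Fin n → Fin n ⊕ Fin n → ℝ))
  isClosed_symplecticGroup.isClosedEmbedding_subtypeVal.locallyCompactSpace

theorem isClosed_maxCompact : IsClosed (maxCompact n : Set (Sp n)) := by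
  have : (maxCompact n : Set (Sp n)) =
      {g : Sp n | (g : Matrix (Fin n ⊕ Fin n) (Fin n ⊕ Fin n) ℝ) *
        star (g : Matrix (Fin n ⊕ Fin n) (Fin n ⊕ Fin n) ℝ) = 1} := by
    ext g
    exact Matrix.mem_orthogonalGroup_iff _ _
  rw [this]
  exact isClosed_eq (continuous_coe_sp.matrix_mul
    (continuous_coe_sp.matrix_conjTranspose)) continuous_const

theorem isCompact_maxCompact : IsCompact (maxCompact n : Set (Sp n)) := by
  have h : IsCompact {M : Matrix (Fin n ⊕ Fin n) (Fin n ⊕ Fin n) ℝ |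
      ∀ i, M i ∈ {v : Fin n ⊕ Fin n → ℝ | ∀ j, v j ∈ Set.Icc (-1 : ℝ) 1}} :=
    isCompact_pi_infinite fun _ => isCompact_pi_infinite fun _ => isCompact_Icc
  refine IsCompact.of_isClosed_subset
    (isClosed_symplecticGroup.isClosedEmbedding_subtypeVal.isCompact_preimage h)
    isClosed_maxCompact fun g hg i j => ?_
  have := entry_norm_bound_of_unitary (𝕜 := ℝ) hg i j
  exact abs_le.1 this

instance maxCompact.compactSpace : CompactSpace (maxCompact n) :=
  isCompact_iff_compactSpace.1 isCompact_maxCompact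

/-- On a compact group, the Haar probability measure is right invariant. -/
theorem isMulRightInvariant_of_isProbabilityMeasure {G : Type*} [Group G] [TopologicalSpace G]
    [IsTopologicalGroup G] [CompactSpace G] [MeasurableSpace G] [BorelSpace G]
    (κ : Measure G) [κ.IsHaarMeasure] [IsProbabilityMeasure κ] : κ.IsMulRightInvariant where
  map_mul_right_eq_self g := by
    have : IsProbabilityMeasure (κ.map (· * g)) :=
      Measure.isProbabilityMeasure_map (continuous_mul_const g).measurable.aemeasurable
    exact Measure.isHaarMeasure_eq_of_isProbabilityMeasure (κ.map (· * g)) κ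

theorem continuous_diagSp : Continuous (diagSp : PosVec n → Sp n) := by
  refine Continuous.subtype_mk ?_ _
  refine Continuous.matrix_fromBlocks (Continuous.matrix_diagonal continuous_subtype_val)
    continuous_const continuous_const (Continuous.matrix_diagonal ?_)
  exact continuous_pi fun i =>
    ((continuous_apply i).comp continuous_subtype_val).inv₀ fun a => (a.2 i).ne'

theorem continuous_unipotentMatrix : Continuous (unipotentMatrix : (StrictPairs n → ℝ) → _) := by
  refine continuous_matrix fun i j => ?_
  by_cases h : i < j
  · simp only [unipotentMatrix, Matrix.of_apply, h, dite_true]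
    exact continuous_apply _
  · simp only [unipotentMatrix, Matrix.of_apply, h, dite_false]
    exact continuous_const

theorem continuous_symMatrix : Continuous (symMatrix : (UpperPairs n → ℝ) → _) :=
  continuous_matrix fun _ _ => continuous_apply _

theorem continuous_unipotentSp :
    Continuous (unipotentSp : (StrictPairs n → ℝ) × (UpperPairs n → ℝ) → Sp n) := by
  have h1 : Continuous (leviUnipotentSp : (StrictPairs n → ℝ) → Sp n) := by
    refine Continuous.subtype_mk ?_ _
    refine Continuous.matrix_fromBlocks continuous_unipotentMatrix continuous_const
      continuous_const ?_
    have h (v : StrictPairs n → ℝ) :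
        ((unipotentMatrix v)ᵀ)⁻¹ = (unipotentMatrix v)ᵀ.adjugate := by
      rw [Matrix.inv_def, Matrix.det_transpose, det_unipotentMatrix]
      simp
    simp only [h]
    exact continuous_unipotentMatrix.matrix_transpose.matrix_adjugate
  have h2 : Continuous (siegelUnipotentSp : (UpperPairs n → ℝ) → Sp n) := by
    refine Continuous.subtype_mk ?_ _
    exact Continuous.matrix_fromBlocks continuous_const continuous_symMatrix continuous_const
      continuous_const
  exact (h1.comp continuous_fst).mul (h2.comp continuous_snd)

theorem continuous_denom : Continuous (denom : Sp n → _) := by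
  have h : Continuous fun g : Sp n =>
      (g : Matrix (Fin n ⊕ Fin n) (Fin n ⊕ Fin n) ℝ).map Complex.ofReal :=
    continuous_coe_sp.matrix_map Complex.continuous_ofReal
  have h1 : Continuous (spC : Sp n → _) := h.matrix_submatrix _ _
  have h2 : Continuous (spD : Sp n → _) := h.matrix_submatrix _ _
  exact (h1.matrix_mul continuous_const).add h2

theorem continuous_numer : Continuous (numer : Sp n → _) := by
  have h : Continuous fun g : Sp n =>
      (g : Matrix (Fin n ⊕ Fin n) (Fin n ⊕ Fin n) ℝ).map Complex.ofReal :=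
    continuous_coe_sp.matrix_map Complex.continuous_ofReal
  have h1 : Continuous (spA : Sp n → _) := h.matrix_submatrix _ _
  have h2 : Continuous (spB : Sp n → _) := h.matrix_submatrix _ _
  exact (h1.matrix_mul continuous_const).add h2

/-- The inverse of a continuous family of invertible matrices is continuous. -/
theorem Continuous.matrix_inv_of_isUnit {X 𝕜 : Type*} [TopologicalSpace X] [RCLike 𝕜]
    {M : X → Matrix (Fin n) (Fin n) 𝕜} (hM : Continuous M) (h : ∀ x, IsUnit (M x).det) :
    Continuous fun x => (M x)⁻¹ := by
  have h' (x : X) : (M x)⁻¹ = ((M x).det)⁻¹ • (M x).adjugate := by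
    rw [Matrix.inv_def, Ring.inverse_eq_inv']
  simp only [h']
  exact (hM.matrix_det.inv₀ fun x => (h x).ne_zero).smul hM.matrix_adjugate

theorem continuous_siegelAct_basePoint :
    Continuous fun g : Sp n => siegelAct g (basePoint n) :=
  continuous_numer.matrix_mul (continuous_denom.matrix_inv_of_isUnit isUnit_det_denom)

end Topology

/-! ### The invariant measure on the upper half space -/

section SiegelIntegral

variable {n : ℕ}

/-- The symplectic group acts transitively on the upper half space. -/
theorem exists_siegelAct_basePoint_eq {Z : Matrix (Fin n) (Fin n) ℂ}
    (hZ : Z ∈ siegelUpperHalfSpace n) : ∃ g : Sp n, siegelAct g (basePoint n) = Z := by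
  obtain ⟨p, rfl⟩ := exists_complexSym_eq hZ.1
  obtain ⟨q, hq, rfl⟩ := exists_iwasawaMap_eq hZ
  exact ⟨_, siegelAct_iwasawa ⟨q.1, hq⟩ q.2⟩

/-- The upper half space in the complex coordinates on symmetric matrices. -/
def siegelDomain (n : ℕ) : Set (UpperPairs n → ℂ) := {x | symMat x ∈ siegelUpperHalfSpace n}

theorem preimage_siegelDomain :
    reImEquiv (UpperPairs n) ⁻¹' siegelDomain n =
      {p | complexSym p ∈ siegelUpperHalfSpace n} := by
  ext p
  simp only [Set.mem_preimage, siegelDomain, Set.mem_ofPred_eq, complexSym_eq]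

theorem measurableSet_siegelDomain : MeasurableSet (siegelDomain n) := by
  rw [← (reImEquiv (UpperPairs n)).measurableSet_preimage, preimage_siegelDomain]
  exact measurableSet_siegelCoord

/-- The density `det(Y)^{-(n+1)}` of the invariant measure. -/
noncomputable def siegelDensity (Z : Matrix (Fin n) (Fin n) ℂ) : ℝ :=
  ((Z.map Complex.im).det ^ (n + 1))⁻¹

/-- The invariant integral over the upper half space, in complex coordinates. -/
noncomputable def siegelIntegral (f : Matrix (Fin n) (Fin n) ℂ → ℝ≥0∞) : ℝ≥0∞ :=
  ∫⁻ x in siegelDomain n, f (symMat x) * ENNReal.ofReal (siegelDensity (symMat x))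

theorem lintegral_siegelCoord (f : Matrix (Fin n) (Fin n) ℂ → ℝ≥0∞) :
    ∫⁻ p in {p : SiegelCoord n | complexSym p ∈ siegelUpperHalfSpace n},
        f (complexSym p) * ENNReal.ofReal (((symMatrix p.2).det ^ (n + 1))⁻¹) =
      siegelIntegral f := by
  rw [siegelIntegral, ← (measurePreserving_reImEquiv (UpperPairs n)).setLIntegral_comp_preimage_emb
    (reImEquiv (UpperPairs n)).measurableEmbedding, preimage_siegelDomain]
  refine lintegral_congr fun p => ?_
  rw [← complexSym_eq, siegelDensity]
  congr 5
  ext i j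
  simp [complexSym]

theorem siegelDensity_siegelAct (g : Sp n) :
    siegelDensity (siegelAct g (basePoint n)) = ‖(denom g).det‖ ^ (2 * (n + 1)) := by
  rw [siegelDensity, det_im_siegelAct, inv_pow, inv_inv, pow_mul]

theorem symMat_upperEntries_siegelAct {g : Sp n} {x : UpperPairs n → ℂ} (hx : x ∈ siegelDomain n) :
    symMat (upperEntries (siegelAct g (symMat x))) = siegelAct g (symMat x) := by
  obtain ⟨h, hh⟩ := exists_siegelAct_basePoint_eq hx
  rw [← hh, siegelAct_mul]
  exact symMat_upperEntries (siegelAct_basePoint_isSymm _)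

theorem image_siegelAct (g : Sp n) :
    (fun x => upperEntries (siegelAct g (symMat x))) '' siegelDomain n = siegelDomain n := by
  have key (g : Sp n) (x : UpperPairs n → ℂ) (hx : x ∈ siegelDomain n) :
      upperEntries (siegelAct g (symMat x)) ∈ siegelDomain n := by
    rw [siegelDomain, Set.mem_ofPred_eq, symMat_upperEntries_siegelAct hx]
    obtain ⟨h, hh⟩ := exists_siegelAct_basePoint_eq hx
    rw [← hh, siegelAct_mul]
    exact siegelAct_basePoint_mem _
  refine subset_antisymm (Set.image_subset_iff.2 fun x hx => key g x hx) fun x hx =>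
    ⟨_, key g⁻¹ x hx, ?_⟩
  simp only
  rw [symMat_upperEntries_siegelAct hx]
  obtain ⟨h, hh⟩ := exists_siegelAct_basePoint_eq hx
  rw [← hh, siegelAct_mul, siegelAct_mul, mul_inv_cancel_left, hh, upperEntries_symMat]

/-- The measure `det(Y)^{-(n+1)} dX dY` is invariant under the symplectic group. -/
theorem siegelIntegral_comp_siegelAct (g : Sp n) (f : Matrix (Fin n) (Fin n) ℂ → ℝ≥0∞) :
    siegelIntegral (fun Z => f (siegelAct g Z)) = siegelIntegral f := by
  have hP (x) (hx : x ∈ siegelDomain n) : IsUnit (spC g * symMat x + spD g).det := by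
    obtain ⟨h, hh⟩ := exists_siegelAct_basePoint_eq hx
    rw [← hh, denom_siegelAct, Matrix.det_mul]
    exact (isUnit_det_denom _).mul (Matrix.isUnit_nonsing_inv_det _ (isUnit_det_denom _))
  have h1 := (isSimilitude_sp g).lintegral_image_mobius one_ne_zero measurableSet_siegelDomain hP
    fun x => f (symMat x) * ENNReal.ofReal (siegelDensity (symMat x))
  simp only [← siegelAct_eq_mobius] at h1
  rw [image_siegelAct] at h1
  rw [siegelIntegral, siegelIntegral, h1]
  refine setLIntegral_congr_fun measurableSet_siegelDomain fun x hx => ?_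
  rw [symMat_upperEntries_siegelAct hx]
  obtain ⟨h, hh⟩ := exists_siegelAct_basePoint_eq hx
  have hd := (isUnit_det_denom h).ne_zero
  have hd' := (isUnit_det_denom (g * h)).ne_zero
  rw [← hh, siegelAct_mul, siegelDensity_siegelAct, siegelDensity_siegelAct, denom_siegelAct,
    mul_left_comm, ← ENNReal.ofReal_mul (by positivity), Matrix.det_mul, Matrix.det_nonsing_inv,
    Ring.inverse_eq_inv', norm_mul, norm_inv, norm_one, one_pow, one_mul]
  congr 2
  rw [mul_pow, mul_inv, inv_pow, inv_inv, mul_right_comm, inv_mul_cancel₀, one_mul]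
  exact pow_ne_zero _ (norm_ne_zero_iff.2 hd')

end SiegelIntegral

/-! ### The Haar measure in Iwasawa coordinates -/

section IwasawaHaar

variable {n : ℕ}

/-- The map `(a, p, k) ↦ a n k` of the Iwasawa decomposition. -/
noncomputable def iwasawaMul
    (q : (PosVec n × ((StrictPairs n → ℝ) × (UpperPairs n → ℝ))) × maxCompact n) : Sp n :=
  diagSp q.1.1 * unipotentSp q.1.2 * (q.2 : Sp n)

theorem continuous_iwasawaMul : Continuous (iwasawaMul (n := n)) :=
  ((continuous_diagSp.comp (continuous_fst.comp continuous_fst)).mul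
    (continuous_unipotentSp.comp (continuous_snd.comp continuous_fst))).mul
    (continuous_subtype_val.comp continuous_snd)

instance maxCompact.secondCountableTopology : SecondCountableTopology (maxCompact n) :=
  TopologicalSpace.Subtype.secondCountableTopology _

instance diagMeasure.sigmaFinite : SigmaFinite (diagMeasure n) := by
  have h : SigmaFinite (Measure.comap Subtype.val (volume : Measure (Fin n → ℝ)) :
      Measure (PosVec n)) := by
    refine SigmaFinite.of_map _ measurable_subtype_coe.aemeasurable ?_
    have h := map_comap_subtype_coe (measurableSet_posVec (n := n)) volume
    exact h ▸ inferInstance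
  exact SigmaFinite.withDensity_of_ne_top' fun _ => ENNReal.ofReal_ne_top

/-- The Haar measure of the Iwasawa integration formula. -/
noncomputable def iwasawaHaar (κ : Measure (maxCompact n)) : Measure (Sp n) :=
  (2 ^ n : ℝ≥0∞) • Measure.map iwasawaMul (((diagMeasure n).prod volume).prod κ)

variable {κ : Measure (maxCompact n)}

/-- The mean of a function over the cosets `g K` is a function of the point `g · i1`. -/
theorem exists_eq_lintegral_mul_right [κ.IsMulLeftInvariant] (F : Sp n → ℝ≥0∞) :
    ∃ f : Matrix (Fin n) (Fin n) ℂ → ℝ≥0∞, ∀ g : Sp n,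
      f (siegelAct g (basePoint n)) = ∫⁻ k : maxCompact n, F (g * k) ∂κ := by
  classical
  refine ⟨fun Z => if h : ∃ g : Sp n, siegelAct g (basePoint n) = Z then
    ∫⁻ k : maxCompact n, F (h.choose * k) ∂κ else 0, fun g => ?_⟩
  have h : ∃ g' : Sp n, siegelAct g' (basePoint n) = siegelAct g (basePoint n) := ⟨g, rfl⟩
  simp only [h, dite_true]
  have hk : h.choose⁻¹ * g ∈ maxCompact n := inv_mul_mem_of_siegelAct_eq h.choose_spec
  rw [← lintegral_mul_left_eq_self _ (⟨h.choose⁻¹ * g, hk⟩ : maxCompact n)]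
  refine lintegral_congr fun k => ?_
  rw [Subgroup.coe_mul, ← mul_assoc, mul_inv_cancel_left]

variable [IsProbabilityMeasure κ]

theorem lintegral_iwasawaHaar {F : Sp n → ℝ≥0∞} (hF : Measurable F) :
    ∫⁻ g, F g ∂(iwasawaHaar κ) =
      2 ^ n * ∫⁻ a : PosVec n, (∫⁻ p : (StrictPairs n → ℝ) × (UpperPairs n → ℝ),
        (∫⁻ k : maxCompact n, F (diagSp a * unipotentSp p * (k : Sp n)) ∂κ)) ∂(diagMeasure n) := by
  have h : Measurable fun q => F (iwasawaMul (n := n) q) := hF.comp continuous_iwasawaMul.measurable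
  rw [iwasawaHaar, lintegral_smul_measure, smul_eq_mul,
    lintegral_map hF continuous_iwasawaMul.measurable, lintegral_prod _ h.aemeasurable,
    lintegral_prod _ h.lintegral_prod_right'.aemeasurable]
  rfl

theorem integral_iwasawaHaar {F : Sp n → ℂ} (hF : Integrable F (iwasawaHaar κ)) :
    ∫ g, F g ∂(iwasawaHaar κ) =
      2 ^ n * ∫ a : PosVec n, (∫ p : (StrictPairs n → ℝ) × (UpperPairs n → ℝ),
        (∫ k : maxCompact n, F (diagSp a * unipotentSp p * (k : Sp n)) ∂κ)) ∂(diagMeasure n) := by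
  have hF' : Integrable F (Measure.map iwasawaMul (((diagMeasure n).prod volume).prod κ)) := by
    rwa [iwasawaHaar, integrable_smul_measure (by simp) (by simp)] at hF
  have h := hF'.comp_measurable continuous_iwasawaMul.measurable
  have h2 : Integrable (fun q => ∫ k, (F ∘ iwasawaMul) (q, k) ∂κ)
    ((diagMeasure n).prod volume) := h.integral_prod_left
  rw [iwasawaHaar, integral_smul_measure,
    integral_map continuous_iwasawaMul.measurable.aemeasurable hF'.aestronglyMeasurable,
    show (fun q => F (iwasawaMul q)) = F ∘ iwasawaMul from rfl, integral_prod _ h,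
    integral_prod _ h2]
  simp only [ENNReal.toReal_pow, ENNReal.toReal_ofNat, Complex.real_smul]
  push_cast
  rfl

/-- The integral of a right `K`-invariant function is its integral over the upper half space. -/
theorem lintegral_iwasawaHaar_siegelAct {f : Matrix (Fin n) (Fin n) ℂ → ℝ≥0∞}
    (hf : Measurable fun g : Sp n => f (siegelAct g (basePoint n))) :
    ∫⁻ g, f (siegelAct g (basePoint n)) ∂(iwasawaHaar κ) = siegelIntegral f := by
  have h1 (a : PosVec n) (p : (StrictPairs n → ℝ) × (UpperPairs n → ℝ)) (k : maxCompact n) :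
      f (siegelAct (diagSp a * unipotentSp p * (k : Sp n)) (basePoint n)) =
        f (complexSym (iwasawaMap (a.1, p))) := by
    rw [siegelAct_mul_of_mem _ k.2, siegelAct_iwasawa]
  have hm : Measurable fun q : PosVec n × ((StrictPairs n → ℝ) × (UpperPairs n → ℝ)) =>
      f (complexSym (iwasawaMap (q.1.1, q.2))) := by
    simp only [← siegelAct_iwasawa]
    exact hf.comp ((continuous_diagSp.comp continuous_fst).mul
      (continuous_unipotentSp.comp continuous_snd)).measurable
  rw [lintegral_iwasawaHaar hf, ← lintegral_siegelCoord,
    lintegral_siegel_eq_iwasawa (fun p => f (complexSym p)) hm]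
  simp only [h1, lintegral_const, measure_univ, mul_one]

variable [κ.IsHaarMeasure]

/-- Averaging a function over right translations by the compact subgroup does not change its
integral. -/
theorem lintegral_iwasawaHaar_mul_right {F : Sp n → ℝ≥0∞} (hF : Measurable F) :
    ∫⁻ g, F g ∂(iwasawaHaar κ) = ∫⁻ g, (∫⁻ k : maxCompact n, F (g * k) ∂κ) ∂(iwasawaHaar κ) := by
  have hm : Measurable fun g : Sp n => ∫⁻ k : maxCompact n, F (g * k) ∂κ :=
    (hF.comp (continuous_fst.mul (continuous_subtype_val.comp
      continuous_snd)).measurable).lintegral_prod_right'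
  rw [lintegral_iwasawaHaar hF, lintegral_iwasawaHaar hm]
  congr 1
  refine lintegral_congr fun a => lintegral_congr fun p => ?_
  have h (k : maxCompact n) :
      ∫⁻ k' : maxCompact n, F (diagSp a * unipotentSp p * (k : Sp n) * (k' : Sp n)) ∂κ =
        ∫⁻ k' : maxCompact n, F (diagSp a * unipotentSp p * (k' : Sp n)) ∂κ := by
    rw [← lintegral_mul_left_eq_self
      (fun k' : maxCompact n => F (diagSp a * unipotentSp p * (k' : Sp n))) k]
    refine lintegral_congr fun k' => ?_
    rw [Subgroup.coe_mul, mul_assoc _ (k : Sp n)]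
  simp only [h, lintegral_const, measure_univ, mul_one]

/-- Left translation does not change the integral against `iwasawaHaar`: after averaging over `K`
this is the invariance of the measure on the upper half space. -/
theorem lintegral_iwasawaHaar_mul_left {F : Sp n → ℝ≥0∞} (hF : Measurable F) (h : Sp n) :
    ∫⁻ g, F (h * g) ∂(iwasawaHaar κ) = ∫⁻ g, F g ∂(iwasawaHaar κ) := by
  obtain ⟨f, hf⟩ := exists_eq_lintegral_mul_right (κ := κ) F
  have hm : Measurable fun g : Sp n => ∫⁻ k : maxCompact n, F (g * k) ∂κ :=
    (hF.comp (continuous_fst.mul (continuous_subtype_val.comp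
      continuous_snd)).measurable).lintegral_prod_right'
  have h1 : ∀ g : Sp n, ∫⁻ k : maxCompact n, F (h * (g * k)) ∂κ =
      f (siegelAct h (siegelAct g (basePoint n))) := by
    intro g
    rw [siegelAct_mul, hf]
    simp only [mul_assoc]
  rw [lintegral_iwasawaHaar_mul_right (F := fun g => F (h * g)) (hF.comp (measurable_const_mul h)),
    lintegral_iwasawaHaar_mul_right hF]
  simp only [h1, ← hf]
  rw [lintegral_iwasawaHaar_siegelAct (f := fun Z => f (siegelAct h Z)),
    lintegral_iwasawaHaar_siegelAct (by simpa only [hf] using hm), siegelIntegral_comp_siegelAct]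
  simp only [siegelAct_mul, hf]
  exact hm.comp (measurable_const_mul h)

instance iwasawaHaar.isMulLeftInvariant : (iwasawaHaar κ).IsMulLeftInvariant where
  map_mul_left_eq_self h := by
    ext s hs
    rw [Measure.map_apply (measurable_const_mul h) hs]
    have := lintegral_iwasawaHaar_mul_left (κ := κ) (measurable_one.indicator hs) h
    rw [lintegral_indicator_one hs] at this
    rw [← this, ← lintegral_indicator_one (measurable_const_mul h hs)]
    rfl

end IwasawaHaar

/-! ### Existence and uniqueness of the classical Haar measure -/

section ClassicalHaar

variable {n : ℕ}

variable {κ : Measure (maxCompact n)} [IsProbabilityMeasure κ]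

theorem iwasawaHaar_ne_zero : iwasawaHaar κ ≠ 0 := by
  intro h
  have h1 := lintegral_iwasawaHaar (κ := κ) (F := fun _ => 1) measurable_const
  rw [h, lintegral_zero_measure] at h1
  have hd : diagMeasure n Set.univ ≠ 0 := by
    intro h0
    have h2 := lintegral_diagMeasure (n := n) (fun _ => 1)
    rw [lintegral_one, h0] at h2
    have h3 := (lintegral_eq_zero_iff (measurable_prod_inv.mul_const 1)).1 h2.symm
    have h4 := (ae_restrict_iff' measurableSet_posVec).1 h3
    have hopen : IsOpen {a : Fin n → ℝ | ∀ i, 0 < a i} := by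
      rw [Set.ofPred_forall]
      exact isOpen_iInter_of_finite fun i => isOpen_lt continuous_const (continuous_apply i)
    have h5 : volume {a : Fin n → ℝ | ∀ i, 0 < a i} = 0 := by
      refine measure_mono_null (fun a ha => ?_) h4
      simp only [Set.mem_compl_iff, Set.mem_ofPred_eq]
      intro hc
      have := hc ha
      simp only [mul_one, Pi.zero_apply, ENNReal.ofReal_eq_zero] at this
      exact absurd this (not_le.2 (Finset.prod_pos fun i _ => inv_pos.2 (ha i)))
    exact (hopen.measure_pos volume ⟨fun _ => 1, fun _ => one_pos⟩).ne' h5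
  simp only [lintegral_const, measure_univ, mul_one, one_mul] at h1
  refine mul_ne_zero (by simp) (mul_ne_zero ?_ hd) h1.symm
  exact isOpen_univ.measure_ne_zero _ Set.univ_nonempty

variable [κ.IsHaarMeasure]

/-- A compact set is mapped to a compact subset of the upper half space, on which the density is
bounded. -/
instance iwasawaHaar.isFiniteMeasureOnCompacts : IsFiniteMeasureOnCompacts (iwasawaHaar κ) where
  lt_top_of_isCompact K hK := by
    classical
    let ψ : Sp n → (UpperPairs n → ℂ) := fun g => upperEntries (siegelAct g (basePoint n))
    have hψ : Continuous ψ := continuous_pi fun p =>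
      (continuous_apply_apply p.1.1 p.1.2).comp continuous_siegelAct_basePoint
    have hψ' (g : Sp n) : symMat (ψ g) = siegelAct g (basePoint n) :=
      symMat_upperEntries (siegelAct_basePoint_isSymm g)
    have hC : IsCompact (ψ '' K) := hK.image hψ
    let f : Matrix (Fin n) (Fin n) ℂ → ℝ≥0∞ := fun Z => (ψ '' K).indicator 1 (upperEntries Z)
    have hf : Measurable fun g : Sp n => f (siegelAct g (basePoint n)) :=
      (measurable_one.indicator hC.measurableSet).comp hψ.measurable
    have h1 : iwasawaHaar κ K ≤ ∫⁻ g, f (siegelAct g (basePoint n)) ∂(iwasawaHaar κ) := by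
      rw [← lintegral_indicator_one hK.measurableSet]
      refine lintegral_mono fun g => ?_
      by_cases hg : g ∈ K
      · have : ψ g ∈ ψ '' K := ⟨g, hg, rfl⟩
        simp only [f]
        rw [Set.indicator_of_mem hg, Set.indicator_of_mem (s := ψ '' K) this]
        rfl
      · rw [Set.indicator_of_notMem hg]
        exact zero_le
    refine h1.trans_lt ?_
    rw [lintegral_iwasawaHaar_siegelAct hf, siegelIntegral]
    obtain ⟨M, hM⟩ : ∃ M : ℝ, ∀ g ∈ K, ‖(denom g).det‖ ^ (2 * (n + 1)) ≤ M := by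
      obtain ⟨M, hM⟩ := (hK.image ((continuous_denom (n := n)).matrix_det.norm.pow
        (2 * (n + 1)))).bddAbove
      exact ⟨M, fun g hg => hM ⟨g, hg, rfl⟩⟩
    have h2 : ∀ x ∈ siegelDomain n, f (symMat x) * ENNReal.ofReal (siegelDensity (symMat x)) ≤
        (ψ '' K).indicator (fun _ => ENNReal.ofReal M) x := by
      intro x _
      simp only [f, upperEntries_symMat]
      by_cases hx : x ∈ ψ '' K
      · rw [Set.indicator_of_mem hx, Set.indicator_of_mem hx]
        obtain ⟨g, hg, rfl⟩ := hx
        rw [hψ', siegelDensity_siegelAct, Pi.one_apply, one_mul]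
        exact ENNReal.ofReal_le_ofReal (hM g hg)
      · rw [Set.indicator_of_notMem hx, zero_mul]
        exact zero_le
    refine (setLIntegral_mono' measurableSet_siegelDomain h2).trans_lt ?_
    refine (setLIntegral_le_lintegral _ _).trans_lt ?_
    rw [lintegral_indicator_const hC.measurableSet]
    exact ENNReal.mul_lt_top ENNReal.ofReal_lt_top hC.measure_lt_top

instance iwasawaHaar.isHaarMeasure : (iwasawaHaar κ).IsHaarMeasure where
  toIsOpenPosMeasure :=
    haveI : NeZero (iwasawaHaar κ) := ⟨iwasawaHaar_ne_zero⟩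
    isOpenPosMeasure_of_mulLeftInvariant_of_regular

theorem isClassicalHaar_iwasawaHaar : IsClassicalHaar (iwasawaHaar κ) :=
  ⟨inferInstance, fun f hf => (lintegral_iwasawaHaar_siegelAct hf).trans
    (lintegral_siegelCoord f).symm⟩

open scoped Pointwise in
/-- The normalization determines the Haar measure: the two sides can be compared on the indicator of
a right `K`-invariant compact neighbourhood of the identity. -/
theorem IsClassicalHaar.eq_iwasawaHaar {μ : Measure (Sp n)} (h : IsClassicalHaar μ) :
    μ = iwasawaHaar κ := by
  obtain ⟨hμ, hint⟩ := h
  have hc := Measure.isMulLeftInvariant_eq_smul μ (iwasawaHaar κ)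
  set c := μ.haarScalarFactor (iwasawaHaar κ)
  obtain ⟨K₀, hK₀, hK₀'⟩ := exists_compact_mem_nhds (1 : Sp n)
  have hK : IsCompact (K₀ * (maxCompact n : Set (Sp n))) := hK₀.mul isCompact_maxCompact
  set K := K₀ * (maxCompact n : Set (Sp n)) with hKdef
  have hsub : K₀ ⊆ K := fun g hg => ⟨g, hg, 1, one_mem _, mul_one g⟩
  have hKpos : iwasawaHaar κ K ≠ 0 :=
    ((Measure.measure_pos_of_mem_nhds _ hK₀').trans_le (measure_mono hsub)).ne'
  have hKinv (g : Sp n) (k : maxCompact n) : g * k ∈ K ↔ g ∈ K := by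
    constructor
    · rintro ⟨x, hx, y, hy, hxy⟩
      exact ⟨x, hx, y * (k : Sp n)⁻¹, mul_mem hy (inv_mem k.2), by
        change x * (y * (k : Sp n)⁻¹) = g
        rw [← mul_assoc, show x * y = g * k from hxy, mul_inv_cancel_right]⟩
    · rintro ⟨x, hx, y, hy, rfl⟩
      exact ⟨x, hx, y * k, mul_mem hy k.2, (mul_assoc _ _ _).symm⟩
  obtain ⟨f, hf⟩ := exists_eq_lintegral_mul_right (κ := κ) (K.indicator (1 : Sp n → ℝ≥0∞))
  have hf' (g : Sp n) : f (siegelAct g (basePoint n)) = K.indicator 1 g := by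
    rw [hf]
    have (k : maxCompact n) : K.indicator (1 : Sp n → ℝ≥0∞) (g * k) = K.indicator 1 g := by
      by_cases hg : g ∈ K
      · rw [Set.indicator_of_mem hg, Set.indicator_of_mem ((hKinv g k).2 hg)]
        rfl
      · rw [Set.indicator_of_notMem hg, Set.indicator_of_notMem (mt (hKinv g k).1 hg)]
    simp only [this, lintegral_const, measure_univ, mul_one]
  have hm : Measurable fun g : Sp n => f (siegelAct g (basePoint n)) := by
    simp only [hf']
    exact measurable_one.indicator hK.measurableSet
  have h1 := (hint f hm).trans ((isClassicalHaar_iwasawaHaar (κ := κ)).2 f hm).symm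
  simp only [hf', lintegral_indicator_one hK.measurableSet] at h1
  rw [hc, Measure.smul_apply] at h1
  have h2 : (c : ℝ≥0∞) * iwasawaHaar κ K = 1 * iwasawaHaar κ K := by
    rw [one_mul]
    exact h1
  have h3 : (c : ℝ≥0∞) = 1 := (ENNReal.mul_left_inj hKpos hK.measure_ne_top).1 h2
  have h4 : c = 1 := by exact_mod_cast h3
  rw [hc, h4, one_smul]

end ClassicalHaar

/-! ### The Cayley chart of the unitary group -/

section CayleyChart

variable {n : ℕ}

/-- Real coordinates on the skew-Hermitian matrices: the complex entries below the diagonal, up to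
sign, and the imaginary parts of the diagonal entries, up to sign. -/
abbrev SkewCoord (n : ℕ) : Type := (StrictPairs n → ℂ) × (Fin n → ℝ)

/-- The skew-Hermitian matrix with given coordinates. -/
noncomputable def skewMat : SkewCoord n →ₗ[ℝ] Matrix (Fin n) (Fin n) ℂ where
  toFun b := (strictMat b.1).map star - (strictMat b.1)ᵀ -
    Matrix.diagonal fun i => Complex.I * (b.2 i : ℂ)
  map_add' b b' := by
    ext i j
    simp only [Prod.fst_add, Prod.snd_add, strictMat_add, Matrix.sub_apply, Matrix.add_apply,
      Matrix.map_apply, Matrix.transpose_apply, Matrix.diagonal_apply, star_add, Pi.add_apply,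
      Complex.ofReal_add]
    split_ifs <;> ring
  map_smul' c b := by
    ext i j
    have h (v : StrictPairs n → ℂ) (i j : Fin n) : strictMat (c • v) i j = c * strictMat v i j := by
      rcases lt_or_ge i j with h | h
      · rw [strictMat_apply_of_lt _ h, strictMat_apply_of_lt _ h]
        simp
      · rw [strictMat_apply_of_le _ h, strictMat_apply_of_le _ h, mul_zero]
    simp only [Prod.smul_fst, Prod.smul_snd, Matrix.sub_apply, Matrix.smul_apply, RingHom.id_apply,
      Matrix.map_apply, Matrix.transpose_apply, Matrix.diagonal_apply, h, Pi.smul_apply,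
      smul_eq_mul,
      Complex.ofReal_mul, Complex.real_smul, Complex.star_def, map_mul, Complex.conj_ofReal]
    split_ifs <;> ring

theorem skewMat_apply_of_lt (b : SkewCoord n) {i j : Fin n} (h : i < j) :
    skewMat b i j = star (b.1 ⟨(i, j), h⟩) := by
  simp [skewMat, strictMat_apply_of_lt _ h, strictMat_apply_of_le _ h.le, h.ne]

theorem skewMat_apply_of_gt (b : SkewCoord n) {i j : Fin n} (h : i < j) :
    skewMat b j i = -b.1 ⟨(i, j), h⟩ := by
  simp [skewMat, strictMat_apply_of_lt _ h, strictMat_apply_of_le _ h.le, h.ne']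

theorem skewMat_apply_self (b : SkewCoord n) (i : Fin n) :
    skewMat b i i = -(Complex.I * (b.2 i : ℂ)) := by
  simp [skewMat, strictMat_apply_of_le _ le_rfl]

theorem skewMat_conjTranspose (b : SkewCoord n) : (skewMat b)ᴴ = -skewMat b := by
  ext i j
  rw [Matrix.conjTranspose_apply, Matrix.neg_apply]
  rcases lt_trichotomy i j with h | rfl | h
  · rw [skewMat_apply_of_lt _ h, skewMat_apply_of_gt _ h, star_neg]
  · simp [skewMat_apply_self]
  · rw [skewMat_apply_of_lt _ h, skewMat_apply_of_gt _ h, star_star, neg_neg]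

/-- The coordinates of a skew-Hermitian matrix. -/
noncomputable def skewEntries : Matrix (Fin n) (Fin n) ℂ →ₗ[ℝ] SkewCoord n where
  toFun M := (fun p => -M p.1.2 p.1.1, fun i => -(M i i).im)
  map_add' M N := by
    refine Prod.ext (funext fun p => ?_) (funext fun i => ?_)
    · simp [add_comm]
    · simp [add_comm]
  map_smul' c M := by
    refine Prod.ext (funext fun p => ?_) (funext fun i => ?_)
    · simp
    · simp

theorem skewEntries_skewMat (b : SkewCoord n) : skewEntries (skewMat b) = b := by
  refine Prod.ext (funext fun p => ?_) (funext fun i => ?_)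
  · change -skewMat b p.1.2 p.1.1 = b.1 p
    rw [skewMat_apply_of_gt b p.2, neg_neg]
  · change -(skewMat b i i).im = b.2 i
    simp [skewMat_apply_self]

theorem skewMat_skewEntries {M : Matrix (Fin n) (Fin n) ℂ} (hM : Mᴴ = -M) :
    skewMat (skewEntries M) = M := by
  have h (i j : Fin n) : star (M j i) = -M i j := congrFun (congrFun hM i) j
  ext i j
  rcases lt_trichotomy i j with hij | rfl | hij
  · rw [skewMat_apply_of_lt _ hij]
    change star (-M j i) = M i j
    rw [star_neg, h, neg_neg]
  · rw [skewMat_apply_self]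
    have h1 := congrArg Complex.re (h i i)
    change -(Complex.I * ((-(M i i).im : ℝ) : ℂ)) = M i i
    simp only [Complex.star_def, Complex.conj_re, Complex.neg_re] at h1
    apply Complex.ext
    · simp; linarith
    · simp
  · rw [skewMat_apply_of_gt _ hij]
    change -(-M i j) = M i j
    rw [neg_neg]

open scoped ComplexOrder in
/-- A skew-Hermitian matrix has no real eigenvalue other than zero. -/
theorem isUnit_det_one_add_of_skew {M : Matrix (Fin n) (Fin n) ℂ} (hM : Mᴴ = -M) :
    IsUnit (1 + M).det := by
  rw [isUnit_iff_ne_zero]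
  intro h
  obtain ⟨v, hv, hv0⟩ := Matrix.exists_mulVec_eq_zero_iff.2 h
  have h1 : M *ᵥ v = -v := by
    rw [Matrix.add_mulVec, Matrix.one_mulVec] at hv0
    exact eq_neg_of_add_eq_zero_right hv0
  have h2 : star v ᵥ* M = star v := by
    have := congrArg star h1
    rw [Matrix.star_mulVec, hM, Matrix.vecMul_neg, star_neg, neg_inj] at this
    exact this
  have h3 : star v ⬝ᵥ (M *ᵥ v) = star v ⬝ᵥ v := by
    rw [Matrix.dotProduct_mulVec, h2]
  rw [h1, dotProduct_neg] at h3
  have h4 : star v ⬝ᵥ v = 0 := by linear_combination (-1 / 2 : ℂ) * h3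
  exact hv (dotProduct_star_self_eq_zero.1 h4)

theorem isUnit_det_one_add_skewMat (b : SkewCoord n) : IsUnit (1 + skewMat b).det :=
  isUnit_det_one_add_of_skew (skewMat_conjTranspose b)

theorem isUnit_det_one_sub_skewMat (b : SkewCoord n) : IsUnit (1 - skewMat b).det := by
  rw [sub_eq_add_neg]
  exact isUnit_det_one_add_of_skew (by rw [Matrix.conjTranspose_neg, skewMat_conjTranspose])

/-- The Cayley transform `(1 + Ξ)(1 - Ξ)⁻¹` of a skew-Hermitian matrix. -/
noncomputable def cayleyUnitary (b : SkewCoord n) : Matrix (Fin n) (Fin n) ℂ :=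
  (1 + skewMat b) * (1 - skewMat b)⁻¹

theorem cayleyUnitary_mul (b : SkewCoord n) :
    cayleyUnitary b * (1 - skewMat b) = 1 + skewMat b := by
  rw [cayleyUnitary, Matrix.nonsing_inv_mul_cancel_right _ _ (isUnit_det_one_sub_skewMat b)]

theorem cayleyUnitary_mul_conjTranspose (b : SkewCoord n) :
    cayleyUnitary b * (cayleyUnitary b)ᴴ = 1 := by
  have h1 := isUnit_det_one_sub_skewMat b
  have h2 := isUnit_det_one_add_skewMat b
  rw [cayleyUnitary, Matrix.conjTranspose_mul, Matrix.conjTranspose_nonsing_inv,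
    Matrix.conjTranspose_add, Matrix.conjTranspose_sub, skewMat_conjTranspose,
    Matrix.conjTranspose_one, sub_neg_eq_add, ← sub_eq_add_neg]
  have hc : (1 - skewMat b)⁻¹ * (1 + skewMat b)⁻¹ = (1 + skewMat b)⁻¹ * (1 - skewMat b)⁻¹ := by
    rw [← Matrix.mul_inv_rev, ← Matrix.mul_inv_rev]
    congr 1
    noncomm_ring
  rw [Matrix.mul_assoc, ← Matrix.mul_assoc (1 - skewMat b)⁻¹, hc, ← Matrix.mul_assoc,
    ← Matrix.mul_assoc, Matrix.mul_nonsing_inv _ h2, Matrix.one_mul, Matrix.nonsing_inv_mul _ h1]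

theorem cayleyUnitary_add_one_mul (b : SkewCoord n) :
    (cayleyUnitary b + 1) * (1 - skewMat b) = (2 : ℂ) • 1 := by
  rw [Matrix.add_mul, cayleyUnitary_mul, Matrix.one_mul, two_smul]
  abel

theorem isUnit_det_one_add_cayleyUnitary (b : SkewCoord n) :
    IsUnit (1 + cayleyUnitary b).det := by
  have h := congrArg Matrix.det (cayleyUnitary_add_one_mul b)
  rw [Matrix.det_mul, Matrix.det_smul, Matrix.det_one, mul_one, add_comm] at h
  exact isUnit_of_mul_isUnit_left (h ▸ (IsUnit.mk0 _ two_ne_zero).pow _)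

theorem cayleyUnitary_injective : Function.Injective (cayleyUnitary (n := n)) := by
  intro b b' h
  have key (b : SkewCoord n) : (1 + cayleyUnitary b) * skewMat b = cayleyUnitary b - 1 := by
    have := cayleyUnitary_mul b
    rw [Matrix.mul_sub, Matrix.mul_one] at this
    rw [Matrix.add_mul, Matrix.one_mul]
    rw [← sub_eq_zero] at this ⊢
    rw [← neg_eq_zero, ← this]
    abel
  have h1 := (key b).trans ((congrArg (· - 1) h).trans (key b').symm)
  rw [← h] at h1
  have h2 := congrArg ((1 + cayleyUnitary b)⁻¹ * ·) h1
  simp only [Matrix.nonsing_inv_mul_cancel_left _ _ (isUnit_det_one_add_cayleyUnitary b)] at h2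
  rw [← skewEntries_skewMat b, h2, skewEntries_skewMat]

/-- The image of the Cayley transform consists of the unitary matrices without the eigenvalue `-1`.
-/
theorem exists_cayleyUnitary_eq {u : Matrix (Fin n) (Fin n) ℂ} (hu : u * uᴴ = 1)
    (hdet : IsUnit (1 + u).det) : ∃ b : SkewCoord n, cayleyUnitary b = u := by
  have hdetH : IsUnit (1 + uᴴ).det := by
    rw [← Matrix.conjTranspose_one, ← Matrix.conjTranspose_add, Matrix.det_conjTranspose]
    exact hdet.star
  set X := (1 + u)⁻¹ * (u - 1) with hX
  have h1 : (1 + u) * X = u - 1 := Matrix.mul_nonsing_inv_cancel_left _ _ hdet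
  have h2 : Xᴴ * (1 + uᴴ) = uᴴ - 1 := by
    have := congrArg Matrix.conjTranspose h1
    simpa using this
  have hskew : Xᴴ = -X := by
    have h3 : (1 + u) * Xᴴ * (1 + uᴴ) = (1 + u) * (-X) * (1 + uᴴ) := by
      rw [Matrix.mul_assoc, h2, Matrix.mul_neg, h1]
      have : (1 + u) * (uᴴ - 1) + (u - 1) * (1 + uᴴ) = 2 • (u * uᴴ - 1) := by noncomm_ring
      rw [hu, sub_self, smul_zero] at this
      rw [Matrix.neg_mul]
      exact eq_neg_of_add_eq_zero_left this
    have h4 := congrArg (· * (1 + uᴴ)⁻¹) h3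
    simp only [Matrix.mul_nonsing_inv_cancel_right _ _ hdetH] at h4
    have h5 := congrArg ((1 + u)⁻¹ * ·) h4
    simpa only [Matrix.nonsing_inv_mul_cancel_left _ _ hdet] using h5
  refine ⟨skewEntries X, ?_⟩
  have h3 := skewMat_skewEntries hskew
  have h4 : 1 + X = u * (1 - X) := by
    rw [Matrix.add_mul, Matrix.one_mul] at h1
    rw [Matrix.mul_sub, Matrix.mul_one]
    rw [← sub_eq_zero] at h1 ⊢
    rw [← h1]
    abel
  have h5 := isUnit_det_one_sub_skewMat (skewEntries X)
  rw [h3] at h5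
  rw [cayleyUnitary, h3, h4, Matrix.mul_nonsing_inv_cancel_right _ _ h5]

theorem continuous_skewMat : Continuous (skewMat (n := n)) :=
  LinearMap.continuous_of_finiteDimensional _

theorem continuous_cayleyUnitary : Continuous (cayleyUnitary (n := n)) :=
  (continuous_const.add continuous_skewMat).matrix_mul
    ((continuous_const.sub continuous_skewMat).matrix_inv_of_isUnit isUnit_det_one_sub_skewMat)

/-- The derivative of the Cayley transform, in the left trivialization of the unitary group. -/
noncomputable def cayleyDeriv (b : SkewCoord n) : SkewCoord n →ₗ[ℝ] SkewCoord n where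
  toFun h := skewEntries ((2 : ℝ) • ((1 + skewMat b)⁻¹ * skewMat h * (1 - skewMat b)⁻¹))
  map_add' h h' := by
    rw [← map_add, ← smul_add, ← Matrix.add_mul, ← Matrix.mul_add, ← map_add]
  map_smul' c h := by
    rw [map_smul skewMat, Matrix.mul_smul, Matrix.smul_mul, smul_comm, map_smul, RingHom.id_apply]

theorem skewMat_cayleyDeriv (b h : SkewCoord n) :
    skewMat (cayleyDeriv b h) =
      (2 : ℝ) • ((1 + skewMat b)⁻¹ * skewMat h * (1 - skewMat b)⁻¹) := by
  refine skewMat_skewEntries ?_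
  rw [Matrix.conjTranspose_smul, Matrix.conjTranspose_mul, Matrix.conjTranspose_mul,
    Matrix.conjTranspose_nonsing_inv, Matrix.conjTranspose_nonsing_inv, Matrix.conjTranspose_add,
    Matrix.conjTranspose_sub, Matrix.conjTranspose_one, skewMat_conjTranspose,
    skewMat_conjTranspose, star_trivial, ← sub_eq_add_neg, sub_neg_eq_add, Matrix.neg_mul,
    Matrix.mul_neg, smul_neg, Matrix.mul_assoc]

theorem cayleyUnitary_mul_skewMat_cayleyDeriv (b h : SkewCoord n) :
    cayleyUnitary b * skewMat (cayleyDeriv b h) =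
      skewMat h * (1 - skewMat b)⁻¹ +
        (1 + skewMat b) * ((1 - skewMat b)⁻¹ * skewMat h * (1 - skewMat b)⁻¹) := by
  have h1 := isUnit_det_one_sub_skewMat b
  have h2 := isUnit_det_one_add_skewMat b
  have h3 : cayleyUnitary b = (1 - skewMat b)⁻¹ * (1 + skewMat b) := by
    have h4 : (1 - skewMat b) * (cayleyUnitary b) = 1 + skewMat b := by
      rw [cayleyUnitary, ← Matrix.mul_assoc,
        show (1 - skewMat b) * (1 + skewMat b) = (1 + skewMat b) * (1 - skewMat b) by noncomm_ring,
        Matrix.mul_assoc, Matrix.mul_nonsing_inv _ h1, Matrix.mul_one]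
    rw [← h4, Matrix.nonsing_inv_mul_cancel_left _ _ h1]
  have h5 : 1 + cayleyUnitary b = (2 : ℝ) • (1 - skewMat b)⁻¹ := by
    rw [h3]
    have : 1 + skewMat b = (2 : ℝ) • (1 : Matrix (Fin n) (Fin n) ℂ) - (1 - skewMat b) := by
      rw [two_smul]; abel
    rw [this, Matrix.mul_sub, Matrix.nonsing_inv_mul _ h1, Matrix.mul_smul, Matrix.mul_one]
    abel
  rw [skewMat_cayleyDeriv, Matrix.mul_smul, Matrix.mul_assoc (1 + skewMat b)⁻¹, h3,
    Matrix.mul_assoc (1 - skewMat b)⁻¹, Matrix.mul_nonsing_inv_cancel_left _ _ h2,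
    ← Matrix.smul_mul, ← h5, cayleyUnitary, Matrix.add_mul, Matrix.one_mul]
  simp only [Matrix.mul_assoc]

open scoped Matrix.Norms.Operator in
/-- The derivative of the Cayley transform `c` satisfies `c⁻¹ dc = 2 (1 + Ξ)⁻¹ dΞ (1 - Ξ)⁻¹`. -/
theorem exists_hasFDerivAt_cayleyUnitary (b : SkewCoord n) :
    ∃ G : SkewCoord n →L[ℝ] Matrix (Fin n) (Fin n) ℂ, HasFDerivAt cayleyUnitary G b ∧
      ∀ h, G h = cayleyUnitary b * skewMat (cayleyDeriv b h) := by
  have h0 := hasFDerivAt_of_linear (skewMat (n := n)) b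
  have h1 := h0.const_add (1 : Matrix (Fin n) (Fin n) ℂ)
  have h2 := h0.const_sub (1 : Matrix (Fin n) (Fin n) ℂ)
  obtain ⟨G2, hG2, hG2'⟩ := exists_hasFDerivAt_matrix_inv h2 (isUnit_det_one_sub_skewMat b)
  obtain ⟨G3, hG3, hG3'⟩ := exists_hasFDerivAt_matrix_mul h1 hG2
  refine ⟨G3, hG3, fun h => ?_⟩
  have h3 : G2 h = (1 - skewMat b)⁻¹ * skewMat h * (1 - skewMat b)⁻¹ := by
    refine (hG2' h).trans ?_
    change -((1 - skewMat b)⁻¹ * (-skewMat h) * (1 - skewMat b)⁻¹) = _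
    rw [Matrix.mul_neg, Matrix.neg_mul, neg_neg]
  rw [hG3', h3, cayleyUnitary_mul_skewMat_cayleyDeriv]
  rfl

/-- The density of the Haar measure in the Cayley chart, up to a constant. -/
noncomputable def cayleyWeight (b : SkewCoord n) : ℝ := |LinearMap.det (cayleyDeriv b)|

theorem cayleyWeight_pos (b : SkewCoord n) : 0 < cayleyWeight b := by
  rw [cayleyWeight, abs_pos]
  have hinj : Function.Injective (cayleyDeriv b) := by
    rw [injective_iff_map_eq_zero]
    intro h hh
    have h1 := skewMat_cayleyDeriv b h
    rw [hh, map_zero, eq_comm, smul_eq_zero_iff_right two_ne_zero] at h1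
    have h2 := congrArg (fun M => (1 + skewMat b) * M * (1 - skewMat b)) h1
    simp only [Matrix.mul_zero, Matrix.zero_mul] at h2
    rw [Matrix.mul_assoc, Matrix.nonsing_inv_mul_cancel_right _ _ (isUnit_det_one_sub_skewMat b),
      Matrix.mul_nonsing_inv_cancel_left _ _ (isUnit_det_one_add_skewMat b)] at h2
    rw [← skewEntries_skewMat h, h2, map_zero]
  exact ((LinearEquiv.ofInjectiveEndo _ hinj).isUnit_det').ne_zero

theorem continuous_cayleyWeight : Continuous (cayleyWeight (n := n)) := by
  have h1 : Continuous fun b : SkewCoord n => (1 + skewMat b)⁻¹ :=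
    (continuous_const.add continuous_skewMat).matrix_inv_of_isUnit isUnit_det_one_add_skewMat
  have h2 : Continuous fun b : SkewCoord n => (1 - skewMat b)⁻¹ :=
    (continuous_const.sub continuous_skewMat).matrix_inv_of_isUnit isUnit_det_one_sub_skewMat
  have h : Continuous fun b : SkewCoord n => (cayleyDeriv b).toContinuousLinearMap := by
    rw [continuous_clm_apply]
    intro h
    refine (LinearMap.continuous_of_finiteDimensional (skewEntries (n := n))).comp ?_
    exact ((h1.matrix_mul continuous_const).matrix_mul h2).const_smul (2 : ℝ)
  exact (ContinuousLinearMap.continuous_det.comp h).abs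

/-- The Cayley transform as a chart of the maximal compact subgroup. -/
noncomputable def cayleyChart (b : SkewCoord n) : maxCompact n :=
  ofUnitary (cayleyUnitary b) (cayleyUnitary_mul_conjTranspose b)

theorem unitaryPart_cayleyChart (b : SkewCoord n) :
    unitaryPart (cayleyChart b : Sp n) = cayleyUnitary b :=
  unitaryPart_ofUnitary _ _

theorem cayleyChart_injective : Function.Injective (cayleyChart (n := n)) := by
  intro b b' h
  refine cayleyUnitary_injective ?_
  rw [← unitaryPart_cayleyChart, h, unitaryPart_cayleyChart]

theorem exists_cayleyChart_eq {k : maxCompact n} (h : IsUnit (1 + unitaryPart (k : Sp n)).det) :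
    ∃ b : SkewCoord n, cayleyChart b = k := by
  obtain ⟨b, hb⟩ := exists_cayleyUnitary_eq (unitaryPart_mul_conjTranspose k.2) h
  refine ⟨b, Subtype.ext (unitaryPart_injOn (cayleyChart b).2 k.2 ?_)⟩
  rw [unitaryPart_cayleyChart, hb]

theorem continuous_cayleyChart : Continuous (cayleyChart (n := n)) := by
  refine Continuous.subtype_mk (Continuous.subtype_mk ?_ _) _
  have h1 := continuous_cayleyUnitary (n := n)
  have hre := h1.matrix_map Complex.continuous_re
  have him := h1.matrix_map Complex.continuous_im
  exact Continuous.matrix_fromBlocks hre him him.neg hre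

theorem continuous_unitaryPart : Continuous fun k : maxCompact n => unitaryPart (k : Sp n) := by
  have h : Continuous fun g : Sp n =>
      (g : Matrix (Fin n ⊕ Fin n) (Fin n ⊕ Fin n) ℝ).map Complex.ofReal :=
    continuous_coe_sp.matrix_map Complex.continuous_ofReal
  have h1 : Continuous (spA : Sp n → _) := h.matrix_submatrix _ _
  have h2 : Continuous (spB : Sp n → _) := h.matrix_submatrix _ _
  exact (h1.add (h2.const_smul Complex.I)).comp continuous_subtype_val

end CayleyChart

/-! ### The `QR` decomposition as a change of variables -/

section QR

variable {n : ℕ}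

/-- Square matrices as vectors. -/
def sqEntries : Matrix (Fin n) (Fin n) ℂ →ₗ[ℂ] (Fin n × Fin n → ℂ) where
  toFun M := fun p => M p.1 p.2
  map_add' _ _ := rfl
  map_smul' _ _ := rfl

/-- The matrix with given entries. -/
def sqMat : (Fin n × Fin n → ℂ) →ₗ[ℂ] Matrix (Fin n) (Fin n) ℂ where
  toFun x := Matrix.of fun i j => x (i, j)
  map_add' _ _ := rfl
  map_smul' _ _ := rfl

theorem sqMat_sqEntries (M : Matrix (Fin n) (Fin n) ℂ) : sqMat (sqEntries M) = M := rfl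

theorem sqEntries_sqMat (x : Fin n × Fin n → ℂ) : sqEntries (sqMat x) = x := rfl

/-- The linear map `X ↦ A X B` on square matrices. -/
def twoSidedMul (A B : Matrix (Fin n) (Fin n) ℂ) :
    (Fin n × Fin n → ℂ) →ₗ[ℂ] (Fin n × Fin n → ℂ) where
  toFun x := sqEntries (A * sqMat x * B)
  map_add' x y := by rw [map_add, Matrix.mul_add, Matrix.add_mul, map_add]
  map_smul' c x := by rw [map_smul, Matrix.mul_smul, Matrix.smul_mul, map_smul, RingHom.id_apply]

theorem det_twoSidedMul (A B : Matrix (Fin n) (Fin n) ℂ) :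
    LinearMap.det (twoSidedMul A B) = A.det ^ n * B.det ^ n := by
  have h : twoSidedMul A B = Matrix.toLin' (Matrix.kronecker A Bᵀ) := by
    refine LinearMap.ext fun x => funext fun p => ?_
    rw [Matrix.toLin'_apply]
    change (A * sqMat x * B) p.1 p.2 = ∑ q, A p.1 q.1 * B q.2 p.2 * x q
    rw [Fintype.sum_prod_type_right]
    simp only [Matrix.mul_apply, Finset.sum_mul]
    refine Finset.sum_congr rfl fun i _ => Finset.sum_congr rfl fun j _ => ?_
    change A p.1 j * x (j, i) * B i p.2 = _
    ring
  have h1 : (Matrix.kronecker A Bᵀ).det = _ := Matrix.det_kronecker A Bᵀ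
  rw [h, LinearMap.det_toLin', h1, Matrix.det_transpose, Fintype.card_fin]

/-- Coordinates for the decomposition of a matrix into an upper triangular matrix and a unitary
matrix. -/
abbrev QRCoord (n : ℕ) : Type := SkewCoord n × ((Fin n → ℝ) × (StrictPairs n → ℂ))

/-- The product of an upper triangular matrix with the inverse of a unitary matrix. -/
noncomputable def qrMap (q : QRCoord n) : Fin n × Fin n → ℂ :=
  sqEntries (upTri q.2.1 q.2.2 * (cayleyUnitary q.1)ᴴ)

/-- The identification of the coordinate spaces that matches the skew-Hermitian part with the
entries below the diagonal and the imaginary parts of the diagonal entries. -/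
noncomputable def qrEquiv (n : ℕ) : QRCoord n ≃ᵐ (Fin n × Fin n → ℂ) :=
  MeasurableEquiv.prodAssoc.symm.trans
    (((MeasurableEquiv.prodAssoc.trans (((MeasurableEquiv.refl (StrictPairs n → ℂ)).prodCongr
      (MeasurableEquiv.prodComm.trans (reImEquiv (Fin n)))).trans
        (glueEquiv ℂ (Equiv.refl (StrictPairs n ⊕ Fin n))))).prodCongr
        (MeasurableEquiv.refl (StrictPairs n → ℂ))).trans (glueEquiv ℂ (squareIndexEquiv n)))

theorem qrEquiv_apply (q : QRCoord n) :
    qrEquiv n q = glueEquiv ℂ (squareIndexEquiv n)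
      (glueEquiv ℂ (Equiv.refl (StrictPairs n ⊕ Fin n)) (q.1.1, reImEquiv (Fin n) (q.2.1, q.1.2)),
        q.2.2) := rfl

/-- The term `star q.1.1` cancels the entries above the diagonal of the skew-Hermitian part. Up to
this unipotent change of coordinates, `qrEquiv` is the difference of an upper triangular and a
skew-Hermitian matrix, which is the shape of the differential of `qrMap`. -/
theorem qrEquiv_eq (q : QRCoord n) :
    qrEquiv n q = sqEntries (Matrix.diagonal (fun i => (q.2.1 i : ℂ)) +
      strictMat (q.2.2 + star q.1.1) - skewMat q.1) := by
  rw [qrEquiv_apply]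
  refine glueEquiv_ext _ _ ?_ fun p => ?_
  · rintro (p | i)
    · obtain ⟨⟨i, j⟩, hij⟩ := p
      have hij' : i < j := hij
      refine Eq.trans ?_ (glueEquiv_inl (R := ℂ) (Equiv.refl (StrictPairs n ⊕ Fin n)) _ _).symm
      change (Matrix.diagonal (fun i => (q.2.1 i : ℂ)) + strictMat (q.2.2 + star q.1.1) -
        skewMat q.1) j i = q.1.1 ⟨(i, j), hij⟩
      simp [Matrix.diagonal_apply_ne _ hij'.ne', strictMat_apply_of_le _ hij'.le,
        skewMat_apply_of_gt _ hij']
    · refine Eq.trans ?_ (glueEquiv_inr (R := ℂ) (Equiv.refl (StrictPairs n ⊕ Fin n)) _ _).symm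
      change (Matrix.diagonal (fun i => (q.2.1 i : ℂ)) + strictMat (q.2.2 + star q.1.1) -
        skewMat q.1) i i = ⟨q.2.1 i, q.1.2 i⟩
      simp [strictMat_apply_of_le _ le_rfl, skewMat_apply_self]
      apply Complex.ext <;> simp
  · obtain ⟨⟨i, j⟩, hij⟩ := p
    have hij' : i < j := hij
    change (Matrix.diagonal (fun i => (q.2.1 i : ℂ)) + strictMat (q.2.2 + star q.1.1) -
        skewMat q.1) i j = q.2.2 ⟨(i, j), hij⟩
    simp [Matrix.diagonal_apply_ne _ hij'.ne, strictMat_apply_of_lt _ hij',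
      skewMat_apply_of_lt _ hij']

theorem measurePreserving_qrEquiv : MeasurePreserving (qrEquiv n) := by
  have h1 : MeasurePreserving (MeasurableEquiv.prodComm.trans (reImEquiv (Fin n))) :=
    (measurePreserving_reImEquiv _).comp Measure.measurePreserving_swap
  have h2 := (measurePreserving_glueEquiv (R := ℂ) (Equiv.refl (StrictPairs n ⊕ Fin n))).comp
    (((MeasurePreserving.id (volume : Measure (StrictPairs n → ℂ))).prod h1).comp
      volume_preserving_prodAssoc)
  exact ((measurePreserving_glueEquiv (R := ℂ) (squareIndexEquiv n)).comp
    (h2.prod (MeasurePreserving.id (volume : Measure (StrictPairs n → ℂ))))).comp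
    (volume_preserving_prodAssoc.symm _)

/-- The linear equivalence underlying `qrEquiv`. -/
noncomputable def qrLinear (n : ℕ) : QRCoord n ≃L[ℝ] (Fin n × Fin n → ℂ) :=
  (qrEquiv n).toContinuousLinearEquiv
    (fun x y => by
      have h : reImEquiv (Fin n) ((x + y).2.1, (x + y).1.2) =
          reImEquiv (Fin n) (x.2.1, x.1.2) + reImEquiv (Fin n) (y.2.1, y.1.2) := rfl
      rw [qrEquiv_apply, h]
      exact (congrArg (fun t => glueEquiv ℂ (squareIndexEquiv n) (t, (x + y).2.2))
        (glueEquiv_add _ (x.1.1, reImEquiv (Fin n) (x.2.1, x.1.2))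
          (y.1.1, reImEquiv (Fin n) (y.2.1, y.1.2)))).trans
        (glueEquiv_add (squareIndexEquiv n) (_, x.2.2) (_, y.2.2)))
    (fun c x => by
      have h : reImEquiv (Fin n) ((c • x).2.1, (c • x).1.2) =
          c • reImEquiv (Fin n) (x.2.1, x.1.2) := by
        ext i
        rw [Pi.smul_apply, reImEquiv_apply, reImEquiv_apply]
        apply Complex.ext <;> simp
      rw [qrEquiv_apply, h]
      exact (congrArg (fun t => glueEquiv ℂ (squareIndexEquiv n) (t, (c • x).2.2))
        (glueEquiv_smul _ c (x.1.1, reImEquiv (Fin n) (x.2.1, x.1.2)))).trans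
        (glueEquiv_smul (squareIndexEquiv n) c (_, x.2.2)))

theorem measurePreserving_qrLinear : MeasurePreserving (qrLinear n) := measurePreserving_qrEquiv

open scoped Matrix.Norms.Operator in
/-- The differential of `T cᴴ` is `(dT - T (c⁻¹ dc)) cᴴ`. -/
theorem exists_hasFDerivAt_qrMap (q : QRCoord n) :
    ∃ G : QRCoord n →L[ℝ] (Fin n × Fin n → ℂ), HasFDerivAt qrMap G q ∧
      ∀ h, G h = sqEntries ((upTriDeriv q.2.1 q.2.2 h.2 -
        upTri q.2.1 q.2.2 * skewMat (cayleyDeriv q.1 h.1)) * (cayleyUnitary q.1)ᴴ) := by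
  obtain ⟨G0, hG0, hG0'⟩ := exists_hasFDerivAt_cayleyUnitary q.1
  have hT : HasFDerivAt (fun q : QRCoord n => upTri (𝕜 := ℂ) q.2.1 q.2.2)
      ((upTriDeriv q.2.1 q.2.2).toContinuousLinearMap.comp (ContinuousLinearMap.snd ℝ _ _)) q :=
    HasFDerivAt.comp (g := fun p : (Fin n → ℝ) × (StrictPairs n → ℂ) => upTri p.1 p.2) q
      (hasFDerivAt_upTri q.2.1 q.2.2) hasFDerivAt_snd
  have hc : HasFDerivAt (fun q : QRCoord n => cayleyUnitary q.1)
      (G0.comp (ContinuousLinearMap.fst ℝ _ _)) q :=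
    HasFDerivAt.comp (g := cayleyUnitary) q hG0 hasFDerivAt_fst
  let starL : Matrix (Fin n) (Fin n) ℂ →ₗ[ℝ] Matrix (Fin n) (Fin n) ℂ :=
    { toFun := fun M => Mᴴ
      map_add' := Matrix.conjTranspose_add
      map_smul' := fun c M => by simp }
  obtain ⟨G1, hG1, hG1'⟩ := hasFDerivAt_linear_comp starL hc
  obtain ⟨G2, hG2, hG2'⟩ := exists_hasFDerivAt_matrix_mul hT hG1
  obtain ⟨G3, hG3, hG3'⟩ := hasFDerivAt_linear_comp (sqEntries.restrictScalars ℝ) hG2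
  refine ⟨G3, hG3, fun h => ?_⟩
  have h1 : starL ((G0.comp (ContinuousLinearMap.fst ℝ _ _)) h) =
      -(skewMat (cayleyDeriv q.1 h.1) * (cayleyUnitary q.1)ᴴ) := by
    change (G0 h.1)ᴴ = _
    rw [hG0', Matrix.conjTranspose_mul, skewMat_conjTranspose, Matrix.neg_mul]
  refine (hG3' h).trans (congrArg sqEntries ((hG2' h).trans ?_))
  refine (congrArg (fun M => upTriDeriv q.2.1 q.2.2 h.2 * (cayleyUnitary q.1)ᴴ +
    upTri q.2.1 q.2.2 * M) ((hG1' h).trans h1)).trans ?_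
  rw [Matrix.sub_mul, Matrix.mul_neg, ← sub_eq_add_neg, ← Matrix.mul_assoc]

/-- The Jacobian of the `QR` coordinates. -/
theorem abs_det_qrMap {q : QRCoord n} (hq : ∀ i, 0 < q.2.1 i)
    {G : QRCoord n →L[ℝ] (Fin n × Fin n → ℂ)} (hG : ∀ h, G h =
      sqEntries ((upTriDeriv q.2.1 q.2.2 h.2 -
        upTri q.2.1 q.2.2 * skewMat (cayleyDeriv q.1 h.1)) * (cayleyUnitary q.1)ᴴ)) :
    |(((qrLinear n).symm : (Fin n × Fin n → ℂ) →L[ℝ] QRCoord n).comp G).det| =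
      cayleyWeight q.1 * ((∏ i, q.2.1 i) ^ (2 * n) * ∏ i, (q.2.1 i)⁻¹) := by
  obtain ⟨b, a, v⟩ := q
  simp only at hq hG ⊢
  obtain ⟨R, hRdet, hR⟩ := exists_upTriDeriv_factor (𝕜 := ℂ) hq v
  set T : Matrix (Fin n) (Fin n) ℂ := upTri a v with hT
  have hTdet : T.det = ((∏ i, a i : ℝ) : ℂ) := by rw [hT, det_upTri]; rfl
  -- the contribution of the skew-Hermitian part to the entries above the diagonal
  let g : SkewCoord n →ₗ[ℝ] (Fin n → ℝ) × (StrictPairs n → ℂ) :=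
    { toFun := fun b => (0, -star b.1)
      map_add' := fun b b' => by ext <;> simp [add_comm]
      map_smul' := fun c b => by ext <;> simp }
  let N : Module.End ℝ (QRCoord n) := LinearMap.inr ℝ _ _ ∘ₗ g ∘ₗ LinearMap.fst ℝ _ _
  have hN : IsNilpotent N := ⟨2, by
    refine LinearMap.ext fun q => ?_
    simp [N, g, pow_two]⟩
  let L : QRCoord n ≃ₗ[ℝ] (Fin n × Fin n → ℂ) := (qrLinear n).toLinearEquiv
  have hfac : (G : QRCoord n →ₗ[ℝ] (Fin n × Fin n → ℂ)) =
      (twoSidedMul T (cayleyUnitary b)ᴴ).restrictScalars ℝ ∘ₗ L.toLinearMap ∘ₗ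
        ((1 + N) ∘ₗ (cayleyDeriv b).prodMap R) := by
    refine LinearMap.ext fun h => ?_
    have h1 : (1 + N) ((cayleyDeriv b).prodMap R h) =
        (cayleyDeriv b h.1, ((R h.2).1, (R h.2).2 - star (cayleyDeriv b h.1).1)) := by
      change (cayleyDeriv b h.1, R h.2) + (0, (0, -star (cayleyDeriv b h.1).1)) = _
      ext <;> simp [sub_eq_add_neg]
    have h2 : L ((1 + N) ((cayleyDeriv b).prodMap R h)) =
        sqEntries (Matrix.diagonal (fun i => ((R h.2).1 i : ℂ)) + strictMat (R h.2).2 -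
          skewMat (cayleyDeriv b h.1)) := by
      rw [h1]
      change qrEquiv n _ = _
      rw [qrEquiv_eq]
      simp
    change G h = twoSidedMul T (cayleyUnitary b)ᴴ (L ((1 + N) ((cayleyDeriv b).prodMap R h)))
    rw [h2, hG, hR]
    change _ = sqEntries (T * _ * _)
    rw [sqMat_sqEntries, Matrix.mul_sub]
    rfl
  have hdet : (((qrLinear n).symm : (Fin n × Fin n → ℂ) →L[ℝ] QRCoord n).comp G).det =
      LinearMap.det ((L.symm.toLinearMap ∘ₗ
        (twoSidedMul T (cayleyUnitary b)ᴴ).restrictScalars ℝ ∘ₗ L.toLinearMap) ∘ₗ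
        ((1 + N) ∘ₗ (cayleyDeriv b).prodMap R)) := by
    change LinearMap.det (L.symm.toLinearMap ∘ₗ (G : QRCoord n →ₗ[ℝ] (Fin n × Fin n → ℂ))) = _
    rw [hfac]
    rfl
  have hconj := LinearMap.det_conj ((twoSidedMul T (cayleyUnitary b)ᴴ).restrictScalars ℝ) L.symm
  rw [LinearEquiv.symm_symm] at hconj
  have hu : ‖(cayleyUnitary b).det‖ = 1 :=
    norm_det_of_mul_conjTranspose (cayleyUnitary_mul_conjTranspose b)
  have hpos : 0 < ∏ i, a i := Finset.prod_pos fun i _ => hq i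
  have hpos' : 0 < ∏ i, (a i)⁻¹ := Finset.prod_pos fun i _ => inv_pos.2 (hq i)
  rw [hdet, LinearMap.det_comp, hconj, LinearMap.det_comp, LinearMap.det_prodMap,
    LinearMap.det_one_add_of_isNilpotent hN, abs_mul, abs_det_restrictScalars, det_twoSidedMul,
    hTdet, hRdet, one_mul, abs_mul, norm_mul, norm_pow, norm_pow, Matrix.det_conjTranspose,
    norm_star, hu, one_pow, mul_one, Complex.norm_real, Real.norm_eq_abs, abs_of_pos hpos,
    abs_of_pos hpos', cayleyWeight, ← pow_mul, mul_comm n 2]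
  ring

end QR

/-! ### Averaging over the compact group -/

/-- If almost every orbit meets `E` in a translate of the same subset `O` of a compact group, then
the integral of an invariant function over `E` is a multiple of its full integral. -/
theorem lintegral_mul_measure_eq_setLIntegral {K X : Type*} [Group K] [MeasurableSpace K]
    [MeasurableMul K] [MeasurableSpace X] (κ : Measure K) [IsProbabilityMeasure κ]
    [κ.IsMulRightInvariant] {ν : Measure X} [SFinite ν] {ρ : K → X → X}
    (hρ : Measurable fun q : K × X => ρ q.1 q.2) (hν : ∀ k, MeasurePreserving (ρ k) ν ν)
    {E : Set X} (hE : MeasurableSet E) {O : Set K} (hO : MeasurableSet O)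
    (h : ∀ᵐ x ∂ν, ∃ k₀, ∀ k, ρ k x ∈ E ↔ k * k₀ ∈ O) {F : X → ℝ≥0∞} (hF : Measurable F)
    (hinv : ∀ k x, F (ρ k x) = F x) :
    (∫⁻ x, F x ∂ν) * κ O = ∫⁻ x in E, F x ∂ν := by
  have hm : Measurable (E.indicator F) := hF.indicator hE
  have h1 (k : K) : ∫⁻ x, E.indicator F (ρ k x) ∂ν = ∫⁻ x in E, F x ∂ν := by
    rw [(hν k).lintegral_comp hm, lintegral_indicator hE]
  have h2 : ∫⁻ k, (∫⁻ x, E.indicator F (ρ k x) ∂ν) ∂κ = ∫⁻ x in E, F x ∂ν := by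
    simp only [h1, lintegral_const, measure_univ, mul_one]
  rw [← h2, lintegral_lintegral_swap (f := fun k x => E.indicator F (ρ k x))
    (hm.comp hρ).aemeasurable, ← lintegral_mul_const _ hF]
  refine lintegral_congr_ae (h.mono fun x hx => ?_)
  obtain ⟨k₀, hk₀⟩ := hx
  have h3 (k : K) : E.indicator F (ρ k x) =
      ((fun k => k * k₀) ⁻¹' O).indicator (fun _ => F x) k := by
    by_cases hk : ρ k x ∈ E
    · rw [Set.indicator_of_mem hk, Set.indicator_of_mem (s := (fun k => k * k₀) ⁻¹' O)
        ((hk₀ k).1 hk), hinv]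
    · rw [Set.indicator_of_notMem hk, Set.indicator_of_notMem (s := (fun k => k * k₀) ⁻¹' O)
        (mt (hk₀ k).2 hk)]
  simp only [h3]
  rw [lintegral_indicator_const (measurable_mul_const k₀ hO), measure_preimage_mul_right]

/-! ### Gaussian integrals -/

section Gaussian

/-- A lower integral of a product of functions of separate variables. Positivity of the integrals
implies integrability, since the integral of a non-integrable function is zero. -/
theorem lintegral_pi_ofReal_prod {ι : Type*} [Fintype ι] {E : Type*} [MeasurableSpace E]
    {μ : ι → Measure E} [∀ i, SigmaFinite (μ i)] {f : ι → E → ℝ}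
    (h0 : ∀ i, ∀ᵐ x ∂μ i, 0 ≤ f i x) (hpos : ∀ i, 0 < ∫ x, f i x ∂μ i) :
    ∫⁻ x : ι → E, ∏ i, ENNReal.ofReal (f i (x i)) ∂Measure.pi μ =
      ENNReal.ofReal (∏ i, ∫ x, f i x ∂μ i) := by
  have hint (i : ι) : Integrable (f i) (μ i) := by
    by_contra h
    exact (hpos i).ne' (integral_undef h)
  have h2 : ∀ᵐ x ∂Measure.pi μ, ∀ i, 0 ≤ f i (x i) := by
    rw [ae_all_iff]
    exact fun i => (Measure.tendsto_eval_ae_ae (μ := μ) (i := i)).eventually (h0 i)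
  rw [← integral_fintype_prod_eq_prod, ofReal_integral_eq_lintegral_ofReal
    (Integrable.fintype_prod hint) (h2.mono fun x hx => Finset.prod_nonneg fun i _ => hx i)]
  refine lintegral_congr_ae (h2.mono fun x hx => ?_)
  exact (ENNReal.ofReal_prod_of_nonneg fun i _ => hx i).symm

theorem integral_complex_gaussian {c : ℝ} (hc : 0 < c) :
    ∫ z : ℂ, Real.exp (-(c * ‖z‖ ^ 2)) = Real.pi / c := by
  have h := Complex.integral_exp_neg_mul_rpow (p := 2) one_le_two hc
  simp only [Real.rpow_two, neg_mul] at h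
  rw [h, show (2 : ℝ) / 2 + 1 = 1 + 1 by norm_num, Real.Gamma_add_one one_ne_zero, Real.Gamma_one,
    neg_div, div_self two_ne_zero, Real.rpow_neg_one]
  ring

theorem lintegral_complex_gaussian {ι : Type*} [Fintype ι] {c : ι → ℝ} (hc : ∀ i, 0 < c i) :
    ∫⁻ x : ι → ℂ, ENNReal.ofReal (Real.exp (-∑ i, c i * ‖x i‖ ^ 2)) =
      ENNReal.ofReal (∏ i, Real.pi / c i) := by
  have h := lintegral_pi_ofReal_prod (μ := fun _ : ι => (volume : Measure ℂ))
    (f := fun i z => Real.exp (-(c i * ‖z‖ ^ 2))) (fun i => .of_forall fun _ => (Real.exp_pos _).le)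
    (fun i => by
      rw [integral_complex_gaussian (hc i)]
      exact div_pos Real.pi_pos (hc i))
  simp only [integral_complex_gaussian (hc _)] at h
  rw [← h]
  refine lintegral_congr fun x => ?_
  rw [← Finset.sum_neg_distrib, Real.exp_sum,
    ENNReal.ofReal_prod_of_nonneg fun i _ => (Real.exp_pos _).le]

theorem integral_odd_pow_mul_gaussian (m : ℕ) :
    ∫ x in Set.Ioi (0 : ℝ), x ^ (2 * m + 1) * Real.exp (-x ^ 2) = (m.factorial : ℝ) / 2 := by
  have h := integral_rpow_mul_exp_neg_rpow (p := 2) (q := 2 * m + 1) two_pos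
    (by have : (0 : ℝ) ≤ m := m.cast_nonneg; linarith)
  rw [show ((2 : ℝ) * m + 1 + 1) / 2 = m + 1 by ring, Real.Gamma_nat_eq_factorial] at h
  have h2 : ∀ x : ℝ, x ^ ((2 : ℝ) * m + 1) = x ^ (2 * m + 1) := by
    intro x
    rw [← Real.rpow_natCast]
    norm_num
  simp only [h2, Real.rpow_two] at h
  rw [h]
  ring

variable {n : ℕ}

theorem prod_strictPairs_fst {M : Type*} [CommMonoid M] (f : Fin n → M) :
    ∏ p : StrictPairs n, f p.1.1 = ∏ i : Fin n, f i ^ (n - 1 - (i : ℕ)) := by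
  rw [prod_strictPairs fun i _ => f i]
  refine Finset.prod_congr rfl fun i _ => ?_
  rw [Finset.prod_ite, Finset.prod_const_one, mul_one, Finset.prod_const,
    Finset.filter_lt_eq_Ioi, Fin.card_Ioi]

theorem card_strictPairs : Fintype.card (StrictPairs n) = n * (n - 1) / 2 := by
  have h := prod_strictPairs_fst (n := n) (fun _ => Multiplicative.ofAdd (1 : ℕ))
  have h2 := congrArg Multiplicative.toAdd h
  simp only [Finset.prod_const, Finset.card_univ, toAdd_pow, toAdd_ofAdd, toAdd_prod,
    smul_eq_mul, mul_one] at h2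
  rw [h2, Fin.sum_univ_eq_sum_range (fun i => n - 1 - i), Finset.sum_range_reflect (fun i => i) n,
    Finset.sum_range_id]

/-- The Gaussian integral over upper triangular matrices, against the Jacobian of the `QR`
coordinates. -/
theorem lintegral_upTri_gaussian :
    ∫⁻ p in {a : Fin n → ℝ | ∀ i, 0 < a i} ×ˢ (Set.univ : Set (StrictPairs n → ℂ)),
      ENNReal.ofReal ((∏ i, p.1 i) ^ (2 * n) * ∏ i, (p.1 i)⁻¹) *
        ENNReal.ofReal (Real.exp (-((∑ i, p.1 i ^ 2) + ∑ q, p.1 q.1.1 ^ 2 * ‖p.2 q‖ ^ 2))) =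
      ENNReal.ofReal (Real.pi ^ (n * (n - 1) / 2) * ∏ i : Fin n, ((i : ℕ).factorial : ℝ) / 2) := by
  have hw : Measurable fun a : Fin n → ℝ => ENNReal.ofReal ((∏ i, a i) ^ (2 * n) * ∏ i, (a i)⁻¹) :=
    (((Finset.measurable_prod _ fun i _ => measurable_pi_apply i).pow_const _).mul
      (Finset.measurable_prod _ fun i _ => (measurable_pi_apply i).inv)).ennreal_ofReal
  have hf : Measurable fun p : (Fin n → ℝ) × (StrictPairs n → ℂ) => ENNReal.ofReal
      (Real.exp (-((∑ i, p.1 i ^ 2) + ∑ q, p.1 q.1.1 ^ 2 * ‖p.2 q‖ ^ 2))) := by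
    refine (ENNReal.continuous_ofReal.comp ?_).measurable
    fun_prop
  refine (setLIntegral_prod_univ_mul measurableSet_posVec hw (fun _ => ENNReal.ofReal_ne_top)
    (hf.comp (((measurable_subtype_coe.comp measurable_fst)).prodMk measurable_snd))).trans ?_
  have h1 : ∀ a ∈ {a : Fin n → ℝ | ∀ i, 0 < a i},
      ENNReal.ofReal ((∏ i, a i) ^ (2 * n) * ∏ i, (a i)⁻¹) *
        ∫⁻ v : StrictPairs n → ℂ, ENNReal.ofReal
          (Real.exp (-((∑ i, a i ^ 2) + ∑ q, a q.1.1 ^ 2 * ‖v q‖ ^ 2))) =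
      ENNReal.ofReal (Real.pi ^ (n * (n - 1) / 2)) *
        ∏ i, ENNReal.ofReal (a i ^ (2 * (i : ℕ) + 1) * Real.exp (-a i ^ 2)) := by
    intro a ha
    have h2 (v : StrictPairs n → ℂ) : ENNReal.ofReal
        (Real.exp (-((∑ i, a i ^ 2) + ∑ q, a q.1.1 ^ 2 * ‖v q‖ ^ 2))) =
        ENNReal.ofReal (Real.exp (-∑ i, a i ^ 2)) * ENNReal.ofReal
          (Real.exp (-∑ q : StrictPairs n, a q.1.1 ^ 2 * ‖v q‖ ^ 2)) := by
      rw [← ENNReal.ofReal_mul (Real.exp_pos _).le, ← Real.exp_add, neg_add]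
    have hpos (i : Fin n) : 0 < a i := ha i
    simp only [h2]
    rw [lintegral_const_mul' _ _ ENNReal.ofReal_ne_top,
      lintegral_complex_gaussian (c := fun q : StrictPairs n => a q.1.1 ^ 2)
        (fun q => pow_pos (ha q.1.1) 2), Finset.prod_div_distrib, Finset.prod_const,
      Finset.card_univ, card_strictPairs, prod_strictPairs_fst fun i => a i ^ 2,
      ← ENNReal.ofReal_prod_of_nonneg (fun i _ => by have := hpos i; positivity),
      ← ENNReal.ofReal_mul (Real.exp_pos _).le,
      ← ENNReal.ofReal_mul (by
        have h3 : 0 < ∏ i, a i := Finset.prod_pos fun i _ => ha i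
        have h4 : 0 < ∏ i, (a i)⁻¹ := Finset.prod_pos fun i _ => inv_pos.2 (ha i)
        positivity),
      ← ENNReal.ofReal_mul (by have := Real.pi_pos; positivity)]
    congr 1
    have key : (∏ i, a i ^ (2 * n)) * (∏ i, (a i)⁻¹) *
          ∏ i : Fin n, ((a i ^ 2) ^ (n - 1 - (i : ℕ)))⁻¹ =
        ∏ i : Fin n, a i ^ (2 * (i : ℕ) + 1) := by
      rw [← Finset.prod_mul_distrib, ← Finset.prod_mul_distrib]
      refine Finset.prod_congr rfl fun i _ => ?_
      obtain ⟨m, hm⟩ : ∃ m, n = i + 1 + m := ⟨n - (i + 1), by omega⟩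
      have h5 : n - 1 - (i : ℕ) = m := by omega
      have h6 : 2 * n = (2 * (i : ℕ) + 1) + 1 + 2 * m := by omega
      have h7 := (hpos i).ne'
      rw [h5, h6, ← pow_mul]
      field_simp
      ring
    rw [← Finset.sum_neg_distrib, Real.exp_sum, ← Finset.prod_pow, div_eq_mul_inv,
      ← Finset.prod_inv_distrib, Finset.prod_mul_distrib, ← key]
    ring
  rw [setLIntegral_congr_fun measurableSet_posVec h1,
    lintegral_const_mul' _ _ ENNReal.ofReal_ne_top]
  have hset : {a : Fin n → ℝ | ∀ i, 0 < a i} = Set.univ.pi fun _ => Set.Ioi 0 := by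
    ext a
    simp
  have h3 := lintegral_pi_ofReal_prod
    (μ := fun _ : Fin n => (volume : Measure ℝ).restrict (Set.Ioi 0))
    (f := fun i x => x ^ (2 * (i : ℕ) + 1) * Real.exp (-x ^ 2))
    (fun i => (ae_restrict_mem measurableSet_Ioi).mono fun x hx => by
      have hx' : 0 < x := hx
      positivity)
    (fun i => by
      rw [integral_odd_pow_mul_gaussian]
      positivity)
  simp only [integral_odd_pow_mul_gaussian] at h3
  rw [hset, volume_pi, Measure.restrict_pi_pi, h3, ← ENNReal.ofReal_mul (by positivity)]

end Gaussian

/-! ### The Haar measure in the Cayley chart -/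

section CayleyHaar

variable {n : ℕ}

instance borelSpace_upTriCoord : BorelSpace ((Fin n → ℝ) × (StrictPairs n → ℂ)) := inferInstance

instance borelSpace_skewCoord : BorelSpace (SkewCoord n) := inferInstance

instance borelSpace_qrCoord : BorelSpace (QRCoord n) := Prod.borelSpace

instance isAddHaarMeasure_upTriCoord :
    (volume : Measure ((Fin n → ℝ) × (StrictPairs n → ℂ))).IsAddHaarMeasure :=
  Measure.prod.instIsAddHaarMeasure (volume : Measure (Fin n → ℝ))
    (volume : Measure (StrictPairs n → ℂ))

instance isAddHaarMeasure_skewCoord : (volume : Measure (SkewCoord n)).IsAddHaarMeasure :=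
  Measure.prod.instIsAddHaarMeasure (volume : Measure (StrictPairs n → ℂ))
    (volume : Measure (Fin n → ℝ))

instance isAddHaarMeasure_qrCoord : (volume : Measure (QRCoord n)).IsAddHaarMeasure :=
  Measure.prod.instIsAddHaarMeasure (volume : Measure (SkewCoord n))
    (volume : Measure ((Fin n → ℝ) × (StrictPairs n → ℂ)))

theorem continuous_sqMat : Continuous (sqMat (n := n)) :=
  continuous_matrix fun _ _ => continuous_apply _

/-- Singular matrices form a null set: a line in the direction of the identity meets it in finitely
many points. -/
theorem ae_isUnit_det_sqMat : ∀ᵐ x : Fin n × Fin n → ℂ, IsUnit (sqMat x).det := by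
  set N : Set (Fin n × Fin n → ℂ) := {x | (sqMat x).det = 0} with hN
  have hNm : MeasurableSet N :=
    (isClosed_eq continuous_sqMat.matrix_det continuous_const).measurableSet
  let e : ℝ → (Fin n × Fin n → ℂ) := fun s => sqEntries (Matrix.scalar (Fin n) (-(s : ℂ)))
  have he : Continuous e := by
    refine continuous_pi fun p => ?_
    change Continuous fun s : ℝ => Matrix.diagonal (fun _ => -(s : ℂ)) p.1 p.2
    by_cases h : p.1 = p.2
    · simp only [h, Matrix.diagonal_apply_eq]
      fun_prop
    · simp only [Matrix.diagonal_apply_ne _ h]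
      exact continuous_const
  have h1 (s : ℝ) : ∫⁻ x, N.indicator 1 (x + e s) = volume N := by
    rw [lintegral_add_right_eq_self (fun x => N.indicator 1 x), lintegral_indicator_one hNm]
  have hm : Measurable fun q : ℝ × (Fin n × Fin n → ℂ) =>
      N.indicator (1 : (Fin n × Fin n → ℂ) → ℝ≥0∞) (q.2 + e q.1) :=
    (measurable_one.indicator hNm).comp
      (continuous_snd.add (he.comp continuous_fst)).measurable
  have h2 : ∫⁻ s in Set.Icc (0 : ℝ) 1,
      (∫⁻ x, N.indicator (1 : (Fin n × Fin n → ℂ) → ℝ≥0∞) (x + e s)) = volume N := by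
    simp only [h1, lintegral_const, Measure.restrict_apply MeasurableSet.univ, Set.univ_inter,
      Real.volume_Icc]
    simp
  have h3 : volume N = 0 := by
    rw [← h2, lintegral_lintegral_swap
      (f := fun s x => N.indicator (1 : (Fin n × Fin n → ℂ) → ℝ≥0∞) (x + e s)) hm.aemeasurable]
    refine (lintegral_congr fun x => ?_).trans lintegral_zero
    have hfin : {s : ℝ | x + e s ∈ N}.Finite := by
      have h4 : ((sqMat x).charpoly.rootSet ℂ).Finite := Polynomial.rootSet_finite _ _
      refine (h4.preimage (f := fun s : ℝ => (s : ℂ))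
        (Complex.ofReal_injective.injOn)).subset fun s hs => ?_
      have h5 : (sqMat x + Matrix.scalar (Fin n) (-(s : ℂ))).det = 0 := hs
      rw [Set.mem_preimage, Polynomial.mem_rootSet]
      refine ⟨(sqMat x).charpoly_monic.ne_zero, ?_⟩
      rw [Polynomial.aeval_def, Polynomial.eval₂_eq_eval_map, Algebra.algebraMap_self,
        Polynomial.map_id, Matrix.eval_charpoly, ← neg_sub, Matrix.det_neg, sub_eq_add_neg,
        ← map_neg, h5, mul_zero]
    refine le_antisymm ((setLIntegral_le_lintegral _ _).trans ?_) zero_le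
    refine (lintegral_indicator_one (μ := volume) (s := {s : ℝ | x + e s ∈ N})
      hfin.measurableSet).le.trans ?_
    rw [hfin.measure_zero]
  filter_upwards [compl_mem_ae_iff.2 h3] with x hx
  exact isUnit_iff_ne_zero.2 hx

open scoped ComplexOrder in
/-- Every invertible matrix is the product of an upper triangular matrix with positive diagonal and
a unitary matrix. -/
theorem exists_qr {M : Matrix (Fin n) (Fin n) ℂ} (hM : IsUnit M.det) :
    ∃ (a : Fin n → ℝ) (v : StrictPairs n → ℂ) (k : maxCompact n), (∀ i, 0 < a i) ∧
      M = upTri a v * (unitaryPart (k : Sp n))ᴴ := by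
  obtain ⟨a, v, ha, hS⟩ := exists_cholesky (Matrix.PosDef.mul_conjTranspose_self M
    (Matrix.vecMul_injective_of_isUnit ((Matrix.isUnit_iff_isUnit_det _).2 hM)))
  have hT := isUnit_det_upTri (𝕜 := ℂ) ha v
  have hMH : IsUnit Mᴴ.det := by rw [Matrix.det_conjTranspose]; exact hM.star
  set u := Mᴴ * ((upTri a v)ᴴ)⁻¹ with hu
  have hTH : IsUnit (upTri (𝕜 := ℂ) a v)ᴴ.det := by rw [Matrix.det_conjTranspose]; exact hT.star
  have huH : uᴴ = (upTri a v)⁻¹ * M := by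
    rw [hu, Matrix.conjTranspose_mul, Matrix.conjTranspose_nonsing_inv,
      Matrix.conjTranspose_conjTranspose, Matrix.conjTranspose_conjTranspose]
  have huu : uᴴ * u = 1 := by
    rw [huH, hu, Matrix.mul_assoc, ← Matrix.mul_assoc M, hS, Matrix.mul_assoc (upTri a v),
      Matrix.mul_nonsing_inv _ hTH, Matrix.mul_one, Matrix.nonsing_inv_mul _ hT]
  refine ⟨a, v, ofUnitary u (by rw [mul_eq_one_comm, huu]), ha, ?_⟩
  rw [unitaryPart_ofUnitary, huH, Matrix.mul_nonsing_inv_cancel_left _ _ hT]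

theorem upTri_mul_unitary_unique {a a' : Fin n → ℝ} (ha : ∀ i, 0 < a i) (ha' : ∀ i, 0 < a' i)
    {v v' : StrictPairs n → ℂ} {u u' : Matrix (Fin n) (Fin n) ℂ} (hu : u * uᴴ = 1)
    (hu' : u' * u'ᴴ = 1) (h : upTri a v * uᴴ = upTri a' v' * u'ᴴ) :
    a = a' ∧ v = v' ∧ u = u' := by
  have key (T u : Matrix (Fin n) (Fin n) ℂ) (hu : u * uᴴ = 1) : T * Tᴴ = (T * uᴴ) * (T * uᴴ)ᴴ := by
    have hu' : uᴴ * u = 1 := by rw [mul_eq_one_comm, hu]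
    rw [Matrix.conjTranspose_mul, Matrix.conjTranspose_conjTranspose, Matrix.mul_assoc,
      ← Matrix.mul_assoc uᴴ, hu', Matrix.one_mul]
  obtain ⟨rfl, rfl⟩ := cholesky_unique ha ha' ((key _ u hu).trans (by rw [h, ← key _ u' hu']))
  refine ⟨rfl, rfl, ?_⟩
  have h1 := congrArg ((upTri a v)⁻¹ * ·) h
  simp only [Matrix.nonsing_inv_mul_cancel_left _ _ (isUnit_det_upTri ha v)] at h1
  exact Matrix.conjTranspose_injective h1

theorem qrMap_injOn (B : Set (SkewCoord n)) :
    Set.InjOn qrMap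
      (B ×ˢ ({a : Fin n → ℝ | ∀ i, 0 < a i} ×ˢ (Set.univ : Set (StrictPairs n → ℂ)))) := by
  rintro ⟨b, a, v⟩ ⟨-, ha, -⟩ ⟨b', a', v'⟩ ⟨-, ha', -⟩ h
  obtain ⟨rfl, rfl, h3⟩ := upTri_mul_unitary_unique ha ha' (cayleyUnitary_mul_conjTranspose b)
    (cayleyUnitary_mul_conjTranspose b') (congrArg sqMat h)
  rw [cayleyUnitary_injective h3]

/-- The sum of the squares of the absolute values of the entries. -/
theorem sum_norm_sq_mul_unitary (M : Matrix (Fin n) (Fin n) ℂ) {u : Matrix (Fin n) (Fin n) ℂ}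
    (hu : u * uᴴ = 1) :
    ∑ p, ‖sqEntries (M * uᴴ) p‖ ^ 2 = ∑ p, ‖sqEntries M p‖ ^ 2 := by
  have key (M : Matrix (Fin n) (Fin n) ℂ) :
      ((∑ p, ‖sqEntries M p‖ ^ 2 : ℝ) : ℂ) = (M * Mᴴ).trace := by
    rw [Fintype.sum_prod_type]
    simp only [Matrix.trace, Matrix.diag, Matrix.mul_apply, Matrix.conjTranspose_apply]
    push_cast
    refine Finset.sum_congr rfl fun i _ => Finset.sum_congr rfl fun j _ => ?_
    exact (Complex.mul_conj' (M i j)).symm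
  have hu' : uᴴ * u = 1 := by rw [mul_eq_one_comm, hu]
  have h : ((∑ p, ‖sqEntries (M * uᴴ) p‖ ^ 2 : ℝ) : ℂ) = ((∑ p, ‖sqEntries M p‖ ^ 2 : ℝ) : ℂ) := by
    rw [key, key, Matrix.conjTranspose_mul, Matrix.conjTranspose_conjTranspose, Matrix.mul_assoc,
      ← Matrix.mul_assoc uᴴ, hu', Matrix.one_mul]
  exact_mod_cast h

theorem sum_norm_sq_upTri (a : Fin n → ℝ) (v : StrictPairs n → ℂ) :
    ∑ p, ‖sqEntries (upTri a v) p‖ ^ 2 =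
      (∑ i, a i ^ 2) + ∑ q : StrictPairs n, a q.1.1 ^ 2 * ‖v q‖ ^ 2 := by
  rw [← (squareIndexEquiv n).sum_comp, Fintype.sum_sum_type, Fintype.sum_sum_type]
  have h1 (q : StrictPairs n) :
      sqEntries (upTri a v) (squareIndexEquiv n (Sum.inl (Sum.inl q))) = 0 :=
    isUpperTriangular_upTri a v q.2
  have h2 (i : Fin n) : sqEntries (upTri a v) (squareIndexEquiv n (Sum.inl (Sum.inr i))) = a i :=
    upTri_apply_self a v i
  have h3 (q : StrictPairs n) :
      sqEntries (upTri a v) (squareIndexEquiv n (Sum.inr q)) = a q.1.1 * v q :=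
    upTri_apply_of_lt a v q.2
  simp only [h1, h2, h3, norm_zero, norm_mul, Complex.norm_real, mul_pow, Real.norm_eq_abs, sq_abs]
  simp

/-- The Haar measure in the Cayley chart. The constant comes from computing the Gaussian integral
over all square matrices in `QR` coordinates. -/
theorem lintegral_cayleyWeight (κ : Measure (maxCompact n)) [κ.IsHaarMeasure]
    [IsProbabilityMeasure κ] {O : Set (maxCompact n)} (hO : MeasurableSet O)
    (hO' : ∀ k ∈ O, IsUnit (1 + unitaryPart (k : Sp n)).det) :
    ∫⁻ b in cayleyChart ⁻¹' O, ENNReal.ofReal (cayleyWeight b) =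
      ENNReal.ofReal (2 ^ n * Real.pi ^ (n * (n + 1) / 2) / ∏ i : Fin n, ((i : ℕ).factorial : ℝ)) *
        κ O := by
  have := isMulRightInvariant_of_isProbabilityMeasure κ
  set B := cayleyChart ⁻¹' O with hB
  have hBm : MeasurableSet B := continuous_cayleyChart.measurable hO
  set S : Set ((Fin n → ℝ) × (StrictPairs n → ℂ)) := {a | ∀ i, 0 < a i} ×ˢ Set.univ with hS
  have hSm : MeasurableSet S := measurableSet_posVec.prod MeasurableSet.univ
  choose G hG hG' using fun q : QRCoord n => exists_hasFDerivAt_qrMap q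
  set E := qrMap '' (B ×ˢ S) with hE
  have hEm : MeasurableSet E := by
    have h := (measurableEmbedding_of_measurePreserving (hBm.prod hSm) (fun q _ => hG q)
      (qrMap_injOn B) (qrLinear n)).measurableSet_range
    rwa [Set.range_domRestrict] at h
  let ρ : maxCompact n → (Fin n × Fin n → ℂ) → (Fin n × Fin n → ℂ) := fun k =>
    twoSidedMul 1 (unitaryPart (k : Sp n))ᴴ
  have hρ' (k : maxCompact n) (x) : ρ k x = sqEntries (sqMat x * (unitaryPart (k : Sp n))ᴴ) := by
    change sqEntries (1 * sqMat x * _) = _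
    rw [Matrix.one_mul]
  have hρm : Measurable fun q : maxCompact n × (Fin n × Fin n → ℂ) => ρ q.1 q.2 := by
    simp only [hρ']
    refine Continuous.measurable (continuous_pi fun p => ?_)
    exact (continuous_apply_apply p.1 p.2).comp ((continuous_sqMat.comp continuous_snd).matrix_mul
      (continuous_unitaryPart.comp continuous_fst).matrix_conjTranspose)
  have hν (k : maxCompact n) : MeasurePreserving (ρ k) := by
    have hdet : |LinearMap.det ((twoSidedMul (1 : Matrix (Fin n) (Fin n) ℂ)
        (unitaryPart (k : Sp n))ᴴ).restrictScalars ℝ)| = 1 := by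
      have h' := norm_det_of_mul_conjTranspose (unitaryPart_mul_conjTranspose k.2)
      rw [abs_det_restrictScalars, det_twoSidedMul, Matrix.det_one, one_pow, one_mul, norm_pow,
        Matrix.det_conjTranspose, norm_star, h', one_pow, one_pow]
    refine ⟨hρm.of_uncurry_left, ?_⟩
    have h := Measure.map_linearMap_addHaar_eq_smul_addHaar
      (volume : Measure (Fin n × Fin n → ℂ)) (abs_ne_zero.1 (hdet.symm ▸ one_ne_zero))
    rw [abs_inv, hdet, inv_one, ENNReal.ofReal_one, one_smul] at h
    exact h
  have hcov : ∀ᵐ x : Fin n × Fin n → ℂ, ∃ k₀ : maxCompact n, ∀ k : maxCompact n,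
      ρ k x ∈ E ↔ k * k₀ ∈ O := by
    filter_upwards [ae_isUnit_det_sqMat] with x hx
    obtain ⟨a, v, k₀, ha, hM⟩ := exists_qr hx
    refine ⟨k₀, fun k => ?_⟩
    have h1 : ρ k x = sqEntries (upTri a v * (unitaryPart ((k * k₀ : maxCompact n) : Sp n))ᴴ) := by
      rw [hρ', hM, Subgroup.coe_mul, unitaryPart_mul _ k₀.2, Matrix.conjTranspose_mul,
        Matrix.mul_assoc]
    rw [h1]
    constructor
    · rintro ⟨⟨b, a', v'⟩, ⟨hb, ha', -⟩, h⟩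
      obtain ⟨-, -, h3⟩ := upTri_mul_unitary_unique ha' ha (cayleyUnitary_mul_conjTranspose b)
        (unitaryPart_mul_conjTranspose (k * k₀).2) (congrArg sqMat h)
      rw [← unitaryPart_cayleyChart] at h3
      have h4 : cayleyChart b = k * k₀ :=
        Subtype.ext (unitaryPart_injOn (cayleyChart b).2 (k * k₀).2 h3)
      rw [← h4]
      exact hb
    · intro hk
      obtain ⟨b, hb⟩ := exists_cayleyChart_eq (hO' _ hk)
      refine ⟨(b, (a, v)), ⟨?_, ha, trivial⟩, ?_⟩
      · change cayleyChart b ∈ O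
        rwa [hb]
      · rw [qrMap, ← hb, unitaryPart_cayleyChart]
  let F : (Fin n × Fin n → ℂ) → ℝ≥0∞ := fun x => ENNReal.ofReal (Real.exp (-∑ p, 1 * ‖x p‖ ^ 2))
  have hF : Measurable F := (ENNReal.continuous_ofReal.comp (by fun_prop)).measurable
  have hFρ (k : maxCompact n) (x) : F (ρ k x) = F x := by
    simp only [F, one_mul]
    rw [hρ', sum_norm_sq_mul_unitary _ (unitaryPart_mul_conjTranspose k.2), sqEntries_sqMat]
  have h1 := lintegral_mul_measure_eq_setLIntegral κ hρm hν hEm hO hcov hF hFρ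
  rw [lintegral_complex_gaussian fun _ => one_pos, hE,
    lintegral_image_eq_of_measurePreserving measurePreserving_qrLinear (hBm.prod hSm)
      (fun q _ => hG q) (qrMap_injOn B)] at h1
  have h2 : ∀ q ∈ B ×ˢ S,
      ENNReal.ofReal |(((qrLinear n).symm : (Fin n × Fin n → ℂ) →L[ℝ] QRCoord n).comp (G q)).det| *
        F (qrMap q) = ENNReal.ofReal (cayleyWeight q.1) *
          (ENNReal.ofReal ((∏ i, q.2.1 i) ^ (2 * n) * ∏ i, (q.2.1 i)⁻¹) *
            ENNReal.ofReal (Real.exp (-((∑ i, q.2.1 i ^ 2) +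
              ∑ p : StrictPairs n, q.2.1 p.1.1 ^ 2 * ‖q.2.2 p‖ ^ 2)))) := by
    intro q hq
    rw [abs_det_qrMap hq.2.1 (hG' q), ENNReal.ofReal_mul (cayleyWeight_pos _).le, mul_assoc]
    simp only [F, one_mul]
    rw [qrMap, sum_norm_sq_mul_unitary _ (cayleyUnitary_mul_conjTranspose _), sum_norm_sq_upTri]
  rw [setLIntegral_congr_fun (hBm.prod hSm) h2] at h1
  have hw : Measurable fun b : SkewCoord n => ENNReal.ofReal (cayleyWeight b) :=
    (ENNReal.continuous_ofReal.comp continuous_cayleyWeight).measurable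
  have hg1 : Measurable fun p : (Fin n → ℝ) × (StrictPairs n → ℂ) =>
      ENNReal.ofReal ((∏ i, p.1 i) ^ (2 * n) * ∏ i, (p.1 i)⁻¹) :=
    ((((Finset.measurable_prod _ fun i _ => measurable_pi_apply i).pow_const _).mul
      (Finset.measurable_prod _ fun i _ => (measurable_pi_apply i).inv)).ennreal_ofReal).comp
      measurable_fst
  have hg2 : Measurable fun p : (Fin n → ℝ) × (StrictPairs n → ℂ) => ENNReal.ofReal
      (Real.exp (-((∑ i, p.1 i ^ 2) + ∑ q : StrictPairs n, p.1 q.1.1 ^ 2 * ‖p.2 q‖ ^ 2))) := by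
    refine (ENNReal.continuous_ofReal.comp ?_).measurable
    fun_prop
  have h3 := lintegral_prod_mul (μ := volume.restrict B) (ν := volume.restrict S) hw.aemeasurable
    (hg1.mul hg2).aemeasurable
  rw [Measure.prod_restrict] at h3
  have h4 := h1.trans h3
  simp only [Pi.mul_apply] at h4
  rw [hS, lintegral_upTri_gaussian] at h4
  simp only [div_one, Finset.prod_const, Finset.card_univ, Fintype.card_prod,
    Fintype.card_fin] at h4
  have hfac : 0 < ∏ i : Fin n, ((i : ℕ).factorial : ℝ) :=
    Finset.prod_pos fun i _ => by positivity
  have hfac' : ∏ i : Fin n, ((i : ℕ).factorial : ℝ) / 2 =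
      (∏ i : Fin n, ((i : ℕ).factorial : ℝ)) / 2 ^ n := by
    rw [Finset.prod_div_distrib]
    simp
  have hpi := Real.pi_pos
  have hc : (0 : ℝ) < Real.pi ^ (n * (n - 1) / 2) * ∏ i : Fin n, ((i : ℕ).factorial : ℝ) / 2 := by
    rw [hfac']
    positivity
  refine (ENNReal.mul_left_inj (ENNReal.ofReal_pos.2 hc).ne' ENNReal.ofReal_ne_top).1
    (h4.symm.trans ?_)
  rw [mul_right_comm, ← ENNReal.ofReal_mul (by positivity)]
  congr 2
  have hexp : n * n = n * (n + 1) / 2 + n * (n - 1) / 2 := by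
    rcases n with - | n
    · rfl
    · rw [Nat.add_sub_cancel, ← Nat.add_div_of_dvd_right (Nat.even_mul_succ_self (n + 1)).two_dvd]
      rw [show (n + 1) * (n + 1 + 1) + (n + 1) * n = (n + 1) * (n + 1) * 2 by ring,
        Nat.mul_div_cancel _ two_pos]
  rw [hfac', hexp, pow_add]
  field_simp

end CayleyHaar

/-! ### The Autonne–Takagi factorization -/

section Takagi

variable {n : ℕ}

open scoped Matrix.Norms.Operator in
/-- The first-order condition at a maximum of `Re tr (Λ u W uᵀ)` over the unitary matrices `u`,
attained at `u = 1`. -/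
theorem isHermitian_mul_of_forall_trace_le {W Λ : Matrix (Fin n) (Fin n) ℂ} (hW : W.IsSymm)
    (hΛ : Λ.IsSymm)
    (hmax : ∀ u : Matrix (Fin n) (Fin n) ℂ, u * uᴴ = 1 →
      (Λ * (u * W * uᵀ)).trace.re ≤ (Λ * W).trace.re) : (W * Λ).IsHermitian := by
  -- the derivative along the Cayley chart at the identity vanishes
  have hskew (b : SkewCoord n) : (skewMat b * (W * Λ)).trace.re = 0 := by
    obtain ⟨G, hG, hG'⟩ := exists_hasFDerivAt_cayleyUnitary (0 : SkewCoord n)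
    have hc0 : cayleyUnitary (0 : SkewCoord n) = 1 := by simp [cayleyUnitary]
    have hGb : G b = (2 : ℝ) • skewMat b := by
      refine (hG' b).trans ?_
      rw [hc0, skewMat_cayleyDeriv, map_zero, add_zero, sub_zero, inv_one, Matrix.one_mul,
        Matrix.one_mul, Matrix.mul_one]
    let L1 : Matrix (Fin n) (Fin n) ℂ →ₗ[ℝ] Matrix (Fin n) (Fin n) ℂ :=
      { toFun := fun M => M * W
        map_add' := fun M N => Matrix.add_mul M N W
        map_smul' := fun c M => Matrix.smul_mul c M W }
    let L3 : Matrix (Fin n) (Fin n) ℂ →ₗ[ℝ] ℝ :=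
      { toFun := fun M => (Λ * M).trace.re
        map_add' := fun M N => by rw [Matrix.mul_add, Matrix.trace_add, Complex.add_re]
        map_smul' := fun c M => by
          rw [Matrix.mul_smul, Matrix.trace_smul, Complex.real_smul, Complex.re_ofReal_mul]
          rfl }
    obtain ⟨G1, hG1, hG1'⟩ := hasFDerivAt_linear_comp L1 hG
    obtain ⟨G2, hG2, hG2'⟩ := exists_hasFDerivAt_matrix_transpose hG
    obtain ⟨G3, hG3, hG3'⟩ := exists_hasFDerivAt_matrix_mul hG1 hG2
    obtain ⟨G4, hG4, hG4'⟩ := hasFDerivAt_linear_comp L3 hG3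
    have hloc : IsLocalMax
        (fun b : SkewCoord n => L3 (L1 (cayleyUnitary b) * (cayleyUnitary b)ᵀ)) 0 :=
        Filter.Eventually.of_forall fun b => by
      refine (hmax _ (cayleyUnitary_mul_conjTranspose b)).trans (le_of_eq ?_)
      change _ = (Λ * (cayleyUnitary 0 * W * (cayleyUnitary 0)ᵀ)).trace.re
      rw [hc0, Matrix.transpose_one, Matrix.one_mul, Matrix.mul_one]
    have h0 : G4 b = 0 := by rw [hloc.hasFDerivAt_eq_zero hG4]; rfl
    have h1 : G4 b = (Λ * ((2 : ℝ) • skewMat b * W * 1 + W * ((2 : ℝ) • skewMat b)ᵀ)).trace.re := by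
      refine (hG4' b).trans (congrArg L3 ((hG3' b).trans ?_))
      refine (congrArg₂ (fun M N => M * (cayleyUnitary 0)ᵀ + L1 (cayleyUnitary 0) * N)
        ((hG1' b).trans (congrArg L1 hGb))
        ((hG2' b).trans (congrArg Matrix.transpose hGb))).trans ?_
      rw [hc0]
      change _ * (1 : Matrix (Fin n) (Fin n) ℂ)ᵀ + (1 * W) * _ = _
      rw [Matrix.transpose_one, Matrix.one_mul]
      rfl
    have h2 : (Λ * (W * (skewMat b)ᵀ)).trace = (skewMat b * (W * Λ)).trace := by
      rw [← Matrix.trace_transpose, Matrix.transpose_mul, Matrix.transpose_mul,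
        Matrix.transpose_transpose, hW.eq, hΛ.eq, Matrix.mul_assoc]
    have h3 : (Λ * (skewMat b * W)).trace = (skewMat b * (W * Λ)).trace := by
      rw [Matrix.trace_mul_comm, Matrix.mul_assoc]
    rw [h0, Matrix.mul_one, Matrix.transpose_smul, Matrix.smul_mul, Matrix.mul_smul,
      ← smul_add, Matrix.mul_smul, Matrix.trace_smul, Matrix.mul_add, Matrix.trace_add, h2, h3,
      Complex.real_smul, Complex.re_ofReal_mul, Complex.add_re] at h1
    linarith
  -- the real trace form is non-degenerate on skew-Hermitian matrices: test against `N - Nᴴ` itself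
  set N := W * Λ with hN
  set D := N - Nᴴ with hD
  have hDH : Dᴴ = -D := by
    rw [hD, Matrix.conjTranspose_sub, Matrix.conjTranspose_conjTranspose, neg_sub]
  have h1 := hskew (skewEntries D)
  rw [skewMat_skewEntries hDH] at h1
  have h2 : (D * Dᴴ).trace.re = 0 := by
    have h3 : (D * Nᴴ).trace.re = -(D * N).trace.re := by
      have h4 : D * Nᴴ = (N * Dᴴ)ᴴ := by
        rw [Matrix.conjTranspose_mul N Dᴴ, Matrix.conjTranspose_conjTranspose]
      rw [h4, Matrix.trace_conjTranspose, hDH, Matrix.mul_neg, Matrix.trace_neg,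
        Matrix.trace_mul_comm]
      simp
    have h5 : D * Dᴴ = D * Nᴴ - D * N := by
      rw [hDH, Matrix.mul_neg, ← Matrix.mul_sub, hD, ← Matrix.mul_neg, neg_sub]
    rw [h5, Matrix.trace_sub, Complex.sub_re, h3, h1]
    simp
  have h6 : D = 0 := by
    have h7 : (D * Dᴴ).trace.re = ∑ i, ∑ j, ‖D i j‖ ^ 2 := by
      simp only [Matrix.trace, Matrix.diag, Matrix.mul_apply, Matrix.conjTranspose_apply,
        Complex.re_sum, Complex.star_def, Complex.mul_conj', ← Complex.ofReal_pow,
        Complex.ofReal_re]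
    rw [h7] at h2
    ext i j
    have h8 := (Finset.sum_eq_zero_iff_of_nonneg fun i _ =>
      Finset.sum_nonneg fun j _ => sq_nonneg ‖D i j‖).1 h2 i (Finset.mem_univ i)
    have h9 := (Finset.sum_eq_zero_iff_of_nonneg fun j _ => sq_nonneg ‖D i j‖).1 h8 j
      (Finset.mem_univ j)
    simpa using h9
  exact (sub_eq_zero.1 h6).symm

/-- The Autonne–Takagi factorization, with non-positive entries in increasing order. For a diagonal
`Λ` with distinct negative entries, a maximizer of `Re tr (Λ u W uᵀ)` over the unitary group makes
`u W uᵀ` real and diagonal, and comparison with permutations and with multiplication of one basis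
vector by the imaginary unit gives the order and the signs. -/
theorem exists_takagi {W : Matrix (Fin n) (Fin n) ℂ} (hW : W.IsSymm) :
    ∃ (k : maxCompact n) (s : Fin n → ℝ), Monotone s ∧ (∀ i, s i ≤ 0) ∧
      W = unitaryPart (k : Sp n) * Matrix.diagonal (fun i => (s i : ℂ)) *
        (unitaryPart (k : Sp n))ᵀ := by
  -- any distinct negative weights would do; increasing ones make the entries increase
  let l : Fin n → ℝ := fun i => (i : ℝ) - n
  have hl (i : Fin n) : l i < 0 := sub_neg.2 (by exact_mod_cast i.2)
  set Λ : Matrix (Fin n) (Fin n) ℂ := Matrix.diagonal fun i => (l i : ℂ) with hΛdef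
  have hΛ : Λ.IsSymm := Matrix.diagonal_transpose _
  have hcont : Continuous fun k : maxCompact n =>
      (Λ * (unitaryPart (k : Sp n) * W * (unitaryPart (k : Sp n))ᵀ)).trace.re :=
    Complex.continuous_re.comp (Continuous.matrix_trace (continuous_const.matrix_mul
      ((continuous_unitaryPart.matrix_mul continuous_const).matrix_mul
        continuous_unitaryPart.matrix_transpose)))
  obtain ⟨k, -, hk⟩ := isCompact_univ.exists_isMaxOn ⟨1, trivial⟩ hcont.continuousOn
  set u := unitaryPart (k : Sp n) with hu
  have huu : u * uᴴ = 1 := unitaryPart_mul_conjTranspose k.2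
  have huu' : uᴴ * u = 1 := by rw [mul_eq_one_comm, huu]
  set W' := u * W * uᵀ with hW'
  have hW's : W'.IsSymm := by
    rw [Matrix.IsSymm, hW', Matrix.transpose_mul, Matrix.transpose_mul, Matrix.transpose_transpose,
      hW.eq, Matrix.mul_assoc]
  have hmax (v : Matrix (Fin n) (Fin n) ℂ) (hv : v * vᴴ = 1) :
      (Λ * (v * W' * vᵀ)).trace.re ≤ (Λ * W').trace.re := by
    have h := hk (Set.mem_univ (ofUnitary v hv * k))
    simp only [Set.mem_ofPred_eq, Subgroup.coe_mul, unitaryPart_mul _ k.2,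
      unitaryPart_ofUnitary] at h
    rw [hW']
    simpa only [Matrix.transpose_mul, Matrix.mul_assoc] using h
  have hherm := isHermitian_mul_of_forall_trace_le hW's hΛ hmax
  -- comparing absolute values of these entries, distinct weights leave only the diagonal
  have hentry (i j : Fin n) : star (W' i j) * l i = W' i j * l j := by
    have h := congrFun (congrFun hherm i) j
    rw [Matrix.conjTranspose_apply, hΛdef, Matrix.mul_diagonal, Matrix.mul_diagonal,
      hW's.apply i j] at h
    simpa using h
  have hdiag : W' = Matrix.diagonal fun i => (((W' i i).re : ℝ) : ℂ) := by
    ext i j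
    by_cases hij : i = j
    · subst hij
      have h := mul_right_cancel₀ (Complex.ofReal_ne_zero.2 (hl i).ne) (hentry i i)
      rw [Matrix.diagonal_apply_eq]
      exact (Complex.conj_eq_iff_re.1 h).symm
    · rw [Matrix.diagonal_apply_ne _ hij]
      by_contra hne
      have h := congrArg norm (hentry i j)
      rw [norm_mul, norm_mul, norm_star, Complex.norm_real, Complex.norm_real] at h
      have h2 := mul_left_cancel₀ (norm_ne_zero_iff.2 hne) h
      rw [Real.norm_eq_abs, Real.norm_eq_abs, abs_of_neg (hl i), abs_of_neg (hl j), neg_inj] at h2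
      refine hij (Fin.ext ?_)
      have h3 : (i : ℝ) = j := by linarith
      exact_mod_cast h3
  set s : Fin n → ℝ := fun i => (W' i i).re with hs
  have htr (t : Fin n → ℝ) :
      (Λ * Matrix.diagonal fun i => (t i : ℂ)).trace.re = ∑ i, l i * t i := by
    rw [hΛdef, Matrix.diagonal_mul_diagonal, Matrix.trace_diagonal, Complex.re_sum]
    simp
  have hmax' (v : Matrix (Fin n) (Fin n) ℂ) (hv : v * vᴴ = 1) (t : Fin n → ℝ)
      (ht : v * Matrix.diagonal (fun i => (s i : ℂ)) * vᵀ = Matrix.diagonal fun i => (t i : ℂ)) :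
      ∑ i, l i * t i ≤ ∑ i, l i * s i := by
    have h := hmax v hv
    rwa [hdiag, ht, htr, htr] at h
  refine ⟨k⁻¹, s, ?_, ?_, ?_⟩
  · intro i j hij
    rcases hij.eq_or_lt with rfl | hij
    · exact le_rfl
    -- exchanging two entries in the wrong order would increase the trace
    have h := hmax' ((1 : Matrix (Fin n) (Fin n) ℂ).submatrix (Equiv.swap i j) id) (by
        ext a b
        simp [Matrix.mul_apply, Matrix.one_apply]) (s ∘ Equiv.swap i j) (by
        ext a b
        by_cases hab : a = b <;>
          simp [Matrix.mul_apply, Matrix.one_apply, Matrix.diagonal_apply, hab])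
    rw [← sub_nonneg, ← Finset.sum_sub_distrib, Finset.sum_eq_add i j hij.ne
      (fun c _ hc => by simp [Equiv.swap_apply_of_ne_of_ne hc.1 hc.2]) (by simp) (by simp)] at h
    simp only [Function.comp_apply, Equiv.swap_apply_left, Equiv.swap_apply_right] at h
    have h2 : l i < l j := by
      have : (i : ℝ) < j := by exact_mod_cast hij
      simp only [l]
      linarith
    nlinarith
  · intro i
    -- multiplying the `i`-th basis vector by the imaginary unit changes the sign of one entry
    have h := hmax' (Matrix.diagonal fun j => if j = i then Complex.I else 1) (by
        rw [Matrix.diagonal_conjTranspose, Matrix.diagonal_mul_diagonal, ← Matrix.diagonal_one]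
        congr 1
        ext j
        by_cases hj : j = i <;> simp [hj]) (fun j => if j = i then -s j else s j) (by
        rw [Matrix.diagonal_transpose, Matrix.diagonal_mul_diagonal, Matrix.diagonal_mul_diagonal]
        congr 1
        ext j
        by_cases hj : j = i
        · simp only [hj, if_true, Complex.ofReal_neg]
          linear_combination (s i : ℂ) * Complex.I_mul_I
        · simp [hj])
    rw [← sub_nonneg, ← Finset.sum_sub_distrib, Finset.sum_eq_single i
      (fun c _ hc => by simp [hc]) (by simp)] at h
    simp only [if_true] at h
    nlinarith [hl i]
  · have h1 : unitaryPart ((k⁻¹ : maxCompact n) : Sp n) = uᴴ := by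
      have h2 : unitaryPart ((k⁻¹ : maxCompact n) : Sp n) * u = 1 := by
        rw [hu, ← unitaryPart_mul _ k.2, ← Subgroup.coe_mul, inv_mul_cancel, Subgroup.coe_one,
          unitaryPart_one]
      calc _ = unitaryPart ((k⁻¹ : maxCompact n) : Sp n) * (u * uᴴ) := by rw [huu, Matrix.mul_one]
        _ = uᴴ := by rw [← Matrix.mul_assoc, h2, Matrix.one_mul]
    have h2 : uᵀ * uᴴᵀ = 1 := by rw [← Matrix.transpose_mul, huu', Matrix.transpose_one]
    rw [h1, ← hdiag, hW', Matrix.mul_assoc, Matrix.mul_assoc, Matrix.mul_assoc, h2, Matrix.mul_one,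
      ← Matrix.mul_assoc, huu', Matrix.one_mul]

/-- The Takagi factorization is unique up to signs if the singular values are distinct and
non-zero. -/
theorem takagi_unique {s s' : Fin n → ℝ} (hs : StrictMono s) (hs' : StrictMono s')
    (h0 : ∀ i, s i < 0) (h0' : ∀ i, s' i < 0) {u : Matrix (Fin n) (Fin n) ℂ} (hu : u * uᴴ = 1)
    (h : u * Matrix.diagonal (fun i => (s i : ℂ)) * uᵀ = Matrix.diagonal fun i => (s' i : ℂ)) :
    s = s' ∧ ∃ ε : Fin n → ℤˣ, u = Matrix.diagonal fun i => ((ε i : ℤ) : ℂ) := by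
  have hu' : uᴴ * u = 1 := by rw [mul_eq_one_comm, hu]
  have hut : uᵀ * uᵀᴴ = 1 := by
    have h1 : (uᴴ * u)ᵀ = 1 := by rw [hu', Matrix.transpose_one]
    rw [Matrix.transpose_mul] at h1
    exact h1
  have hreal (t : Fin n → ℝ) : (Matrix.diagonal fun i => (t i : ℂ))ᴴ =
      Matrix.diagonal fun i => (t i : ℂ) := by
    rw [Matrix.diagonal_conjTranspose]
    congr 1
    ext i
    simp
  -- `u` intertwines the diagonal matrices of the squares, which are distinct
  have h1 : Matrix.diagonal (fun i => ((s' i ^ 2 : ℝ) : ℂ)) * u =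
      u * Matrix.diagonal fun i => ((s i ^ 2 : ℝ) : ℂ) := by
    have hsq (t : Fin n → ℝ) : (Matrix.diagonal fun i => ((t i ^ 2 : ℝ) : ℂ)) =
        (Matrix.diagonal fun i => (t i : ℂ)) * (Matrix.diagonal fun i => (t i : ℂ))ᴴ := by
      rw [hreal, Matrix.diagonal_mul_diagonal]
      congr 1
      ext i
      push_cast
      ring
    rw [hsq s', ← h, hsq s, Matrix.conjTranspose_mul, Matrix.conjTranspose_mul]
    simp only [Matrix.mul_assoc]
    rw [hu', Matrix.mul_one,
      ← Matrix.mul_assoc uᵀ, hut, Matrix.one_mul]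
  have h2 (i j : Fin n) (hij : u i j ≠ 0) : s' i = s j := by
    have h3 := congrFun (congrFun h1 i) j
    rw [Matrix.diagonal_mul, Matrix.mul_diagonal, mul_comm] at h3
    have h4 : s' i ^ 2 = s j ^ 2 := by exact_mod_cast mul_left_cancel₀ hij h3
    have := h0 j
    have := h0' i
    nlinarith
  have h3 (i : Fin n) : ∃ j, u i j ≠ 0 := by
    by_contra! hc
    have := congrFun (congrFun hu i) i
    rw [Matrix.mul_apply] at this
    simp [hc] at this
  choose φ hφ using h3
  have h4 (i : Fin n) : s' i = s (φ i) := h2 i _ (hφ i)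
  have h5 : Function.Injective φ := fun i j hij => hs'.injective (by rw [h4, h4, hij])
  have h6 : s = s' := by
    refine (hs.range_inj hs').1 ?_
    rw [show s' = s ∘ φ from funext h4, (Finite.injective_iff_surjective.1 h5).range_comp]
  subst h6
  refine ⟨rfl, ?_⟩
  have h7 (i j : Fin n) (hij : i ≠ j) : u i j = 0 := by
    by_contra hne
    exact hij (hs.injective (h2 i j hne))
  have h8 : u = Matrix.diagonal fun i => u i i := by
    ext i j
    by_cases hij : i = j
    · subst hij; simp
    · rw [h7 i j hij, Matrix.diagonal_apply_ne _ hij]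
  have h9 (i : Fin n) : ∃ ε : ℤˣ, u i i = ((ε : ℤ) : ℂ) := by
    rw [h8, Matrix.diagonal_transpose, Matrix.diagonal_mul_diagonal,
      Matrix.diagonal_mul_diagonal] at h
    have h10 := congrFun (Matrix.diagonal_injective h) i
    have h11 : (s i : ℂ) ≠ 0 := Complex.ofReal_ne_zero.2 (h0 i).ne
    have h12 : u i i * u i i = 1 := by
      refine mul_right_cancel₀ h11 ?_
      linear_combination h10
    rcases mul_self_eq_one_iff.1 h12 with h | h
    · exact ⟨1, by simp [h]⟩
    · exact ⟨-1, by simp [h]⟩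
  choose ε hε using h9
  exact ⟨ε, h8.trans (congrArg _ (funext hε))⟩

end Takagi

/-! ### The Takagi factorization as a change of variables -/

section TakagiJacobian

variable {n : ℕ}

/-- Coordinates for the factorization `u * diag (tanh a) * uᵀ` of a complex symmetric matrix. -/
abbrev TakagiCoord (n : ℕ) : Type := SkewCoord n × (Fin n → ℝ)

/-- The diagonal matrix with entries `tanh aᵢ`. -/
noncomputable def tanhDiag (a : Fin n → ℝ) : Matrix (Fin n) (Fin n) ℂ :=
  Matrix.diagonal fun i => (Real.tanh (a i) : ℂ)

/-- The symmetric matrix `c * diag (tanh a) * cᵀ`, with `c` the Cayley transform of `b`. -/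
noncomputable def takagiMat (q : TakagiCoord n) : Matrix (Fin n) (Fin n) ℂ :=
  cayleyUnitary q.1 * tanhDiag q.2 * (cayleyUnitary q.1)ᵀ

theorem takagiMat_isSymm (q : TakagiCoord n) : (takagiMat q).IsSymm := by
  rw [Matrix.IsSymm, takagiMat, Matrix.transpose_mul, Matrix.transpose_mul,
    Matrix.transpose_transpose, tanhDiag, Matrix.diagonal_transpose, Matrix.mul_assoc]

/-- The identification of the coordinate spaces that matches the skew-Hermitian part with the
entries above the diagonal and the imaginary parts of the diagonal entries. -/
noncomputable def takagiEquiv (n : ℕ) : TakagiCoord n ≃ᵐ (UpperPairs n → ℂ) :=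
  (MeasurableEquiv.prodAssoc.trans (((MeasurableEquiv.refl (StrictPairs n → ℂ)).prodCongr
    (MeasurableEquiv.prodComm.trans (reImEquiv (Fin n)))))).trans (glueEquiv ℂ (upperIndexEquiv n))

theorem takagiEquiv_apply (q : TakagiCoord n) :
    takagiEquiv n q =
      glueEquiv ℂ (upperIndexEquiv n) (q.1.1, reImEquiv (Fin n) (q.2, q.1.2)) := rfl

theorem measurePreserving_takagiEquiv : MeasurePreserving (takagiEquiv n) := by
  have h1 : MeasurePreserving (MeasurableEquiv.prodComm.trans (reImEquiv (Fin n))) :=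
    (measurePreserving_reImEquiv _).comp Measure.measurePreserving_swap
  exact (measurePreserving_glueEquiv (R := ℂ) (upperIndexEquiv n)).comp
    (((MeasurePreserving.id (volume : Measure (StrictPairs n → ℂ))).prod h1).comp
      volume_preserving_prodAssoc)

/-- The linear equivalence underlying `takagiEquiv`. -/
noncomputable def takagiLinear (n : ℕ) : TakagiCoord n ≃L[ℝ] (UpperPairs n → ℂ) :=
  (takagiEquiv n).toContinuousLinearEquiv
    (fun x y => by
      rw [takagiEquiv_apply]
      exact glueEquiv_add _ (x.1.1, reImEquiv (Fin n) (x.2, x.1.2))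
        (y.1.1, reImEquiv (Fin n) (y.2, y.1.2)))
    (fun c x => by
      have h : reImEquiv (Fin n) ((c • x).2, (c • x).1.2) = c • reImEquiv (Fin n) (x.2, x.1.2) := by
        ext i
        rw [Pi.smul_apply, reImEquiv_apply, reImEquiv_apply]
        apply Complex.ext <;> simp
      rw [takagiEquiv_apply, h]
      exact glueEquiv_smul _ c (x.1.1, reImEquiv (Fin n) (x.2, x.1.2)))

theorem measurePreserving_takagiLinear : MeasurePreserving (takagiLinear n) :=
  measurePreserving_takagiEquiv

theorem Real.hasDerivAt_tanh (x : ℝ) : HasDerivAt Real.tanh (1 - Real.tanh x ^ 2) x := by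
  have h := (Real.hasDerivAt_sinh x).div (Real.hasDerivAt_cosh x) (Real.cosh_pos x).ne'
  have h1 : Real.tanh = fun x => Real.sinh x / Real.cosh x := funext Real.tanh_eq_sinh_div_cosh
  rw [h1]
  refine h.congr_deriv ?_
  have := (Real.cosh_pos x).ne'
  field_simp

/-- The derivative of `tanhDiag`. -/
noncomputable def tanhDiagDeriv (a : Fin n → ℝ) : (Fin n → ℝ) →ₗ[ℝ] Matrix (Fin n) (Fin n) ℂ where
  toFun h := Matrix.diagonal fun i => (((1 - Real.tanh (a i) ^ 2) * h i : ℝ) : ℂ)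
  map_add' h h' := by
    rw [Matrix.diagonal_add]
    congr 1
    ext i
    push_cast [Pi.add_apply]
    ring
  map_smul' c h := by
    rw [← Matrix.diagonal_smul]
    congr 1
    ext i
    simp only [Pi.smul_apply, smul_eq_mul, RingHom.id_apply, Complex.real_smul]
    push_cast
    ring

open scoped Matrix.Norms.Operator in
theorem hasFDerivAt_tanhDiag (a : Fin n → ℝ) :
    HasFDerivAt tanhDiag (tanhDiagDeriv a).toContinuousLinearMap a := by
  let D : (Fin n → ℝ) →ₗ[ℝ] Matrix (Fin n) (Fin n) ℂ :=
    { toFun := fun v => Matrix.diagonal fun i => (v i : ℂ)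
      map_add' := fun v w => by
        rw [Matrix.diagonal_add]
        congr 1
        ext i
        simp
      map_smul' := fun c v => by
        rw [← Matrix.diagonal_smul]
        congr 1
        ext i
        simp }
  have h1 : HasFDerivAt (fun a : Fin n → ℝ => fun i => Real.tanh (a i))
      (ContinuousLinearMap.pi fun i =>
        (1 - Real.tanh (a i) ^ 2) • ContinuousLinearMap.proj (R := ℝ) (φ := fun _ => ℝ) i) a :=
    hasFDerivAt_pi.2 fun i => HasDerivAt.comp_hasFDerivAt (f := fun a : Fin n → ℝ => a i) a
      (Real.hasDerivAt_tanh (a i)) (hasFDerivAt_apply i a)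
  exact D.toContinuousLinearMap.hasFDerivAt.comp a h1

open scoped Matrix.Norms.Operator in
/-- The differential of `c S cᵀ`, with `S = diag (tanh a)`, is the congruence by `c` of `(c⁻¹ dc) S
+ dS + S (c⁻¹ dc)ᵀ`. -/
theorem exists_hasFDerivAt_takagiMat (q : TakagiCoord n) :
    ∃ G : TakagiCoord n →L[ℝ] (UpperPairs n → ℂ),
      HasFDerivAt (fun q : TakagiCoord n => upperEntries (takagiMat q)) G q ∧
      ∀ h, G h = upperEntries (cayleyUnitary q.1 *
        (skewMat (cayleyDeriv q.1 h.1) * tanhDiag q.2 + tanhDiagDeriv q.2 h.2 +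
          tanhDiag q.2 * (skewMat (cayleyDeriv q.1 h.1))ᵀ) * (cayleyUnitary q.1)ᵀ) := by
  obtain ⟨G0, hG0, hG0'⟩ := exists_hasFDerivAt_cayleyUnitary q.1
  have hc : HasFDerivAt (fun q : TakagiCoord n => cayleyUnitary q.1)
      (G0.comp (ContinuousLinearMap.fst ℝ _ _)) q :=
    HasFDerivAt.comp (g := cayleyUnitary) q hG0 hasFDerivAt_fst
  have ht : HasFDerivAt (fun q : TakagiCoord n => tanhDiag q.2)
      ((tanhDiagDeriv q.2).toContinuousLinearMap.comp (ContinuousLinearMap.snd ℝ _ _)) q :=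
    HasFDerivAt.comp (g := tanhDiag) q (hasFDerivAt_tanhDiag q.2) hasFDerivAt_snd
  let upL : Matrix (Fin n) (Fin n) ℂ →ₗ[ℝ] (UpperPairs n → ℂ) :=
    { toFun := upperEntries, map_add' := fun _ _ => rfl, map_smul' := fun _ _ => rfl }
  obtain ⟨G1, hG1, hG1'⟩ := exists_hasFDerivAt_matrix_mul hc ht
  obtain ⟨G2, hG2, hG2'⟩ := exists_hasFDerivAt_matrix_transpose hc
  obtain ⟨G3, hG3, hG3'⟩ := exists_hasFDerivAt_matrix_mul hG1 hG2
  obtain ⟨G4, hG4, hG4'⟩ := hasFDerivAt_linear_comp upL hG3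
  refine ⟨G4, hG4, fun h => ?_⟩
  refine (hG4' h).trans (congrArg upperEntries ((hG3' h).trans ?_))
  refine (congrArg₂ (fun M N => M * (cayleyUnitary q.1)ᵀ +
    cayleyUnitary q.1 * tanhDiag q.2 * N) ((hG1' h).trans
      (congrArg (fun M => M * tanhDiag q.2 + cayleyUnitary q.1 * tanhDiagDeriv q.2 h.2)
        (hG0' h.1))) ((hG2' h).trans (congrArg Matrix.transpose (hG0' h.1)))).trans ?_
  rw [Matrix.transpose_mul]
  simp only [Matrix.mul_add, Matrix.add_mul, Matrix.mul_assoc]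

/-- The Jacobian of the Takagi factorization. -/
noncomputable def takagiWeight (a : Fin n → ℝ) : ℝ :=
  (∏ p : StrictPairs n, |Real.tanh (a p.1.2) ^ 2 - Real.tanh (a p.1.1) ^ 2|) *
    ∏ i, (2 * |Real.tanh (a i)| * (1 - Real.tanh (a i) ^ 2))

/-- The map multiplies `1` by `t - s` and the imaginary unit by `-(t + s)`. -/
theorem Complex.det_mul_conj_sub_mul (s t : ℝ) (f : ℂ →ₗ[ℝ] ℂ)
    (hf : ∀ z, f z = t * star z - s * z) : LinearMap.det f = -(t ^ 2 - s ^ 2) := by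
  rw [← LinearMap.det_toMatrix Complex.basisOneI, Matrix.det_fin_two]
  simp [LinearMap.toMatrix_apply, hf]
  ring

/-- With `Ξ = c⁻¹ dc` and `S = diag (tanh a)`, the differential is the congruence by the unitary
matrix `c`, of absolute determinant one, of `Ξ S + dS + S Ξᵀ`. An entry of this matrix above the
diagonal has the form `t * conj z - s * z` with `z` a coordinate of `Ξ`; a diagonal entry has the
entry of `dS` as real part and a multiple of a coordinate of `Ξ`, by `2 * tanh aᵢ` up to sign, as
imaginary part. -/
theorem abs_det_takagiMat {q : TakagiCoord n} {G : TakagiCoord n →L[ℝ] (UpperPairs n → ℂ)}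
    (hG : ∀ h, G h = upperEntries (cayleyUnitary q.1 *
        (skewMat (cayleyDeriv q.1 h.1) * tanhDiag q.2 + tanhDiagDeriv q.2 h.2 +
          tanhDiag q.2 * (skewMat (cayleyDeriv q.1 h.1))ᵀ) * (cayleyUnitary q.1)ᵀ)) :
    |(((takagiLinear n).symm : (UpperPairs n → ℂ) →L[ℝ] TakagiCoord n).comp G).det| =
      cayleyWeight q.1 * takagiWeight q.2 := by
  obtain ⟨b, a⟩ := q
  simp only at hG ⊢
  let f (p : StrictPairs n) : ℂ →ₗ[ℝ] ℂ :=
    { toFun := fun z => Real.tanh (a p.1.2) * star z - Real.tanh (a p.1.1) * z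
      map_add' := fun z w => by rw [star_add]; ring
      map_smul' := fun c z => by
        simp only [Complex.real_smul, Complex.star_def, map_mul, Complex.conj_ofReal,
          RingHom.id_apply]
        ring }
  let P : (StrictPairs n → ℂ) →ₗ[ℝ] (StrictPairs n → ℂ) :=
    LinearMap.pi fun p => f p ∘ₗ LinearMap.proj p
  let d (c : Fin n → ℝ) : (Fin n → ℝ) →ₗ[ℝ] (Fin n → ℝ) :=
    LinearMap.pi fun i => c i • LinearMap.proj i
  let T : TakagiCoord n →ₗ[ℝ] TakagiCoord n :=
    (P.prodMap (d fun i => -(2 * Real.tanh (a i)))).prodMap (d fun i => 1 - Real.tanh (a i) ^ 2)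
  let L : TakagiCoord n ≃ₗ[ℝ] (UpperPairs n → ℂ) := (takagiLinear n).toLinearEquiv
  have hfac : (G : TakagiCoord n →ₗ[ℝ] (UpperPairs n → ℂ)) =
      (congrSym (cayleyUnitary b)).restrictScalars ℝ ∘ₗ L.toLinearMap ∘ₗ
        (T ∘ₗ (cayleyDeriv b).prodMap LinearMap.id) := by
    refine LinearMap.ext fun h => (hG h).trans ?_
    set Ξ := cayleyDeriv b h.1 with hΞ
    set M := skewMat Ξ * tanhDiag a + tanhDiagDeriv a h.2 + tanhDiag a * (skewMat Ξ)ᵀ with hM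
    have hMs : M.IsSymm := by
      have h1 : (tanhDiagDeriv a h.2)ᵀ = tanhDiagDeriv a h.2 := Matrix.diagonal_transpose _
      have h2 : (tanhDiag a)ᵀ = tanhDiag a := Matrix.diagonal_transpose _
      rw [Matrix.IsSymm, hM, Matrix.transpose_add, Matrix.transpose_add, Matrix.transpose_mul,
        Matrix.transpose_mul, Matrix.transpose_transpose, h1, h2]
      abel
    have hL : L (T (Ξ, h.2)) = upperEntries M := by
      change takagiEquiv n _ = _
      rw [takagiEquiv_apply]
      have hMij (i j : Fin n) : M i j = skewMat Ξ i j * Real.tanh (a j) +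
          tanhDiagDeriv a h.2 i j + Real.tanh (a i) * skewMat Ξ j i := by
        rw [hM, tanhDiag, Matrix.add_apply, Matrix.add_apply, Matrix.mul_diagonal,
          Matrix.diagonal_mul, Matrix.transpose_apply]
      refine glueEquiv_ext _ _ (fun p => ?_) fun i => ?_
      · obtain ⟨⟨i, j⟩, hij⟩ := p
        have hij' : i < j := hij
        change M i j = Real.tanh (a j) * star (Ξ.1 ⟨(i, j), hij⟩) -
          Real.tanh (a i) * Ξ.1 ⟨(i, j), hij⟩
        rw [hMij, skewMat_apply_of_lt _ hij', skewMat_apply_of_gt _ hij', tanhDiagDeriv]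
        change _ + Matrix.diagonal _ i j + _ = _
        rw [Matrix.diagonal_apply_ne _ hij'.ne]
        ring
      · change M i i = ⟨(1 - Real.tanh (a i) ^ 2) * h.2 i, -(2 * Real.tanh (a i)) * Ξ.2 i⟩
        rw [hMij, skewMat_apply_self]
        change _ + Matrix.diagonal _ i i + _ = _
        rw [Matrix.diagonal_apply_eq]
        apply Complex.ext
        · simp [-Complex.ofReal_tanh, -Complex.ofReal_mul, -Complex.ofReal_sub]
        · simp [-Complex.ofReal_tanh, -Complex.ofReal_mul, -Complex.ofReal_sub]
          ring
    change _ = congrSym (cayleyUnitary b) (L (T (Ξ, h.2)))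
    rw [hL]
    change _ = upperEntries (cayleyUnitary b * symMat (upperEntries M) * (cayleyUnitary b)ᵀ)
    rw [symMat_upperEntries hMs]
  have hdet : (((takagiLinear n).symm : (UpperPairs n → ℂ) →L[ℝ] TakagiCoord n).comp G).det =
      LinearMap.det ((L.symm.toLinearMap ∘ₗ
        (congrSym (cayleyUnitary b)).restrictScalars ℝ ∘ₗ L.toLinearMap) ∘ₗ
        (T ∘ₗ (cayleyDeriv b).prodMap LinearMap.id)) := by
    change LinearMap.det (L.symm.toLinearMap ∘ₗ (G : TakagiCoord n →ₗ[ℝ] (UpperPairs n → ℂ))) = _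
    rw [hfac]
    rfl
  have hconj := LinearMap.det_conj ((congrSym (cayleyUnitary b)).restrictScalars ℝ) L.symm
  rw [LinearEquiv.symm_symm] at hconj
  have hu : ‖(cayleyUnitary b).det‖ = 1 :=
    norm_det_of_mul_conjTranspose (cayleyUnitary_mul_conjTranspose b)
  have hP : LinearMap.det P =
      ∏ p : StrictPairs n, -(Real.tanh (a p.1.2) ^ 2 - Real.tanh (a p.1.1) ^ 2) := by
    refine (LinearMap.det_pi f).trans (Finset.prod_congr rfl fun p _ => ?_)
    exact Complex.det_mul_conj_sub_mul _ _ (f p) fun z => rfl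
  have hd (c : Fin n → ℝ) : LinearMap.det (d c) = ∏ i, c i :=
    LinearMap.det_pi_smul c _ fun x i => rfl
  rw [hdet, LinearMap.det_comp, hconj, LinearMap.det_comp, LinearMap.det_prodMap,
    LinearMap.det_prodMap, LinearMap.det_prodMap, LinearMap.det_id, mul_one, hP, hd, hd, abs_mul,
    abs_det_restrictScalars, det_congrSym (norm_ne_zero_iff.1 (hu.trans_ne one_ne_zero)), norm_pow,
    hu, one_pow, one_pow, one_mul, abs_mul, mul_comm, cayleyWeight, takagiWeight, mul_assoc,
    abs_mul, Finset.abs_prod, ← Finset.prod_mul_distrib, Finset.abs_prod]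
  simp only [abs_neg, abs_mul]
  congr 3
  ext i
  rw [abs_two, abs_of_pos (sub_pos.2 (Real.tanh_sq_lt_one (a i)))]

end TakagiJacobian

/-! ### The invariant measure in the disc model -/

section Disc

variable {n : ℕ}

/-- The coordinates of the Cayley transform of `g · i1`. -/
noncomputable def discCoord (g : Sp n) : UpperPairs n → ℂ :=
  upperEntries (cayley (siegelAct g (basePoint n)))

/-- The density `2^{n(n+1)} det(1 - WᴴW)^{-(n+1)}` of the invariant measure in the disc model. -/
noncomputable def discDensity (W : Matrix (Fin n) (Fin n) ℂ) : ℝ :=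
  2 ^ (n * (n + 1)) * ((1 - Wᴴ * W).det.re ^ (n + 1))⁻¹

theorem isUnit_det_cayley_denom {Z : Matrix (Fin n) (Fin n) ℂ} (hZ : Z ∈ siegelUpperHalfSpace n) :
    IsUnit (1 * Z + Complex.I • (1 : Matrix (Fin n) (Fin n) ℂ)).det := by
  obtain ⟨g, rfl⟩ := exists_siegelAct_basePoint_eq hZ
  rw [one_mul, siegelAct_basePoint, ← Matrix.mul_nonsing_inv _ (isUnit_det_denom g),
    ← Matrix.smul_mul, ← Matrix.add_mul, Matrix.det_mul]
  exact (isUnit_det_numer_add g).mul (Matrix.isUnit_nonsing_inv_det _ (isUnit_det_denom g))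

theorem cayley_siegelAct_isSymm (g : Sp n) : (cayley (siegelAct g (basePoint n))).IsSymm :=
  isSimilitude_cayley.mobius_isSymm (siegelAct_basePoint_isSymm g)
    (isUnit_det_cayley_denom (siegelAct_basePoint_mem g))

theorem symMat_discCoord (g : Sp n) : symMat (discCoord g) = cayley (siegelAct g (basePoint n)) :=
  symMat_upperEntries (cayley_siegelAct_isSymm g)

/-- The disc is the quotient of the symplectic group by its maximal compact subgroup. -/
theorem discCoord_eq_iff {g h : Sp n} : discCoord g = discCoord h ↔ g⁻¹ * h ∈ maxCompact n := by
  constructor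
  · intro hgh
    have h1 := congrArg symMat hgh
    rw [symMat_discCoord, symMat_discCoord] at h1
    exact inv_mul_mem_of_siegelAct_eq (isSimilitude_cayley.mobius_injective
      (mul_ne_zero two_ne_zero Complex.I_ne_zero) (siegelAct_basePoint_isSymm h)
      (isUnit_det_cayley_denom (siegelAct_basePoint_mem g))
      (isUnit_det_cayley_denom (siegelAct_basePoint_mem h)) h1)
  · intro hk
    have h1 := siegelAct_mul_of_mem g hk
    rw [mul_inv_cancel_left] at h1
    rw [discCoord, discCoord, h1]

theorem continuous_discCoord : Continuous (discCoord : Sp n → _) := by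
  have h : Continuous fun g : Sp n => cayley (siegelAct g (basePoint n)) := by
    simp only [cayley_siegelAct]
    exact (continuous_numer.sub (continuous_denom.const_smul Complex.I)).matrix_mul
      ((continuous_numer.add (continuous_denom.const_smul Complex.I)).matrix_inv_of_isUnit
        isUnit_det_numer_add)
  exact continuous_pi fun p => (continuous_apply_apply p.1.1 p.1.2).comp h

theorem discDensity_cayley (g : Sp n) :
    discDensity (cayley (siegelAct g (basePoint n))) =
      ‖(numer g + Complex.I • denom g).det‖ ^ (2 * (n + 1)) / 2 ^ (n * (n + 1)) := by
  have hP := norm_ne_zero_iff.2 (isUnit_det_numer_add g).ne_zero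
  rw [discDensity, one_sub_cayley_siegelAct, Matrix.det_smul, Matrix.det_mul,
    Matrix.det_conjTranspose, Matrix.det_nonsing_inv, Ring.inverse_eq_inv', Complex.star_def,
    Complex.conj_mul', norm_inv, Fintype.card_fin,
    show (4 : ℂ) ^ n * ((‖(numer g + Complex.I • denom g).det‖⁻¹ : ℝ) : ℂ) ^ 2 =
      (((4 : ℝ) ^ n * ‖(numer g + Complex.I • denom g).det‖⁻¹ ^ 2 : ℝ) : ℂ) by push_cast; rfl,
    Complex.ofReal_re, mul_pow, ← pow_mul, show (4 : ℝ) = 2 * 2 by norm_num, mul_pow, inv_pow,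
    inv_pow, ← pow_mul, mul_inv, mul_inv, inv_inv]
  field_simp

theorem image_cayley_siegelDomain :
    (fun x => upperEntries (mobius 1 (-Complex.I • 1) 1 (Complex.I • 1) (symMat x))) ''
      siegelDomain n = Set.range (discCoord (n := n)) := by
  ext w
  constructor
  · rintro ⟨x, hx, rfl⟩
    obtain ⟨g, hg⟩ := exists_siegelAct_basePoint_eq hx
    exact ⟨g, by rw [discCoord, hg]; rfl⟩
  · rintro ⟨g, rfl⟩
    have h := symMat_upperEntries (siegelAct_basePoint_isSymm g)
    refine ⟨upperEntries (siegelAct g (basePoint n)), ?_, ?_⟩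
    · rw [siegelDomain, Set.mem_ofPred_eq, h]
      exact siegelAct_basePoint_mem g
    · simp only [h]
      rfl

/-- The integral of a right `K`-invariant function, transported from the upper half space to the
disc by the Cayley transform. -/
theorem lintegral_iwasawaHaar_discCoord {κ : Measure (maxCompact n)} [IsProbabilityMeasure κ]
    {G : (UpperPairs n → ℂ) → ℝ≥0∞} (hG : Measurable fun g => G (discCoord g)) :
    ∫⁻ g, G (discCoord g) ∂(iwasawaHaar κ) =
      ∫⁻ w in Set.range (discCoord (n := n)), G w * ENNReal.ofReal (discDensity (symMat w)) := by
  refine (lintegral_iwasawaHaar_siegelAct (f := fun Z => G (upperEntries (cayley Z))) hG).trans ?_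
  rw [← image_cayley_siegelDomain, isSimilitude_cayley.lintegral_image_mobius
      (mul_ne_zero two_ne_zero Complex.I_ne_zero) measurableSet_siegelDomain
      fun x hx => isUnit_det_cayley_denom hx, siegelIntegral]
  refine setLIntegral_congr_fun measurableSet_siegelDomain fun x hx => ?_
  obtain ⟨g, hg⟩ := exists_siegelAct_basePoint_eq hx
  have hd := norm_ne_zero_iff.2 (isUnit_det_denom g).ne_zero
  have hP := norm_ne_zero_iff.2 (isUnit_det_numer_add g).ne_zero
  have hden : 1 * symMat x + Complex.I • (1 : Matrix (Fin n) (Fin n) ℂ) =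
      (numer g + Complex.I • denom g) * (denom g)⁻¹ := by
    rw [one_mul, ← hg, siegelAct_basePoint, Matrix.add_mul, Matrix.smul_mul,
      Matrix.mul_nonsing_inv _ (isUnit_det_denom g)]
  change G (upperEntries (cayley (symMat x))) * _ =
    _ * (G (upperEntries (cayley (symMat x))) *
      ENNReal.ofReal (discDensity (symMat (upperEntries (cayley (symMat x))))))
  rw [hden, ← hg, symMat_upperEntries (cayley_siegelAct_isSymm g), discDensity_cayley,
    siegelDensity_siegelAct, mul_left_comm, ← ENNReal.ofReal_mul (by positivity)]
  congr 2
  rw [Matrix.det_mul, Matrix.det_nonsing_inv, Ring.inverse_eq_inv', norm_mul, norm_mul, norm_inv,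
    Complex.norm_I, mul_one, Complex.norm_ofNat, mul_pow, mul_inv, inv_pow, inv_inv]
  field_simp

theorem tanh_eq_exp_sub_div (x : ℝ) :
    Real.tanh x = (Real.exp x - Real.exp (-x)) / (Real.exp x + Real.exp (-x)) := by
  rw [Real.tanh_eq_sinh_div_cosh, Real.sinh_eq, Real.cosh_eq, div_div_div_cancel_right₀ two_ne_zero]

/-- The Cayley transform takes the points `exp(H) · i1` to the matrices `diag (tanh a)`. -/
theorem cayley_expSp (a : Fin n → ℝ) : cayley (siegelAct (expSp a) (basePoint n)) = tanhDiag a := by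
  have hn : numer (expSp a) = Matrix.diagonal fun i => Complex.I * (Real.exp (a i) : ℂ) := by
    ext i j
    by_cases hij : i = j
    · subst hij
      simp [numer, spA, spB, expSp, diagSp, Matrix.toBlocks₁₁, Matrix.toBlocks₁₂]
    · simp [numer, spA, spB, expSp, diagSp, Matrix.toBlocks₁₁, Matrix.toBlocks₁₂, hij]
  have hd : denom (expSp a) = Matrix.diagonal fun i => (Real.exp (-a i) : ℂ) := by
    ext i j
    by_cases hij : i = j
    · subst hij
      simp [denom, spC, spD, expSp, diagSp, Matrix.toBlocks₂₁, Matrix.toBlocks₂₂, Complex.exp_neg]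
    · simp [denom, spC, spD, expSp, diagSp, Matrix.toBlocks₂₁, Matrix.toBlocks₂₂, hij]
  have hP : numer (expSp a) + Complex.I • denom (expSp a) = Matrix.diagonal fun i =>
      Complex.I * ((Real.exp (a i) + Real.exp (-a i) : ℝ) : ℂ) := by
    rw [hn, hd, ← Matrix.diagonal_smul, Matrix.diagonal_add]
    congr 1
    ext i
    simp only [Pi.smul_apply, smul_eq_mul]
    push_cast
    ring
  have h : tanhDiag a * (numer (expSp a) + Complex.I • denom (expSp a)) =
      numer (expSp a) - Complex.I • denom (expSp a) := by
    rw [hP, hn, hd, ← Matrix.diagonal_smul, Matrix.diagonal_sub, tanhDiag,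
      Matrix.diagonal_mul_diagonal]
    congr 1
    ext i
    simp only [Pi.smul_apply, smul_eq_mul]
    rw [tanh_eq_exp_sub_div, mul_left_comm, ← Complex.ofReal_mul, div_mul_cancel₀ _ (by positivity)]
    push_cast
    ring
  rw [cayley_siegelAct, ← h, Matrix.mul_nonsing_inv_cancel_right _ _ (isUnit_det_numer_add _)]

/-- The polar coordinates of a point of the disc. -/
theorem cayley_mul_expSp {k : Sp n} (hk : k ∈ maxCompact n) (a : Fin n → ℝ) :
    cayley (siegelAct (k * expSp a) (basePoint n)) =
      unitaryPart k * tanhDiag a * (unitaryPart k)ᵀ := by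
  rw [cayley_mul_left hk, cayley_expSp]

theorem upperEntries_takagiMat (q : TakagiCoord n) :
    upperEntries (takagiMat q) = discCoord ((cayleyChart q.1 : Sp n) * expSp q.2) := by
  rw [discCoord, cayley_mul_expSp (cayleyChart q.1).2, unitaryPart_cayleyChart]
  rfl

theorem one_sub_takagi {u : Matrix (Fin n) (Fin n) ℂ} (hu : u * uᴴ = 1) (s : Fin n → ℝ) :
    1 - (u * Matrix.diagonal (fun i => (s i : ℂ)) * uᵀ)ᴴ *
        (u * Matrix.diagonal (fun i => (s i : ℂ)) * uᵀ) =
      uᵀᴴ * Matrix.diagonal (fun i => ((1 - s i ^ 2 : ℝ) : ℂ)) * uᵀ := by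
  have hu' : uᴴ * u = 1 := by rw [mul_eq_one_comm, hu]
  have hut : uᵀᴴ * uᵀ = 1 := by
    have h1 : (u * uᴴ)ᵀ = 1 := by rw [hu, Matrix.transpose_one]
    rw [Matrix.transpose_mul] at h1
    exact h1
  have hS : (Matrix.diagonal fun i => (s i : ℂ))ᴴ = Matrix.diagonal fun i => (s i : ℂ) := by
    rw [Matrix.diagonal_conjTranspose]
    congr 1
    ext i
    simp
  have hsq : Matrix.diagonal (fun i => ((1 - s i ^ 2 : ℝ) : ℂ)) =
      1 - Matrix.diagonal (fun i => (s i : ℂ)) * Matrix.diagonal fun i => (s i : ℂ) := by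
    rw [Matrix.diagonal_mul_diagonal, ← Matrix.diagonal_one, Matrix.diagonal_sub]
    congr 1
    ext i
    push_cast
    ring
  rw [hsq, Matrix.mul_sub, Matrix.sub_mul, Matrix.mul_one, hut, Matrix.conjTranspose_mul,
    Matrix.conjTranspose_mul, hS]
  simp only [Matrix.mul_assoc]
  rw [← Matrix.mul_assoc uᴴ, hu', Matrix.one_mul]

open scoped ComplexOrder in
/-- The Cartan decomposition. -/
theorem exists_cartan (g : Sp n) : ∃ (k : maxCompact n) (a : Fin n → ℝ), Monotone a ∧
    (∀ i, a i ≤ 0) ∧ discCoord g = discCoord ((k : Sp n) * expSp a) := by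
  obtain ⟨k, s, hs, hs0, hW⟩ := exists_takagi (cayley_siegelAct_isSymm g)
  set u := unitaryPart (k : Sp n) with hu
  have huu : u * uᴴ = 1 := unitaryPart_mul_conjTranspose k.2
  have hut : uᵀ * uᵀᴴ = 1 := by
    have h1 : (uᴴ * u)ᵀ = 1 := by rw [mul_eq_one_comm.1 huu, Matrix.transpose_one]
    rw [Matrix.transpose_mul] at h1
    exact h1
  have h1 := one_sub_cayley_siegelAct g
  have hpos : (1 - (cayley (siegelAct g (basePoint n)))ᴴ *
      cayley (siegelAct g (basePoint n))).PosDef := by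
    rw [h1]
    refine Matrix.PosDef.smul (Matrix.PosDef.conjTranspose_mul_self _ ?_) (by norm_num)
    exact Matrix.mulVec_injective_of_isUnit ((Matrix.isUnit_iff_isUnit_det _).2
      (Matrix.isUnit_nonsing_inv_det _ (isUnit_det_numer_add g)))
  have hs1 (i : Fin n) : -1 < s i := by
    have h2 := hpos.conjTranspose_mul_mul_same (B := uᵀᴴ)
      (Matrix.mulVec_injective_of_isUnit (IsUnit.of_mul_eq_one_right _ hut))
    rw [hW, one_sub_takagi huu, Matrix.conjTranspose_conjTranspose, Matrix.mul_assoc,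
      Matrix.mul_assoc, Matrix.mul_assoc, hut, Matrix.mul_one, ← Matrix.mul_assoc, hut,
      Matrix.one_mul] at h2
    have h3 := h2.diag_pos (i := i)
    rw [Matrix.diagonal_apply_eq, Complex.zero_lt_real] at h3
    nlinarith [hs0 i]
  have htanh (i : Fin n) : Real.tanh (Real.artanh (s i)) = s i :=
    Real.tanh_artanh ⟨hs1 i, (hs0 i).trans_lt one_pos⟩
  refine ⟨k, fun i => Real.artanh (s i), fun i j hij => ?_, fun i => ?_, ?_⟩
  · exact Real.artanh_le_artanh (hs1 i) ((hs0 j).trans_lt one_pos) (hs hij)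
  · exact Real.artanh_nonpos (hs0 i)
  · rw [discCoord, discCoord, cayley_mul_expSp k.2, hW, tanhDiag]
    simp only [htanh, hu]

theorem discDensity_takagiMat (q : TakagiCoord n) :
    discDensity (takagiMat q) =
      2 ^ (n * (n + 1)) * ((∏ i, (1 - Real.tanh (q.2 i) ^ 2)) ^ (n + 1))⁻¹ := by
  have hu := cayleyUnitary_mul_conjTranspose q.1
  rw [discDensity, takagiMat, tanhDiag, one_sub_takagi hu, Matrix.det_mul, Matrix.det_mul,
    Matrix.det_conjTranspose, Matrix.det_transpose, mul_right_comm, Complex.star_def,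
    Complex.conj_mul', norm_det_of_mul_conjTranspose hu, Complex.ofReal_one, one_pow, one_mul,
    Matrix.det_diagonal, ← Complex.ofReal_prod, Complex.ofReal_re]

theorem Real.strictMono_tanh : StrictMono Real.tanh := fun x y h =>
  (Real.artanh_lt_artanh_iff ⟨Real.neg_one_lt_tanh x, Real.tanh_lt_one x⟩
    ⟨Real.neg_one_lt_tanh y, Real.tanh_lt_one y⟩).1 (by rwa [Real.artanh_tanh, Real.artanh_tanh])

theorem Real.tanh_neg_of_neg {x : ℝ} (hx : x < 0) : Real.tanh x < 0 :=
  (Real.strictMono_tanh hx).trans_eq Real.tanh_zero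

theorem prod_upperPairs_eq_mul {M : Type*} [CommMonoid M] (f : UpperPairs n → M) :
    ∏ p, f p = (∏ p : StrictPairs n, f ⟨p.1, p.2.le⟩) * ∏ i, f ⟨(i, i), le_rfl⟩ := by
  rw [← (upperIndexEquiv n).prod_comp, Fintype.prod_sum_type]
  rfl

/-- The two forms of the Jacobian of polar coordinates. -/
theorem discDensity_mul_takagiWeight {a : Fin n → ℝ} (ha : a ∈ weylChamber n) (b : SkewCoord n) :
    discDensity (takagiMat (b, a)) * takagiWeight a = 2 ^ (n * (n + 1)) * sinhRootProduct a := by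
  have hc (i : Fin n) := Real.cosh_pos (a i)
  have hσ (i : Fin n) : Real.tanh (a i) < 0 := Real.tanh_neg_of_neg (ha.2 i)
  have hd (i : Fin n) : 1 - Real.tanh (a i) ^ 2 = (Real.cosh (a i) ^ 2)⁻¹ := by
    have := (hc i).ne'
    rw [Real.tanh_eq_sinh_div_cosh]
    field_simp
    exact Real.cosh_sq_sub_sinh_sq _
  have h1 (p : StrictPairs n) : Real.sinh (a p.1.2 - a p.1.1) * Real.sinh (-a p.1.1 - a p.1.2) =
      |Real.tanh (a p.1.2) ^ 2 - Real.tanh (a p.1.1) ^ 2| *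
        (Real.cosh (a p.1.1) ^ 2 * Real.cosh (a p.1.2) ^ 2) := by
    have h2 : Real.tanh (a p.1.2) ^ 2 - Real.tanh (a p.1.1) ^ 2 < 0 := by
      have h3 : Real.tanh (a p.1.1) < Real.tanh (a p.1.2) := Real.strictMono_tanh (ha.1 p.2)
      nlinarith [hσ p.1.1, hσ p.1.2]
    have h4 := (hc p.1.1).ne'
    have h5 := (hc p.1.2).ne'
    rw [abs_of_neg h2, show -a p.1.1 - a p.1.2 = -(a p.1.2 + a p.1.1) by ring, Real.sinh_neg,
      Real.sinh_add, Real.sinh_sub, Real.tanh_eq_sinh_div_cosh, Real.tanh_eq_sinh_div_cosh]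
    field_simp
    ring
  have h2 (i : Fin n) : Real.sinh (-a i - a i) = 2 * |Real.tanh (a i)| * Real.cosh (a i) ^ 2 := by
    have := (hc i).ne'
    rw [abs_of_neg (hσ i), show -a i - a i = -(2 * a i) by ring, Real.sinh_neg, Real.sinh_two_mul,
      Real.tanh_eq_sinh_div_cosh]
    field_simp
  have h3 := prod_upperPairs_mul fun i => Real.cosh (a i) ^ 2
  rw [prod_upperPairs_eq_mul] at h3
  have h5 : sinhRootProduct a = (∏ p : StrictPairs n,
      |Real.tanh (a p.1.2) ^ 2 - Real.tanh (a p.1.1) ^ 2| *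
        (Real.cosh (a p.1.1) ^ 2 * Real.cosh (a p.1.2) ^ 2)) *
      ∏ i, (2 * |Real.tanh (a i)| * Real.cosh (a i) ^ 2) := by
    rw [sinhRootProduct, prod_upperPairs_eq_mul, ← mul_assoc, ← Finset.prod_mul_distrib]
    exact congrArg₂ _ (Finset.prod_congr rfl fun p _ => h1 p)
      (Finset.prod_congr rfl fun i _ => h2 i)
  rw [discDensity_takagiMat, takagiWeight, h5]
  simp only [hd, Finset.prod_mul_distrib, Finset.prod_inv_distrib] at h3 ⊢
  rw [inv_pow, inv_inv, ← h3]
  have h4 : ∏ i, Real.cosh (a i) ^ 2 ≠ 0 :=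
    (Finset.prod_pos fun i _ => pow_pos (hc i) 2).ne'
  field_simp

end Disc

/-! ### The integral in polar coordinates -/

section Polar

variable {n : ℕ}

/-- The diagonal matrix of signs, as an element of the maximal compact subgroup. -/
noncomputable def signElt (ε : Fin n → ℤˣ) : maxCompact n :=
  ofUnitary (Matrix.diagonal fun i => ((ε i : ℤ) : ℂ)) (by
    rw [Matrix.diagonal_conjTranspose, Matrix.diagonal_mul_diagonal, ← Matrix.diagonal_one]
    congr 1
    ext i
    rcases Int.units_eq_one_or (ε i) with h | h <;> simp [h])

theorem unitaryPart_signElt (ε : Fin n → ℤˣ) :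
    unitaryPart (signElt ε : Sp n) = Matrix.diagonal fun i => ((ε i : ℤ) : ℂ) :=
  unitaryPart_ofUnitary _ _

theorem maxCompact_ext {k k' : maxCompact n}
    (h : unitaryPart (k : Sp n) = unitaryPart (k' : Sp n)) : k = k' :=
  Subtype.ext (unitaryPart_injOn k.2 k'.2 h)

theorem signElt_mul (ε ε' : Fin n → ℤˣ) : signElt ε * signElt ε' = signElt (ε * ε') := by
  refine maxCompact_ext ?_
  rw [Subgroup.coe_mul, unitaryPart_mul _ (signElt ε').2, unitaryPart_signElt, unitaryPart_signElt,
    unitaryPart_signElt, Matrix.diagonal_mul_diagonal]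
  congr 1
  ext i
  simp

theorem signElt_one : signElt (1 : Fin n → ℤˣ) = 1 := by
  refine maxCompact_ext ?_
  rw [unitaryPart_signElt, Subgroup.coe_one, unitaryPart_one, ← Matrix.diagonal_one]
  congr 1
  ext i
  simp

theorem signElt_mul_self (ε : Fin n → ℤˣ) : signElt ε * signElt ε = 1 := by
  rw [signElt_mul, ← signElt_one]
  congr 1
  ext i
  simp

theorem signElt_injective : Function.Injective (signElt (n := n)) := by
  intro ε ε' h
  have h1 := congrArg (fun k : maxCompact n => unitaryPart (k : Sp n)) h
  simp only [unitaryPart_signElt] at h1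
  ext i
  exact_mod_cast congrFun (Matrix.diagonal_injective h1) i

/-- A neighbourhood of the identity in the domain of the Cayley chart whose translates by the
diagonal matrices of signs are disjoint. -/
theorem exists_sign_transversal : ∃ O : Set (maxCompact n), IsOpen O ∧ 1 ∈ O ∧
    (∀ k ∈ O, IsUnit (1 + unitaryPart (k : Sp n)).det) ∧
    ∀ k ∈ O, ∀ ε : Fin n → ℤˣ, k * signElt ε ∈ O → ε = 1 := by
  have hU : IsOpen ((signElt '' {ε : Fin n → ℤˣ | ε ≠ 1})ᶜ) :=
    (Set.toFinite _).isClosed.isOpen_compl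
  have hV : IsOpen ((fun q : maxCompact n × maxCompact n => q.1⁻¹ * q.2) ⁻¹'
      (signElt '' {ε : Fin n → ℤˣ | ε ≠ 1})ᶜ) :=
    hU.preimage (continuous_fst.inv.mul continuous_snd)
  have h1 : ((1 : maxCompact n), (1 : maxCompact n)) ∈
      ((fun q : maxCompact n × maxCompact n => q.1⁻¹ * q.2) ⁻¹'
        (signElt '' {ε : Fin n → ℤˣ | ε ≠ 1})ᶜ) := by
    rintro ⟨ε, hε, h⟩
    simp only [inv_one, mul_one] at h
    exact hε (signElt_injective (h.trans signElt_one.symm))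
  obtain ⟨U₁, U₂, hU₁, hU₂, h₁, h₂, hsub⟩ := isOpen_prod_iff.1 hV 1 1 h1
  have hdet : IsOpen {k : maxCompact n | (1 + unitaryPart (k : Sp n)).det ≠ 0} :=
    isOpen_ne_fun (continuous_const.add continuous_unitaryPart).matrix_det continuous_const
  refine ⟨U₁ ∩ U₂ ∩ {k | (1 + unitaryPart (k : Sp n)).det ≠ 0}, (hU₁.inter hU₂).inter hdet,
    ⟨⟨h₁, h₂⟩, ?_⟩, fun k hk => isUnit_iff_ne_zero.2 hk.2, fun k hk ε hε => ?_⟩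
  · change (1 + unitaryPart (1 : Sp n)).det ≠ 0
    rw [unitaryPart_one, show (1 : Matrix (Fin n) (Fin n) ℂ) + 1 = (2 : ℂ) • 1 by
      rw [two_smul], Matrix.det_smul, Matrix.det_one, mul_one]
    exact pow_ne_zero _ two_ne_zero
  · by_contra hne
    have h3 := hsub (Set.mk_mem_prod hk.1.1 hε.1.2)
    exact h3 ⟨ε, hne, by simp⟩

theorem measurableSet_weylChamber : MeasurableSet (weylChamber n) := by
  have h : weylChamber n = (⋂ i : Fin n, ⋂ j : Fin n, ⋂ _ : i < j, {a | a i < a j}) ∩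
      ⋂ i : Fin n, {a | a i < 0} := by
    ext a
    simp [weylChamber, StrictMono]
  rw [h]
  exact (MeasurableSet.iInter fun i => MeasurableSet.iInter fun j => MeasurableSet.iInter fun _ =>
    measurableSet_lt (measurable_pi_apply i) (measurable_pi_apply j)).inter
    (MeasurableSet.iInter fun i => measurableSet_lt (measurable_pi_apply i) measurable_const)

/-- The union of the translates of a set by the diagonal matrices of signs. -/
def signSaturation (O : Set (maxCompact n)) : Set (maxCompact n) :=
  ⋃ ε : Fin n → ℤˣ, (fun k => k * signElt ε) ⁻¹' O

theorem measurableSet_signSaturation {O : Set (maxCompact n)} (hO : MeasurableSet O) :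
    MeasurableSet (signSaturation O) :=
  MeasurableSet.iUnion fun ε => (continuous_mul_const (signElt ε)).measurable hO

/-- The translates by the `2 ^ n` matrices of signs are disjoint and have equal measure. -/
theorem measure_signSaturation (κ : Measure (maxCompact n)) [κ.IsMulRightInvariant]
    {O : Set (maxCompact n)} (hO : MeasurableSet O)
    (hε : ∀ k ∈ O, ∀ ε : Fin n → ℤˣ, k * signElt ε ∈ O → ε = 1) :
    κ (signSaturation O) = 2 ^ n * κ O := by
  rw [signSaturation, measure_iUnion]
  · simp only [measure_preimage_mul_right]
    rw [tsum_fintype, Finset.sum_const, nsmul_eq_mul]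
    congr 1
    simp
  · intro ε ε' hne
    refine Set.disjoint_left.2 fun k hk hk' => hne ?_
    have h := hε _ hk (ε * ε') (by
      rw [mul_assoc, ← signElt_mul, ← mul_assoc (signElt ε), signElt_mul_self, one_mul]
      exact hk')
    have h2 : ε * ε = 1 := by
      ext i
      simp
    exact (mul_left_cancel (h2.trans h.symm))
  · exact fun ε => (continuous_mul_const (signElt ε)).measurable hO

/-- Two polar decompositions of the same point of the disc differ by signs. -/
theorem discCoord_mul_expSp_eq_iff {k k' : maxCompact n} {a a' : Fin n → ℝ}
    (ha : a ∈ weylChamber n) (ha' : a' ∈ weylChamber n) :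
    discCoord ((k : Sp n) * expSp a) = discCoord ((k' : Sp n) * expSp a') ↔
      a = a' ∧ ∃ ε : Fin n → ℤˣ, k * signElt ε = k' := by
  have hut (l : maxCompact n) := unitaryPart_mul_conjTranspose l.2
  have hcoord (l : maxCompact n) (c : Fin n → ℝ) :
      symMat (discCoord ((l : Sp n) * expSp c)) =
        unitaryPart (l : Sp n) * tanhDiag c * (unitaryPart (l : Sp n))ᵀ := by
    rw [symMat_discCoord, cayley_mul_expSp l.2]
  constructor
  · intro h
    have h1 := congrArg symMat h
    rw [hcoord, hcoord] at h1
    have hinv : unitaryPart ((k⁻¹ : maxCompact n) : Sp n) * unitaryPart (k : Sp n) = 1 := by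
      rw [← unitaryPart_mul _ k.2, ← Subgroup.coe_mul, inv_mul_cancel, Subgroup.coe_one,
        unitaryPart_one]
    have hinv' : (unitaryPart (k : Sp n))ᵀ * (unitaryPart ((k⁻¹ : maxCompact n) : Sp n))ᵀ = 1 := by
      rw [← Matrix.transpose_mul, hinv, Matrix.transpose_one]
    have h2 : unitaryPart ((k⁻¹ * k' : maxCompact n) : Sp n) * tanhDiag a' *
        (unitaryPart ((k⁻¹ * k' : maxCompact n) : Sp n))ᵀ = tanhDiag a := by
      rw [Subgroup.coe_mul, unitaryPart_mul _ k'.2, Matrix.transpose_mul]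
      calc _ = unitaryPart ((k⁻¹ : maxCompact n) : Sp n) *
          (unitaryPart (k' : Sp n) * tanhDiag a' * (unitaryPart (k' : Sp n))ᵀ) *
            (unitaryPart ((k⁻¹ : maxCompact n) : Sp n))ᵀ := by simp only [Matrix.mul_assoc]
        _ = (unitaryPart ((k⁻¹ : maxCompact n) : Sp n) * unitaryPart (k : Sp n)) * tanhDiag a *
            ((unitaryPart (k : Sp n))ᵀ * (unitaryPart ((k⁻¹ : maxCompact n) : Sp n))ᵀ) := by
          rw [← h1]
          simp only [Matrix.mul_assoc]
        _ = tanhDiag a := by rw [hinv, hinv', Matrix.one_mul, Matrix.mul_one]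
    obtain ⟨h3, ε, h4⟩ := takagi_unique (Real.strictMono_tanh.comp ha'.1)
      (Real.strictMono_tanh.comp ha.1) (fun i => Real.tanh_neg_of_neg (ha'.2 i))
      (fun i => Real.tanh_neg_of_neg (ha.2 i)) (hut (k⁻¹ * k')) h2
    refine ⟨funext fun i => Real.tanh_injective (congrFun h3 i).symm, ε, ?_⟩
    have h5 : k⁻¹ * k' = signElt ε := maxCompact_ext (by rw [h4, unitaryPart_signElt])
    rw [← h5, mul_inv_cancel_left]
  · rintro ⟨rfl, ε, rfl⟩
    refine symMat_injective ?_
    rw [hcoord, hcoord, Subgroup.coe_mul, unitaryPart_mul _ (signElt ε).2, Matrix.transpose_mul,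
      unitaryPart_signElt, Matrix.diagonal_transpose, tanhDiag]
    have h1 : Matrix.diagonal (fun i => ((ε i : ℤ) : ℂ)) *
        Matrix.diagonal (fun i => (Real.tanh (a i) : ℂ)) *
          Matrix.diagonal (fun i => ((ε i : ℤ) : ℂ)) =
        Matrix.diagonal fun i => (Real.tanh (a i) : ℂ) := by
      rw [Matrix.diagonal_mul_diagonal, Matrix.diagonal_mul_diagonal]
      congr 1
      ext i
      rcases Int.units_eq_one_or (ε i) with h | h <;> simp [h]
    nth_rewrite 1 [← h1]
    simp only [Matrix.mul_assoc]

instance TakagiCoord.isAddHaarMeasure :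
    (volume : Measure (TakagiCoord n)).IsAddHaarMeasure :=
  Measure.prod.instIsAddHaarMeasure (volume : Measure (SkewCoord n)) (volume : Measure (Fin n → ℝ))

/-- The Jacobian vanishes on the walls of the chamber. -/
theorem takagiWeight_eq_zero {a : Fin n → ℝ} (hm : Monotone a) (h0 : ∀ i, a i ≤ 0)
    (ha : a ∉ weylChamber n) : takagiWeight a = 0 := by
  by_cases h : ∀ i, a i < 0
  · have h1 : ¬ StrictMono a := fun hs => ha ⟨hs, h⟩
    rw [hm.strictMono_iff_injective, Function.Injective] at h1
    push Not at h1
    obtain ⟨i, j, hij, hne⟩ := h1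
    rw [takagiWeight]
    refine mul_eq_zero_of_left ?_ _
    rcases lt_or_gt_of_ne hne with h2 | h2
    · exact Finset.prod_eq_zero (Finset.mem_univ ⟨(i, j), h2⟩) (by simp [hij])
    · exact Finset.prod_eq_zero (Finset.mem_univ ⟨(j, i), h2⟩) (by simp [hij])
  · push Not at h
    obtain ⟨i, hi⟩ := h
    refine mul_eq_zero_of_right _ (Finset.prod_eq_zero (Finset.mem_univ i) ?_)
    rw [le_antisymm (h0 i) hi]
    simp

/-- Almost every element has regular polar coordinates. -/
theorem ae_exists_cartan (κ : Measure (maxCompact n)) [κ.IsHaarMeasure] [IsProbabilityMeasure κ] :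
    ∀ᵐ g ∂(iwasawaHaar κ), ∃ (k : maxCompact n) (a : Fin n → ℝ), a ∈ weylChamber n ∧
      discCoord g = discCoord ((k : Sp n) * expSp a) := by
  choose G hG hG' using fun q : TakagiCoord n => exists_hasFDerivAt_takagiMat q
  -- the walls of the chamber contribute a set of critical values
  set N : Set (UpperPairs n → ℂ) := (fun q : TakagiCoord n => upperEntries (takagiMat q)) ''
    {q | takagiWeight q.2 = 0} with hN
  have hN0 : volume N = 0 :=
    measure_image_eq_zero_of_measurePreserving measurePreserving_takagiLinear (fun q _ => hG q)
      fun q hq => by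
        have h := abs_det_takagiMat (hG' q)
        rw [hq, mul_zero] at h
        exact abs_eq_zero.1 h
  have hnull : iwasawaHaar κ (discCoord ⁻¹' N) = 0 := by
    set M := toMeasurable volume N
    have hM : MeasurableSet M := measurableSet_toMeasurable _ _
    have hMm : MeasurableSet (discCoord ⁻¹' M : Set (Sp n)) := continuous_discCoord.measurable hM
    refine measure_mono_null (Set.preimage_mono (subset_toMeasurable volume N)) ?_
    have h1 := lintegral_iwasawaHaar_discCoord (κ := κ) (G := M.indicator 1)
      ((measurable_one.indicator hM).comp continuous_discCoord.measurable)
    have h2 : (fun g : Sp n => M.indicator (1 : (UpperPairs n → ℂ) → ℝ≥0∞) (discCoord g)) =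
        (discCoord ⁻¹' M).indicator 1 := rfl
    have hM0 : volume M = 0 := (measure_toMeasurable N).trans hN0
    rw [h2, lintegral_indicator_one hMm] at h1
    rw [h1]
    refine lintegral_eq_zero_of_ae_eq_zero ?_
    have h3 : ∀ᵐ w ∂(volume.restrict (Set.range (discCoord (n := n)))), w ∉ M :=
      ae_restrict_of_ae (measure_eq_zero_iff_ae_notMem.1 hM0)
    filter_upwards [h3] with w hw
    rw [Set.indicator_of_notMem hw, zero_mul]
    rfl
  -- countably many translates of the Cayley chart cover the compact group
  obtain ⟨O, hO, hO1, hOdet, -⟩ := exists_sign_transversal (n := n)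
  obtain ⟨s, hs, hcover⟩ := TopologicalSpace.countable_cover_nhds
    (f := fun l : maxCompact n => (fun k => l⁻¹ * k) ⁻¹' O) fun l =>
      (hO.preimage (continuous_const_mul l⁻¹)).mem_nhds (by simpa using hO1)
  have hall : ∀ᵐ g ∂(iwasawaHaar κ), ∀ l ∈ s,
      discCoord (((l⁻¹ : maxCompact n) : Sp n) * g) ∉ N := by
    rw [ae_ball_iff hs]
    intro l _
    have h : iwasawaHaar κ
        ((fun g => ((l⁻¹ : maxCompact n) : Sp n) * g) ⁻¹' (discCoord ⁻¹' N)) = 0 := by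
      rw [measure_preimage_mul]
      exact hnull
    exact measure_eq_zero_iff_ae_notMem.1 h
  filter_upwards [hall] with g hg
  obtain ⟨k, a, hm, h0, hga⟩ := exists_cartan g
  refine ⟨k, a, ?_, hga⟩
  by_contra ha
  have hk : k ∈ ⋃ l ∈ s, (fun k => l⁻¹ * k) ⁻¹' O := by rw [hcover]; trivial
  simp only [Set.mem_iUnion] at hk
  obtain ⟨l, hl, hlk⟩ := hk
  obtain ⟨b, hb⟩ := exists_cayleyChart_eq (hOdet _ hlk)
  refine hg l hl ⟨(b, a), takagiWeight_eq_zero hm h0 ha, ?_⟩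
  simp only
  rw [upperEntries_takagiMat, hb]
  refine symMat_injective ?_
  have h1 := congrArg symMat hga
  rw [symMat_discCoord, symMat_discCoord] at h1 ⊢
  rw [Subgroup.coe_mul, mul_assoc, cayley_mul_left (l⁻¹).2, cayley_mul_left (l⁻¹).2, ← h1]

end Polar

section PolarIntegral

variable {n : ℕ}

instance borelSpace_takagiCoord : BorelSpace (TakagiCoord n) := Prod.borelSpace

theorem continuous_expSp : Continuous (expSp : (Fin n → ℝ) → Sp n) :=
  continuous_diagSp.comp (Continuous.subtype_mk
    (continuous_pi fun i => Real.continuous_exp.comp (continuous_apply i)) _)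

theorem continuous_sinhRootProduct : Continuous (sinhRootProduct : (Fin n → ℝ) → ℝ) := by
  unfold sinhRootProduct
  fun_prop

theorem sinhRootProduct_nonneg {a : Fin n → ℝ} (ha : a ∈ weylChamber n) :
    0 ≤ sinhRootProduct a := by
  refine mul_nonneg (Finset.prod_nonneg fun p _ => ?_) (Finset.prod_nonneg fun p _ => ?_)
  · exact Real.sinh_nonneg_iff.2 (sub_nonneg.2 (ha.1 p.2).le)
  · exact Real.sinh_nonneg_iff.2 (by linarith [ha.2 p.1.1, ha.2 p.1.2])

/-- The integral of a bi-invariant function in polar coordinates. It is computed on the set `E` of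
the elements with polar coordinates in a small set `O` of the compact group and in the chamber.
Almost every orbit meets `E` in a translate of the saturation of `O` by signs, of measure
`2 ^ n * κ O`; on `E` polar coordinates are injective and the Cayley chart applies, which gives the
integral over the chamber times the volume of `O` in the chart. -/
theorem lintegral_iwasawaHaar_polar (κ : Measure (maxCompact n)) [κ.IsHaarMeasure]
    [IsProbabilityMeasure κ] {F : Sp n → ℝ≥0∞} (hF : Measurable F)
    (hl : ∀ (k : maxCompact n) g, F (k * g) = F g) (hr : ∀ g (k : maxCompact n), F (g * k) = F g) :
    ∫⁻ g, F g ∂(iwasawaHaar κ) =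
      ENNReal.ofReal (2 ^ (n * (n + 1)) * Real.pi ^ (n * (n + 1) / 2) /
        ∏ i : Fin n, ((i : ℕ).factorial : ℝ)) *
      ∫⁻ a in weylChamber n, ENNReal.ofReal (sinhRootProduct a) * F (expSp a) := by
  have := isMulRightInvariant_of_isProbabilityMeasure κ
  obtain ⟨O, hO, hO1, hOdet, hOε⟩ := exists_sign_transversal (n := n)
  have hOm := hO.measurableSet
  set B := cayleyChart ⁻¹' O with hB
  have hBm : MeasurableSet B := continuous_cayleyChart.measurable hOm
  set D := weylChamber n with hD
  have hDm : MeasurableSet D := measurableSet_weylChamber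
  let ψ : TakagiCoord n → (UpperPairs n → ℂ) := fun q => upperEntries (takagiMat q)
  choose G hG hG' using fun q : TakagiCoord n => exists_hasFDerivAt_takagiMat q
  have hinj : Set.InjOn ψ (B ×ˢ D) := by
    rintro ⟨b, a⟩ ⟨hb, ha⟩ ⟨b', a'⟩ ⟨hb', ha'⟩ h
    simp only [ψ, upperEntries_takagiMat] at h
    obtain ⟨rfl, ε, hε⟩ := (discCoord_mul_expSp_eq_iff ha ha').1 h
    have h1 : cayleyChart b * signElt ε ∈ O := by
      rw [hε]
      exact hb'
    rw [hOε _ hb ε h1, signElt_one, mul_one] at hε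
    rw [cayleyChart_injective hε]
  have hψm : MeasurableSet (ψ '' (B ×ˢ D)) := by
    have h := (measurableEmbedding_of_measurePreserving (hBm.prod hDm) (fun q _ => hG q)
      hinj (takagiLinear n)).measurableSet_range
    rwa [Set.range_domRestrict] at h
  set E : Set (Sp n) := discCoord ⁻¹' (ψ '' (B ×ˢ D)) with hE
  have hEm : MeasurableSet E := continuous_discCoord.measurable hψm
  -- the orbit of a regular point meets `E` in a translate of the saturation of `O`
  have hcov : ∀ᵐ g ∂(iwasawaHaar κ), ∃ k₀ : maxCompact n, ∀ k : maxCompact n,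
      (k : Sp n) * g ∈ E ↔ k * k₀ ∈ signSaturation O := by
    filter_upwards [ae_exists_cartan κ] with g hg
    obtain ⟨k₀, a, ha, hga⟩ := hg
    refine ⟨k₀, fun k => ?_⟩
    have h1 : discCoord ((k : Sp n) * g) =
        discCoord (((k * k₀ : maxCompact n) : Sp n) * expSp a) := by
      rw [discCoord_eq_iff] at hga ⊢
      simpa only [Subgroup.coe_mul, mul_inv_rev, mul_assoc, inv_mul_cancel_left] using hga
    rw [hE, Set.mem_preimage, h1, signSaturation, Set.mem_iUnion]
    constructor
    · rintro ⟨⟨b, a'⟩, ⟨hb, ha'⟩, h⟩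
      simp only [ψ, upperEntries_takagiMat] at h
      obtain ⟨-, ε, hε⟩ := (discCoord_mul_expSp_eq_iff ha ha').1 h.symm
      refine ⟨ε, ?_⟩
      rw [Set.mem_preimage, hε]
      exact hb
    · rintro ⟨ε, hε⟩
      obtain ⟨b, hb⟩ := exists_cayleyChart_eq (hOdet _ hε)
      refine ⟨(b, a), ⟨?_, ha⟩, ?_⟩
      · change cayleyChart b ∈ O
        rwa [hb]
      · simp only [ψ, upperEntries_takagiMat]
        rw [hb]
        exact ((discCoord_mul_expSp_eq_iff ha ha).2 ⟨rfl, ε, rfl⟩).symm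
  have h1 := lintegral_mul_measure_eq_setLIntegral κ (ν := iwasawaHaar κ)
    (ρ := fun (k : maxCompact n) (g : Sp n) => (k : Sp n) * g)
    ((continuous_subtype_val.comp continuous_fst).mul continuous_snd).measurable
    (fun k => measurePreserving_mul_left _ _) hEm (measurableSet_signSaturation hOm) hcov hF hl
  rw [measure_signSaturation κ hOm hOε] at h1
  -- the function in the coordinates of the disc
  obtain ⟨f, hf⟩ : ∃ f : (UpperPairs n → ℂ) → ℝ≥0∞, ∀ g, f (discCoord g) = F g := by
    classical
    refine ⟨fun w => if h : ∃ g : Sp n, discCoord g = w then F h.choose else 0, fun g => ?_⟩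
    have h : ∃ g' : Sp n, discCoord g' = discCoord g := ⟨g, rfl⟩
    refine (dif_pos h).trans ?_
    have h2 := discCoord_eq_iff.1 h.choose_spec
    have h3 := hr h.choose ⟨_, h2⟩
    rw [← h3]
    simp
  have h2 : ∫⁻ g in E, F g ∂(iwasawaHaar κ) =
      ∫⁻ w in ψ '' (B ×ˢ D), f w * ENNReal.ofReal (discDensity (symMat w)) := by
    have h3 (g : Sp n) : (ψ '' (B ×ˢ D)).indicator f (discCoord g) = E.indicator F g := by
      by_cases hg : g ∈ E
      · rw [Set.indicator_of_mem hg, Set.indicator_of_mem (s := ψ '' (B ×ˢ D)) hg, hf]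
      · rw [Set.indicator_of_notMem hg, Set.indicator_of_notMem (s := ψ '' (B ×ˢ D)) hg]
    have h4 := lintegral_iwasawaHaar_discCoord (κ := κ) (G := (ψ '' (B ×ˢ D)).indicator f) (by
      simp only [h3]
      exact hF.indicator hEm)
    simp only [h3] at h4
    rw [lintegral_indicator hEm] at h4
    have h5 : ψ '' (B ×ˢ D) ⊆ Set.range (discCoord (n := n)) := by
      rintro _ ⟨q, -, rfl⟩
      exact ⟨_, (upperEntries_takagiMat q).symm⟩
    have h6 (w) : (ψ '' (B ×ˢ D)).indicator f w * ENNReal.ofReal (discDensity (symMat w)) =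
        (ψ '' (B ×ˢ D)).indicator (fun w => f w * ENNReal.ofReal (discDensity (symMat w))) w := by
      by_cases hw : w ∈ ψ '' (B ×ˢ D)
      · rw [Set.indicator_of_mem hw, Set.indicator_of_mem hw]
      · rw [Set.indicator_of_notMem hw, Set.indicator_of_notMem hw, zero_mul]
    simp only [h6] at h4
    rw [h4, setLIntegral_indicator hψm, Set.inter_eq_left.2 h5]
  rw [h2, lintegral_image_eq_of_measurePreserving measurePreserving_takagiLinear (hBm.prod hDm)
    (fun q _ => hG q) hinj] at h1
  have h3 : ∀ q ∈ B ×ˢ D,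
      ENNReal.ofReal |(((takagiLinear n).symm : (UpperPairs n → ℂ) →L[ℝ] TakagiCoord n).comp
        (G q)).det| * (f (ψ q) * ENNReal.ofReal (discDensity (symMat (ψ q)))) =
      ENNReal.ofReal (cayleyWeight q.1) * (ENNReal.ofReal (2 ^ (n * (n + 1))) *
        (ENNReal.ofReal (sinhRootProduct q.2) * F (expSp q.2))) := by
    rintro ⟨b, a⟩ ⟨-, ha⟩
    have h4 : f (ψ (b, a)) = F (expSp a) := by
      simp only [ψ, upperEntries_takagiMat]
      rw [hf, hl]
    have h5 : 0 ≤ takagiWeight a :=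
      mul_nonneg (Finset.prod_nonneg fun _ _ => abs_nonneg _) (Finset.prod_nonneg fun i _ =>
        mul_nonneg (mul_nonneg two_pos.le (abs_nonneg _)) (sub_pos.2 (Real.tanh_sq_lt_one _)).le)
    rw [abs_det_takagiMat (hG' _), h4, ENNReal.ofReal_mul (cayleyWeight_pos _).le, mul_assoc,
      symMat_upperEntries (takagiMat_isSymm _), mul_left_comm (ENNReal.ofReal (takagiWeight _)),
      ← ENNReal.ofReal_mul h5, mul_comm (takagiWeight _), discDensity_mul_takagiWeight ha,
      ENNReal.ofReal_mul (by positivity)]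
    ring
  rw [setLIntegral_congr_fun (hBm.prod hDm) h3] at h1
  have hw : Measurable fun b : SkewCoord n => ENNReal.ofReal (cayleyWeight b) :=
    (ENNReal.continuous_ofReal.comp continuous_cayleyWeight).measurable
  have hsF : Measurable fun a : Fin n → ℝ => ENNReal.ofReal (sinhRootProduct a) * F (expSp a) :=
    continuous_sinhRootProduct.measurable.ennreal_ofReal.mul (hF.comp continuous_expSp.measurable)
  have h4 := lintegral_prod_mul (μ := volume.restrict B) (ν := volume.restrict D) hw.aemeasurable
    (hsF.const_mul (ENNReal.ofReal (2 ^ (n * (n + 1))))).aemeasurable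
  rw [Measure.prod_restrict] at h4
  have h5 := h1.trans h4
  rw [lintegral_cayleyWeight κ hOm hOdet, lintegral_const_mul _ hsF] at h5
  have hκ0 : κ O ≠ 0 := (hO.measure_pos κ ⟨1, hO1⟩).ne'
  have hc0 : 2 ^ n * κ O ≠ 0 := mul_ne_zero (pow_ne_zero _ two_ne_zero) hκ0
  have hct : 2 ^ n * κ O ≠ ⊤ :=
    ENNReal.mul_ne_top (ENNReal.pow_ne_top ENNReal.ofNat_ne_top) (measure_ne_top κ O)
  refine (ENNReal.mul_left_inj hc0 hct).1 (h5.trans ?_)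
  rw [show 2 ^ (n * (n + 1)) * Real.pi ^ (n * (n + 1) / 2) / ∏ i : Fin n, ((i : ℕ).factorial : ℝ) =
      2 ^ (n * (n + 1)) * (Real.pi ^ (n * (n + 1) / 2) / ∏ i : Fin n, ((i : ℕ).factorial : ℝ)) by
        ring,
    show 2 ^ n * Real.pi ^ (n * (n + 1) / 2) / ∏ i : Fin n, ((i : ℕ).factorial : ℝ) =
      2 ^ n * (Real.pi ^ (n * (n + 1) / 2) / ∏ i : Fin n, ((i : ℕ).factorial : ℝ)) by ring,
    ENNReal.ofReal_mul (by positivity), ENNReal.ofReal_mul (by positivity),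
    ENNReal.ofReal_pow two_pos.le n, ENNReal.ofReal_ofNat]
  ring

end PolarIntegral

/-! ### The `KAK` integration formula -/

section KAK

variable {n : ℕ}

/-- The constant of the `KAK` integration formula. -/
theorem kakConstant_eq :
    2 ^ (n * (n + 1)) * Real.pi ^ (n * (n + 1) / 2) / ∏ i : Fin n, ((i : ℕ).factorial : ℝ) =
      (4 * Real.pi) ^ (n * (n + 1) / 2) / ∏ m ∈ Finset.Icc 1 n, ((m - 1).factorial : ℝ) := by
  congr 1
  · obtain ⟨k, hk⟩ := (Nat.even_mul_succ_self n).two_dvd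
    rw [hk, Nat.mul_div_cancel_left _ two_pos, mul_pow, pow_mul]
    norm_num
  · rw [Fin.prod_univ_eq_prod_range fun i => (i.factorial : ℝ)]
    induction n with
    | zero => simp
    | succ n ih => rw [Finset.prod_range_succ, ih, Finset.prod_Icc_succ_top (by omega),
        Nat.add_sub_cancel]

/-- The integral does not change if the function is replaced by its bi-invariant mean, to which the
formula in polar coordinates applies. -/
theorem lintegral_iwasawaHaar_kak (κ : Measure (maxCompact n)) [κ.IsHaarMeasure]
    [IsProbabilityMeasure κ] {φ : Sp n → ℝ} (hφ : Continuous φ) :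
    ∫⁻ g, ENNReal.ofReal (φ g) ∂(iwasawaHaar κ) =
      ENNReal.ofReal ((4 * Real.pi) ^ (n * (n + 1) / 2) /
        ∏ m ∈ Finset.Icc 1 n, ((m - 1).factorial : ℝ)) *
      ∫⁻ k₂ : maxCompact n, (∫⁻ a in weylChamber n, (∫⁻ k₁ : maxCompact n,
        ENNReal.ofReal (sinhRootProduct a * φ ((k₁ : Sp n) * expSp a * (k₂ : Sp n))) ∂κ)) ∂κ := by
  have := isMulRightInvariant_of_isProbabilityMeasure κ
  set Φ : Sp n → ℝ≥0∞ := fun g => ENNReal.ofReal (φ g) with hΦ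
  have hΦm : Measurable Φ := hφ.measurable.ennreal_ofReal
  -- averaging over left translations, then over right translations
  set H : Sp n → ℝ≥0∞ := fun g => ∫⁻ k₁ : maxCompact n, Φ (k₁ * g) ∂κ with hH
  have hHm : Measurable H := (hΦm.comp ((continuous_subtype_val.comp continuous_snd).mul
    continuous_fst).measurable).lintegral_prod_right'
  have hHl (k : maxCompact n) (g : Sp n) : H (k * g) = H g := by
    have h := lintegral_mul_right_eq_self (μ := κ) (fun k₁ : maxCompact n => Φ (k₁ * g)) k
    simpa only [Subgroup.coe_mul, mul_assoc] using h
  set F : Sp n → ℝ≥0∞ := fun g => ∫⁻ k₂ : maxCompact n, H (g * k₂) ∂κ with hF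
  have hFm : Measurable F := (hHm.comp (continuous_fst.mul
    (continuous_subtype_val.comp continuous_snd)).measurable).lintegral_prod_right'
  have hFl (k : maxCompact n) (g : Sp n) : F (k * g) = F g := by
    simp only [hF, mul_assoc, hHl]
  have hFr (g : Sp n) (k : maxCompact n) : F (g * k) = F g := by
    have h := lintegral_mul_left_eq_self (μ := κ) (fun k₂ : maxCompact n => H (g * k₂)) k
    simpa only [Subgroup.coe_mul, ← mul_assoc] using h
  have h1 : ∫⁻ g, Φ g ∂(iwasawaHaar κ) = ∫⁻ g, F g ∂(iwasawaHaar κ) := by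
    rw [← lintegral_iwasawaHaar_mul_right hHm, hH, lintegral_lintegral_swap]
    · simp only [lintegral_mul_left_eq_self, lintegral_const, measure_univ, mul_one]
    · exact (hΦm.comp ((continuous_subtype_val.comp continuous_snd).mul
        continuous_fst).measurable).aemeasurable
  rw [h1, lintegral_iwasawaHaar_polar κ hFm hFl hFr, kakConstant_eq]
  congr 1
  have h2 : ∀ a ∈ weylChamber n, ENNReal.ofReal (sinhRootProduct a) * F (expSp a) =
      ∫⁻ k₂ : maxCompact n, (∫⁻ k₁ : maxCompact n,
        ENNReal.ofReal (sinhRootProduct a * φ ((k₁ : Sp n) * expSp a * (k₂ : Sp n))) ∂κ) ∂κ := by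
    intro a ha
    have hm₂ : Measurable fun k₂ : maxCompact n => H (expSp a * k₂) :=
      hHm.comp (continuous_const.mul continuous_subtype_val).measurable
    refine (lintegral_const_mul _ hm₂).symm.trans (lintegral_congr fun k₂ => ?_)
    have hm₁ : Measurable fun k₁ : maxCompact n => Φ (k₁ * (expSp a * (k₂ : Sp n))) :=
      hΦm.comp (continuous_subtype_val.mul continuous_const).measurable
    refine (lintegral_const_mul _ hm₁).symm.trans (lintegral_congr fun k₁ => ?_)
    rw [ENNReal.ofReal_mul (sinhRootProduct_nonneg ha), mul_assoc (k₁ : Sp n)]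
  rw [setLIntegral_congr_fun measurableSet_weylChamber h2, lintegral_lintegral_swap]
  have hc : Continuous fun q : ((Fin n → ℝ) × maxCompact n) × maxCompact n =>
      sinhRootProduct q.1.1 * φ ((q.2 : Sp n) * expSp q.1.1 * (q.1.2 : Sp n)) :=
    (continuous_sinhRootProduct.comp (continuous_fst.comp continuous_fst)).mul
      (hφ.comp (((continuous_subtype_val.comp continuous_snd).mul
        (continuous_expSp.comp (continuous_fst.comp continuous_fst))).mul
          (continuous_subtype_val.comp (continuous_snd.comp continuous_fst))))
  exact (hc.measurable.ennreal_ofReal.lintegral_prod_right').aemeasurable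

/-- The integral of a bump function is positive and finite, so that at most one constant is
possible. -/
theorem isKAKConstant_iwasawaHaar_iff (κ : Measure (maxCompact n)) [κ.IsHaarMeasure]
    [IsProbabilityMeasure κ] {α : ℝ} (hα : 0 < α) :
    IsKAKConstant (iwasawaHaar κ) κ α ↔
      α = (4 * Real.pi) ^ (n * (n + 1) / 2) /
        ∏ m ∈ Finset.Icc 1 n, ((m - 1).factorial : ℝ) := by
  constructor
  · intro h
    -- a test function with positive and finite integral
    obtain ⟨f, hf, hf0, hf1⟩ := exists_continuous_nonneg_pos (1 : Sp n)
    have hpos : 0 < ∫ g, f g ∂(iwasawaHaar κ) :=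
      f.continuous.integral_pos_of_hasCompactSupport_nonneg_nonzero hf hf0 hf1
    have hint := f.continuous.integrable_of_hasCompactSupport (μ := iwasawaHaar κ) hf
    have h1 := h f f.continuous hf0
    have h2 := lintegral_iwasawaHaar_kak κ f.continuous
    rw [← ofReal_integral_eq_lintegral_ofReal hint (Filter.Eventually.of_forall hf0)] at h1 h2
    set R := ∫⁻ k₂ : maxCompact n, (∫⁻ a in weylChamber n, (∫⁻ k₁ : maxCompact n,
      ENNReal.ofReal (sinhRootProduct a * f ((k₁ : Sp n) * expSp a * (k₂ : Sp n))) ∂κ)) ∂κ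
    have hR0 : R ≠ 0 := by
      intro hR
      rw [hR, mul_zero, ENNReal.ofReal_eq_zero] at h1
      exact hpos.not_ge h1
    have hRt : R ≠ ⊤ := by
      intro hR
      rw [hR, ENNReal.mul_top (ENNReal.ofReal_pos.2 hα).ne'] at h1
      exact ENNReal.ofReal_ne_top h1
    have h3 := (ENNReal.mul_left_inj hR0 hRt).1 (h1.symm.trans h2)
    exact (ENNReal.ofReal_eq_ofReal_iff hα.le (by positivity)).1 h3
  · rintro rfl φ hφ -
    exact lintegral_iwasawaHaar_kak κ hφ

end KAK

theorem propositionA1 (n : ℕ) (hn : 0 < n)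
    (κ : Measure (maxCompact n)) [κ.IsHaarMeasure] [IsProbabilityMeasure κ] :
    (∃! μ : Measure (Sp n), IsClassicalHaar μ) ∧
    ∀ μ : Measure (Sp n), IsClassicalHaar μ →
      -- the constant in the KAK integration formula
      (∀ α : ℝ, 0 < α →
        (IsKAKConstant μ κ α ↔
          α = (4 * Real.pi) ^ (n * (n + 1) / 2) /
            ∏ m ∈ Finset.Icc 1 n, ((m - 1).factorial : ℝ))) ∧
      -- the Iwasawa integration formula, for measurable functions with values in `[0, ∞]`
      (∀ F : Sp n → ℝ≥0∞, Measurable F →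
        ∫⁻ g, F g ∂μ =
          2 ^ n * ∫⁻ a : PosVec n, (∫⁻ p : (StrictPairs n → ℝ) × (UpperPairs n → ℝ),
            (∫⁻ k : maxCompact n, F (diagSp a * unipotentSp p * (k : Sp n)) ∂κ)) ∂(diagMeasure n)) ∧
      -- the Iwasawa integration formula, for integrable functions
      (∀ F : Sp n → ℂ, Integrable F μ →
        ∫ g, F g ∂μ =
          2 ^ n * ∫ a : PosVec n, (∫ p : (StrictPairs n → ℝ) × (UpperPairs n → ℝ),
            (∫ k : maxCompact n, F (diagSp a * unipotentSp p * (k : Sp n)) ∂κ)) ∂(diagMeasure n)) := by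
  refine ⟨⟨iwasawaHaar κ, isClassicalHaar_iwasawaHaar, fun μ hμ => hμ.eq_iwasawaHaar⟩,
    fun μ hμ => ?_⟩
  rw [hμ.eq_iwasawaHaar (κ := κ)]
  exact ⟨fun α hα => isKAKConstant_iwasawaHaar_iff κ hα, fun F hF => lintegral_iwasawaHaar hF,
    fun F hF => integral_iwasawaHaar hF⟩
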